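/- **Setting.** Let $M$ be an $n$-dimensional (complex analytic) generalized Frobenius manifold with non-flat unity: it has a flat metric $\eta=\langle\ ,\ \rangle$ with Levi-Civita connection $\nabla$, an analytic commutative associative product on tangent spaces with unit vector field $e$, $\nabla e\neq 0$, such that $\langle X\cdot Y,Z\rangle=\langle X,Y\cdot Z\rangle$ and $(\nabla_W c)(X,Y,Z)$ is totally symmetric for $c(X,Y,Z)=\langle X\cdot Y,Z\rangle$, and an Euler vector field $E$ with $\nabla^2E=0$, $\mathrm{Lie}_E(\cdot)=\cdot$ and $\mathrm{Lie}_E\eta=(2-d)\eta$. Fix flat coordinates $v=(v^1,\dots,v^n)$, ranging over an open subset of $\mathbb C^n$, and write $\partial_\alpha=\partial/\partial v^\alpha$, $\partial^\alpha=\eta^{\alpha\beta}\partial_\beta$, $\mathcal U=E\,\cdot$, $\mu=\frac{2-d}2-\nabla E$, $g^{\alpha\beta}=\eta^{\alpha\gamma}\mathcal U^\beta_\gamma$. Assume $M$ is semisimple, i.e. the algebra $T_vM$ is semisimple for generic $v$. A basis of periods on $D\times W$ ($D\subset M$ and $W\subset\mathbb C$ open, $W\ne\emptyset$, $\det(g-\lambda\eta^{-1})\neq0$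 there) consists of analytic functions $p_1(v;\lambda),\dots,p_n(v;\lambda)$ with linearly independent differentials, which are flat coordinates of the metric $(g^{\alpha\beta}-\lambda\eta^{\alpha\beta})^{-1}$ and satisfy $(\mathcal U-\lambda)\partial_\lambda\nabla p=(\mu+\frac12)\nabla p$, where $\nabla p$ is the gradient for $\eta$; $(G^{\alpha\beta})$ denotes the inverse of the matrix of the pairings $(dp_\alpha,dp_\beta)$ for the contravariant metric $g-\lambda\eta^{-1}$. On the jet space $J^\infty(M)$, with coordinates $v^{\gamma,s}=\partial_x^sv^\gamma$, put $$K^{\gamma,s}=(s+1)\,\partial_x^s\Big(\frac1{E-\lambda e}\Big)^{\gamma}+\sum_{k=1}^sk\binom{s+1}{k+1}\big(\partial_x^{s-k}\partial^\gamma p_\alpha\big)G^{\alpha\beta}\big(\partial_\lambda\partial_x^kp_\beta\big).$$ Let $\Omega\subset J^\infty(M)$ be a connected open set (in the product topology), and consider series $\Delta\mathcal F=\sum_{k\ge1}\varepsilon^{k-2}\mathcal F^{[k]}$ in which every $\mathcal F^{[k]}=\mathcal F^{[k]}(v,v_x,\dots,v^{(N_k)})$ is an analytic function on $\Omega$ of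 finitely many jet variables. The loop equation is the identity of formal Laurent series in $\varepsilon$ $$\sum_{s\ge0}\frac{\partial\Delta\mathcal F}{\partial v^{\gamma,s}}K^{\gamma,s}=\frac{\varepsilon^2}2\sum_{k,\ell\ge0}\Big(\frac{\partial\Delta\mathcal F}{\partial v^{\alpha,k}}\frac{\partial\Delta\mathcal F}{\partial v^{\beta,\ell}}+\frac{\partial^2\Delta\mathcal F}{\partial v^{\alpha,k}\partial v^{\beta,\ell}}\Big)(\partial_x^{k+1}\partial^\alpha p_\sigma)G^{\sigma\rho}(\partial_x^{\ell+1}\partial^\beta p_\rho)$$ $$+\frac{\varepsilon^2}2\sum_{k\ge0}\frac{\partial\Delta\mathcal F}{\partial v^{\alpha,k}}\,\partial_x^{k+1}\Big[\nabla\frac{\partial p_\sigma}{\partial\lambda}\cdot\nabla\frac{\partial p_\rho}{\partial\lambda}\cdot v_x\Big]^\alpha G^{\sigma\rho}+\frac12G^{\alpha\beta}\frac{\partial p_\alpha}{\partial\lambda}*\frac{\partial p_\beta}{\partial\lambda}-\frac1{4\lambda^2}\mathrm{tr}\Big(\frac14-\mu^2\Big),$$ required at all jets in $\Omega$ and identically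 in $\lambda$, with respect to fixed local bases of periods whose domains $D$ cover $M$. Here the star product, characterized by $\nabla(f*g)=\nabla f\cdot\nabla g$ together with its normalization, enters through $$G^{\alpha\beta}\frac{\partial p_\alpha}{\partial\lambda}*\frac{\partial p_\beta}{\partial\lambda}=-\frac12G^{\alpha\beta}\Big(d\frac{\partial p_\alpha}{\partial\lambda},d\frac{\partial p_\beta}{\partial\lambda}\Big)_{g-\lambda\eta^{-1}}+\frac1{2\lambda^2}\mathrm{tr}\Big(\frac14-\mu^2\Big).$$ **Theorem.** Let $M$ and $\Omega$ be as above. 1. If $\Delta\mathcal F=\sum_{k\ge1}\varepsilon^{k-2}\mathcal F^{[k]}$ is a solution of the loop equation on $\Omega$, then $\mathcal F^{[2k-1]}$ is constant on $\Omega$ for every $k\ge1$; consequently, up to additive constants, $\Delta\mathcal F$ is the genus expansion $\sum_{g\ge1}\varepsilon^{2g-2}\mathcal F_g$ with $\mathcal F_g=\mathcal F^{[2g]}$, and this expansion is again a solution. 2. The solution is unique up to additive constants: if $\sum_{k\ge1}\varepsilon^{k-2}\mathcal F^{[k]}$ and $\sum_{k\ge1}\varepsilon^{k-2}\tilde{\mathcal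 F}^{[k]}$ are two solutions on $\Omega$, then $\tilde{\mathcal F}^{[k]}-\mathcal F^{[k]}$ is constant on $\Omega$ for every $k\ge1$. -/

import Mathlib

noncomputable section

namespace GenFrob

/-- Coordinate vectors in `ℂⁿ`; points and tangent vectors are written in flat coordinates. -/
abbrev V (n : ℕ) : Type := Fin n → ℂ

/-- The partial derivative `∂f/∂v^α` at `v`. -/
def pd {n : ℕ} (α : Fin n) (f : V n → ℂ) (v : V n) : ℂ :=
  fderiv ℂ f v (Pi.single α 1)

/-- A generalized Frobenius manifold of dimension `n` with non-flat unity, written in a system of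
flat coordinates `v^1, …, v^n` that range over the open set `domain`.
`η α β = ⟨∂_α, ∂_β⟩`, `∂_α · ∂_β = ∑ γ, c v α β γ ∂_γ`, `e` is the unit vector field, `E` the Euler
vector field and `d` the charge. -/
structure GFM (n : ℕ) where
  domain : Set (V n)
  isOpen_domain : IsOpen domain
  /-- the flat metric -/
  η : Matrix (Fin n) (Fin n) ℂ
  η_symm : η.IsSymm
  η_nondeg : IsUnit η.det
  /-- the structure functions of the multiplication -/
  c : V n → Fin n → Fin n → Fin n → ℂ
  c_analytic : ∀ α β γ, AnalyticOnNhd ℂ (fun v => c v α β γ) domain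
  c_comm : ∀ v ∈ domain, ∀ α β γ, c v α β γ = c v β α γ
  c_assoc : ∀ v ∈ domain, ∀ α β γ δ,
    ∑ ε, c v α β ε * c v ε γ δ = ∑ ε, c v β γ ε * c v α ε δ
  /-- `⟨∂_α · ∂_β, ∂_γ⟩ = ⟨∂_β, ∂_α · ∂_γ⟩` -/
  c_frobenius : ∀ v ∈ domain, ∀ α β γ,
    ∑ δ, c v α β δ * η δ γ = ∑ δ, c v α γ δ * η β δ
  /-- the tensor `∇_δ ⟨∂_α · ∂_β, ∂_γ⟩` is symmetric in `δ` and `α` (hence totally symmetric) -/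
  c_potential : ∀ v ∈ domain, ∀ α β γ δ,
    pd δ (fun w => ∑ ε, c w α β ε * η ε γ) v = pd α (fun w => ∑ ε, c w δ β ε * η ε γ) v
  /-- the unit vector field -/
  e : V n → V n
  e_analytic : AnalyticOnNhd ℂ e domain
  e_unit : ∀ v ∈ domain, ∀ β γ, ∑ α, e v α * c v α β γ = if β = γ then 1 else 0
  /-- the unit vector field is not flat: `∇ e ≠ 0` -/
  e_nonflat : ∃ v ∈ domain, ∃ α γ, pd α (fun w => e w γ) v ≠ 0
  /-- the Euler vector field -/
  E : V n → V n
  E_analytic : AnalyticOnNhd ℂ E domain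
  /-- `∇² E = 0` -/
  E_affine : ∀ v ∈ domain, ∀ α β γ, pd α (pd β (fun w => E w γ)) v = 0
  /-- the charge -/
  d : ℂ
  /-- `Lie_E (·) = ·` -/
  E_mul : ∀ v ∈ domain, ∀ α β γ,
    ∑ ε, (E v ε * pd ε (fun w => c w α β γ) v
        + pd α (fun w => E w ε) v * c v ε β γ
        + pd β (fun w => E w ε) v * c v α ε γ
        - c v α β ε * pd ε (fun w => E w γ) v) = c v α β γ
  /-- `Lie_E η = (2 - d) η` -/
  E_metric : ∀ v ∈ domain, ∀ α β,
    ∑ ε, (pd α (fun w => E w ε) v * η ε β + pd β (fun w => E w ε) v * η α ε) = (2 - d) * η α β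

/-- The jet space `J^∞(ℂⁿ)` with the product topology; `q s γ` is the coordinate
`v^{γ,s} = ∂_x^s v^γ`. -/
abbrev Jet (n : ℕ) : Type := ℕ → V n

/-- The partial derivative `∂F/∂v^{γ,s}` of a function on the jet space. -/
def jpd {n : ℕ} (γ : Fin n) (s : ℕ) (F : Jet n → ℂ) (q : Jet n) : ℂ :=
  deriv (fun t : ℂ => F (Function.update q s (Function.update (q s) γ t))) (q s γ)

/-- The polynomial curve `x ↦ ∑_{k ≤ N} v^{(k)} x^k / k!`, whose `N`-jet at `x = 0` is that
of `q`. -/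
def jetCurve {n : ℕ} (q : Jet n) (N : ℕ) (x : ℂ) : V n :=
  ∑ k ∈ Finset.range (N + 1), (x ^ k / (k.factorial : ℂ)) • q k

/-- `∂_x^s f` at the jet `q`, for a function `f = f(v, v_x)`: the `s`-th derivative at `x = 0` of
`f(v(x), v'(x))` along a curve `v(x)` with the derivatives `v, v_x, …, v^{(s+1)}` prescribed by
`q`. -/
def dx {n : ℕ} (s : ℕ) (f : V n → V n → ℂ) (q : Jet n) : ℂ :=
  iteratedDeriv s (fun x : ℂ => f (jetCurve q (s + 1) x) (deriv (jetCurve q (s + 1)) x)) 0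

/-- `F = F(v, v_x, …, v^{(N)})` is a (holomorphic) function on the open subset `Ω` of the jet space,
for some `N`. -/
def IsJetFunction {n : ℕ} (Ω : Set (Jet n)) (F : Jet n → ℂ) : Prop :=
  ∃ (N : ℕ) (f : (Fin (N + 1) → V n) → ℂ),
    AnalyticOnNhd ℂ f ((fun (q : Jet n) (k : Fin (N + 1)) => q k) '' Ω) ∧
    ∀ q ∈ Ω, F q = f (fun k => q k)

namespace GFM

variable {n : ℕ} (M : GFM n)

/-- The product `X · Y` of two tangent vectors at `v`. -/
def mul (v X Y : V n) : V n := fun γ => ∑ α, ∑ β, X α * Y β * M.c v α β γ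

/-- The Frobenius algebra on the tangent space at `v` is semisimple, that is, isomorphic to `ℂⁿ`:
it has a basis of orthogonal idempotents. -/
def SemisimpleAt (v : V n) : Prop :=
  ∃ π : Fin n → V n, LinearIndependent ℂ π ∧
    ∀ i j, M.mul v (π i) (π j) = if i = j then π i else 0

/-- `M` is semisimple: the Frobenius algebra at a generic point is semisimple. -/
def IsSemisimple : Prop :=
  M.domain ⊆ closure {v | v ∈ M.domain ∧ M.SemisimpleAt v}

/-- The matrix of the multiplication by `E`: `E · ∂_γ = ∑ β, opU v β γ ∂_β`. -/
def opU (v : V n) : Matrix (Fin n) (Fin n) ℂ :=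
  Matrix.of fun β γ => ∑ ε, M.E v ε * M.c v ε γ β

/-- The grading operator `μ = (2 - d)/2 - ∇E`. -/
def opμ (v : V n) : Matrix (Fin n) (Fin n) ℂ :=
  ((2 - M.d) / 2) • (1 : Matrix (Fin n) (Fin n) ℂ)
    - Matrix.of fun β γ => pd γ (fun w => M.E w β) v

/-- The constant `tr(1/4 - μ²)`. -/
def trConst (v : V n) : ℂ :=
  ((1 / 4 : ℂ) • (1 : Matrix (Fin n) (Fin n) ℂ) - M.opμ v * M.opμ v).trace

/-- The pencil `g^{αβ} - l η^{αβ}` of contravariant metrics, where `g^{αβ} = η^{αγ} U^β_γ` is the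
intersection form. -/
def pencil (l : ℂ) (v : V n) : Matrix (Fin n) (Fin n) ℂ :=
  M.η⁻¹ * (M.opU v).transpose - l • M.η⁻¹

/-- The Christoffel symbols `Γ^γ_{αβ}` of the Levi-Civita connection `∇(l)` of the covariant metric
`(g^{αβ} - l η^{αβ})⁻¹`. -/
def christoffel (l : ℂ) (v : V n) (γ α β : Fin n) : ℂ :=
  (1 / 2) * ∑ δ, M.pencil l v γ δ *
    (pd α (fun w => (M.pencil l w)⁻¹ δ β) v + pd β (fun w => (M.pencil l w)⁻¹ δ α) v
      - pd δ (fun w => (M.pencil l w)⁻¹ α β) v)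

/-- The gradient `(∇f)^γ = ∂^γ f = η^{γδ} ∂_δ f` with respect to the flat metric `η`. -/
def grad (f : V n → ℂ) (v : V n) : V n := fun γ => ∑ δ, M.η⁻¹ γ δ * pd δ f v

/-- The vector field `∇ (∂p/∂l)`, for a function `p = p(v; l)`. -/
def gradDl (p : V n → ℂ → ℂ) (v : V n) (l : ℂ) : V n :=
  M.grad (fun w => deriv (p w) l) v

/-- A basis of periods `p_σ(v; l)` of `M`, defined for `v ∈ D` and `l ∈ W`: a system of flat
coordinates of the metric `(g^{αβ} - l η^{αβ})⁻¹` that depends on the parameter `l` through the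
Gauss-Manin equation `(U - l) ∂_l ∇p = (μ + 1/2) ∇p`. -/
structure PeriodBasis where
  D : Set (V n)
  W : Set ℂ
  isOpen_D : IsOpen D
  isOpen_W : IsOpen W
  nonempty_W : W.Nonempty
  D_subset : D ⊆ M.domain
  /-- `D` lies outside the discriminant `Σ_l` for `l ∈ W` -/
  regular : ∀ v ∈ D, ∀ l ∈ W, (M.pencil l v).det ≠ 0
  p : Fin n → V n → ℂ → ℂ
  analytic : ∀ σ, AnalyticOnNhd ℂ (fun x : V n × ℂ => p σ x.1 x.2) (D ×ˢ W)
  /-- `∇(l) dp_σ = 0` -/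
  flat : ∀ σ, ∀ v ∈ D, ∀ l ∈ W, ∀ α β,
    pd α (pd β (fun w => p σ w l)) v = ∑ γ, M.christoffel l v γ α β * pd γ (fun w => p σ w l) v
  gaussManin : ∀ σ, ∀ v ∈ D, ∀ l ∈ W,
    (M.opU v - l • (1 : Matrix (Fin n) (Fin n) ℂ)).mulVec (M.gradDl (p σ) v l)
      = (M.opμ v + (1 / 2 : ℂ) • (1 : Matrix (Fin n) (Fin n) ℂ)).mulVec
          (M.grad (fun w => p σ w l) v)
  /-- the differentials `dp_1, …, dp_n` are linearly independent -/
  independent : ∀ v ∈ D, ∀ l ∈ W,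
    (Matrix.of fun σ α => pd α (fun w => p σ w l) v : Matrix (Fin n) (Fin n) ℂ).det ≠ 0

variable {M}

namespace PeriodBasis

variable (P : M.PeriodBasis)

/-- The Gram matrix `(G^{αβ})`: the inverse of the matrix of the pairings `(dp_α, dp_β)` with
respect to the contravariant metric `g - l η`. -/
def gram (v : V n) (l : ℂ) : Matrix (Fin n) (Fin n) ℂ :=
  (Matrix.of fun σ ρ => ∑ α, ∑ β,
    pd α (fun w => P.p σ w l) v * M.pencil l v α β * pd β (fun w => P.p ρ w l) v)⁻¹

/-- `∂_x^s ∂^γ p_σ`. -/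
def dxGrad (s : ℕ) (γ : Fin n) (σ : Fin n) (l : ℂ) (q : Jet n) : ℂ :=
  dx s (fun v _ => M.grad (fun w => P.p σ w l) v γ) q

/-- `∂_x^s (1/(E - l e))^γ`. -/
def dxResolvent (_P : M.PeriodBasis) (s : ℕ) (γ : Fin n) (l : ℂ) (q : Jet n) : ℂ :=
  dx s (fun v _ =>
    ((M.opU v - l • (1 : Matrix (Fin n) (Fin n) ℂ))⁻¹.mulVec (M.e v)) γ) q

/-- The coefficients
`K^{γ,s} = (s+1) ∂_x^s (1/(E - l e))^γ
  + ∑_{k=1}^s k C(s+1,k+1) (∂_x^{s-k} ∂^γ p_α) G^{αβ} (∂_l ∂_x^k p_β)`. -/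
def K (γ : Fin n) (s : ℕ) (l : ℂ) (q : Jet n) : ℂ :=
  ((s : ℂ) + 1) * P.dxResolvent s γ l q
    + ∑ k ∈ Finset.Icc 1 s, (k : ℂ) * ((s + 1).choose (k + 1) : ℂ) *
        ∑ α, ∑ β, P.dxGrad (s - k) γ α l q * P.gram (q 0) l α β *
          deriv (fun l' => dx k (fun v _ => P.p β v l') q) l

/-- `(∂_x^{k+1} ∂^α p_σ) G^{σρ} (∂_x^{m+1} ∂^β p_ρ)`. -/
def quadCoeff (α : Fin n) (k : ℕ) (β : Fin n) (m : ℕ) (l : ℂ) (q : Jet n) : ℂ :=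
  ∑ σ, ∑ ρ, P.dxGrad (k + 1) α σ l q * P.gram (q 0) l σ ρ * P.dxGrad (m + 1) β ρ l q

/-- `∂_x^{k+1} [∇(∂p_σ/∂l) · ∇(∂p_ρ/∂l) · v_x]^α G^{σρ}`. -/
def linCoeff (α : Fin n) (k : ℕ) (l : ℂ) (q : Jet n) : ℂ :=
  ∑ σ, ∑ ρ, dx (k + 1) (fun v w =>
      M.mul v (M.mul v (M.gradDl (P.p σ) v l) (M.gradDl (P.p ρ) v l)) w α) q
    * P.gram (q 0) l σ ρ

/-- The contracted star product `G^{αβ} (∂p_α/∂l) * (∂p_β/∂l)`.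
The star product satisfies `∇(f * g) = ∇f · ∇g`. If `f` and `g` are `l`-derivatives of periods this
means that `f * g` equals `-(1/2) (df, dg)`, where `( , )` is the contravariant metric `g - l η`, up
to a term that does not depend on `v`. That term is fixed by the quasi-homogeneity and by the decay
`O(l⁻³)` of the contraction at `l = ∞`: it contributes `tr(1/4 - μ²)/(2 l²)`. -/
def starContraction (v : V n) (l : ℂ) : ℂ :=
  (∑ σ, ∑ ρ, P.gram v l σ ρ *
    (-(1 / 2) * ∑ α, ∑ β, pd α (fun w => deriv (P.p σ w) l) v * M.pencil l v α β *
      pd β (fun w => deriv (P.p ρ w) l) v))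
  + M.trConst v / (2 * l ^ 2)

/-- The coefficient of `ε^{k-2}` (`k ≥ 1`) in the loop equation for
`ΔF = ∑_{k ≥ 1} ε^{k-2} F k`, at the jet `q` and the parameter `l`. The sums over the jet orders have
finitely many nonzero terms, because every `F k` depends on finitely many jet variables. -/
def LoopEquation (F : ℕ → Jet n → ℂ) (k : ℕ) (l : ℂ) (q : Jet n) : Prop :=
  (∑ᶠ s : ℕ, ∑ γ, jpd γ s (F k) q * P.K γ s l q)
    = (1 / 2) * (∑ a ∈ Finset.Ico 1 k, ∑ᶠ ij : ℕ × ℕ, ∑ α, ∑ β,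
          jpd α ij.1 (F a) q * jpd β ij.2 (F (k - a)) q * P.quadCoeff α ij.1 β ij.2 l q)
      + (if 3 ≤ k then
          (1 / 2) * (∑ᶠ ij : ℕ × ℕ, ∑ α, ∑ β,
            jpd α ij.1 (jpd β ij.2 (F (k - 2))) q * P.quadCoeff α ij.1 β ij.2 l q)
          + (1 / 2) * (∑ᶠ i : ℕ, ∑ α, jpd α i (F (k - 2)) q * P.linCoeff α i l q)
        else 0)
      + (if k = 2 then
          (1 / 2) * P.starContraction (q 0) l - M.trConst (q 0) / (4 * l ^ 2)
        else 0)

end PeriodBasis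

/-- `ΔF = ∑_{k ≥ 1} ε^{k-2} F k`, with every `F k` a function on the open subset `Ω` of the jet
space, is a solution of the loop equation, written by means of the local bases of periods `P i`. The
value `F 0` plays no role. -/
def IsLoopSolution {ι : Type*} (P : ι → M.PeriodBasis) (Ω : Set (Jet n))
    (F : ℕ → Jet n → ℂ) : Prop :=
  ∀ k, 1 ≤ k → IsJetFunction Ω (F k) ∧
    ∀ i, ∀ q ∈ Ω, q 0 ∈ (P i).D → ∀ l ∈ (P i).W, (P i).LoopEquation F k l q

end GFM

/-- The series `∑_{g ≥ 1} ε^{2g-2} 𝓕 g` as a series `∑_{k ≥ 1} ε^{k-2} F k`. -/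
def genusSeries {n : ℕ} (𝓕 : ℕ → Jet n → ℂ) (k : ℕ) : Jet n → ℂ :=
  if Even k then 𝓕 (k / 2) else 0

end GenFrob

end

/-! At every order in ε the loop equation has the form L(F_k) = R_k. The operator L(H) = ∑
∂H/∂v^{γ,s} K^{γ,s} is the same for all k, and R_k contains only derivatives of the coefficients
below k, plus a known term when k = 2. Both claims therefore follow by strong induction from one
fact: L has only constants in its kernel (`exists_eq_const_of_loop_linear`). For uniqueness, the
difference of two k-th coefficients lies in that kernel. For parity, each term of R_k with k odd
contains a coefficient of odd index below k, already known to be constant, so R_k = 0.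

To find the kernel, let m be the top jet order in H. Flatness and the Gauss-Manin equation express
all x-derivatives of ∇p and ∂_l p linearly through ∇p, and the Gram contraction of ∇p ⊗ ∇p is (U -
l)⁻¹ η⁻¹. Hence K^{γ,s} = det(U - l)^{-(s+1)} N_s(l), where N_s is entire in l and free of periods
(`PeriodBasis.K_eq`). Multiply L(H) = 0 by det(U - l)^{m+1}, continue analytically in l, and set l =
u_i, a simple eigenvalue of U: only s = m survives. There the adjugate of U - l is τ π_i ⊗ ℓ_i, the
recursions defining N_s become algebraic, and the Chu-Vandermonde identity gives N_m(u_i) = 2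
(1/2)_{m+1} τ (-τ ℓ_i(v_x))^m π_i (`IsSimpleEigen.kNum_eq`). This is nonzero if ℓ_i(v_x) ≠ 0, so the
covector ∂H/∂v^{·,m} kills every idempotent π_i and vanishes (`PeriodBasis.coeff_eq_zero`). Suitable
jets meet every nonempty open subset of Ω, so the top derivative vanishes identically, and one
descends in m.

Simplicity of the spectrum at generic points (`IsSemisimple.exists_isFrame_injective`) is obtained
without canonical coordinates. At a point with the largest number of distinct eigenvalues, a
repeated eigenvalue would split to first order along the corresponding idempotent. -/

noncomputable section

namespace GenFrob

open Matrix Topology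

/-! ### Analyticity of matrix expressions -/

section MatrixAnalytic

variable {E : Type*} [NormedAddCommGroup E] [NormedSpace ℂ E]
variable {m : Type*} [Fintype m]

theorem analyticAt_mul_apply {l o : Type*} {A : E → Matrix l m ℂ} {B : E → Matrix m o ℂ} {z : E}
    (hA : ∀ i j, AnalyticAt ℂ (fun w => A w i j) z)
    (hB : ∀ i j, AnalyticAt ℂ (fun w => B w i j) z) (i : l) (j : o) :
    AnalyticAt ℂ (fun w => (A w * B w) i j) z := by
  simp only [Matrix.mul_apply]
  exact Finset.analyticAt_fun_sum _ fun k _ => (hA i k).mul (hB k j)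

variable [DecidableEq m]

theorem analyticAt_det {A : E → Matrix m m ℂ} {z : E}
    (hA : ∀ i j, AnalyticAt ℂ (fun w => A w i j) z) : AnalyticAt ℂ (fun w => (A w).det) z := by
  simp only [Matrix.det_apply']
  refine Finset.analyticAt_fun_sum _ fun σ _ => ?_
  exact analyticAt_const.mul (Finset.analyticAt_fun_prod _ fun i _ => hA _ _)

theorem analyticAt_adjugate {A : E → Matrix m m ℂ} {z : E}
    (hA : ∀ i j, AnalyticAt ℂ (fun w => A w i j) z) (i j : m) :
    AnalyticAt ℂ (fun w => (A w).adjugate i j) z := by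
  simp only [Matrix.adjugate_apply]
  refine analyticAt_det fun k l => ?_
  by_cases h : k = j
  · subst h; simpa using analyticAt_const
  · simpa [Matrix.updateRow_apply, h] using hA k l

theorem analyticAt_inv_apply {A : E → Matrix m m ℂ} {z : E}
    (hA : ∀ i j, AnalyticAt ℂ (fun w => A w i j) z) (h : (A z).det ≠ 0) (i j : m) :
    AnalyticAt ℂ (fun w => (A w)⁻¹ i j) z := by
  simp only [Matrix.inv_def, Matrix.smul_apply, Ring.inverse_eq_inv', smul_eq_mul]
  exact ((analyticAt_det hA).inv h).mul (analyticAt_adjugate hA i j)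

end MatrixAnalytic

/-! ### Calculus of partial derivatives -/

section PartialDerivatives

variable {n : ℕ}

theorem fderiv_apply_eq_sum_pd (f : V n → ℂ) (v w : V n) :
    fderiv ℂ f v w = ∑ α, w α * pd α f v := by
  conv_lhs => rw [pi_eq_sum_univ' w]
  simp only [map_sum, map_smul, smul_eq_mul, pd]

theorem pd_congr {f g : V n → ℂ} {v : V n} (h : f =ᶠ[𝓝 v] g) (α : Fin n) :
    pd α f v = pd α g v := by
  simp only [pd, h.fderiv_eq]

theorem pd_mul {f g : V n → ℂ} {v : V n} (hf : DifferentiableAt ℂ f v)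
    (hg : DifferentiableAt ℂ g v) (α : Fin n) :
    pd α (fun w => f w * g w) v = pd α f v * g v + f v * pd α g v := by
  simp [pd, fderiv_fun_mul hf hg]; ring

theorem pd_sum {κ : Type*} {s : Finset κ} {f : κ → V n → ℂ} {v : V n}
    (hf : ∀ i ∈ s, DifferentiableAt ℂ (f i) v) (α : Fin n) :
    pd α (fun w => ∑ i ∈ s, f i w) v = ∑ i ∈ s, pd α (f i) v := by
  simp [pd, fderiv_fun_sum hf]

theorem pd_const (a : ℂ) (v : V n) (α : Fin n) : pd α (fun _ => a) v = 0 := by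
  simp [pd]

theorem pd_sub_const (f : V n → ℂ) (a : ℂ) (v : V n) (α : Fin n) :
    pd α (fun w => f w - a) v = pd α f v := by
  simp only [pd, fderiv_sub_const]

theorem pd_const_mul {f : V n → ℂ} {v : V n} (hf : DifferentiableAt ℂ f v) (a : ℂ) (α : Fin n) :
    pd α (fun w => a * f w) v = a * pd α f v := by
  rw [pd, fderiv_const_mul hf]; rfl

theorem pd_mul_const {f : V n → ℂ} {v : V n} (hf : DifferentiableAt ℂ f v) (a : ℂ) (α : Fin n) :
    pd α (fun w => f w * a) v = pd α f v * a := by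
  rw [pd, fderiv_mul_const hf, mul_comm]; rfl

theorem analyticOnNhd_pd {f : V n → ℂ} {D : Set (V n)} (hf : AnalyticOnNhd ℂ f D) (α : Fin n) :
    AnalyticOnNhd ℂ (pd α f) D := fun v hv =>
  ((ContinuousLinearMap.apply ℂ ℂ (Pi.single α 1 : V n)).analyticAt _).comp (hf.fderiv v hv)

/-- The entrywise partial derivative of a matrix-valued function. -/
def pdMat {m o : Type*} (α : Fin n) (A : V n → Matrix m o ℂ) (v : V n) : Matrix m o ℂ :=
  Matrix.of fun i j => pd α (fun w => A w i j) v

theorem pdMat_mul {m o p : Type*} [Fintype o] {A : V n → Matrix m o ℂ} {B : V n → Matrix o p ℂ}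
    {v : V n} (hA : ∀ i j, DifferentiableAt ℂ (fun w => A w i j) v)
    (hB : ∀ i j, DifferentiableAt ℂ (fun w => B w i j) v) (α : Fin n) :
    pdMat α (fun w => A w * B w) v = pdMat α A v * B v + A v * pdMat α B v := by
  ext i j
  simp only [pdMat, Matrix.of_apply, Matrix.mul_apply, Matrix.add_apply]
  rw [pd_sum fun k _ => (hA i k).fun_mul (hB k j), ← Finset.sum_add_distrib]
  exact Finset.sum_congr rfl fun k _ => pd_mul (hA i k) (hB k j) α

theorem pdMat_inv {m : Type*} [Fintype m] [DecidableEq m] {A : V n → Matrix m m ℂ} {v : V n}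
    (hA : ∀ i j, AnalyticAt ℂ (fun w => A w i j) v) (h : (A v).det ≠ 0) (α : Fin n) :
    pdMat α (fun w => (A w)⁻¹) v = -((A v)⁻¹ * pdMat α A v * (A v)⁻¹) := by
  have hd : ∀ᶠ w in 𝓝 v, (A w).det ≠ 0 :=
    (analyticAt_det hA).continuousAt.eventually_ne h
  have h1 : pdMat α (fun w => (A w)⁻¹ * A w) v = 0 := by
    ext i j
    have : (fun w => ((A w)⁻¹ * A w) i j) =ᶠ[𝓝 v] fun _ => (1 : Matrix m m ℂ) i j := by
      filter_upwards [hd] with w hw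
      rw [Matrix.nonsing_inv_mul _ hw.isUnit]
    simp [pdMat, pd_congr this, pd_const]
  rw [pdMat_mul (fun i j => (analyticAt_inv_apply hA h i j).differentiableAt)
    (fun i j => (hA i j).differentiableAt)] at h1
  have h2 := congrArg (· * (A v)⁻¹) (eq_neg_of_add_eq_zero_left h1)
  simpa [Matrix.mul_assoc, Matrix.mul_nonsing_inv _ h.isUnit] using h2

end PartialDerivatives

/-! ### Tangent algebras and the Levi-Civita connection of the pencil -/

namespace GFM

variable {n : ℕ} (M : GFM n)

/-- The matrix of the multiplication by `∂_α`. -/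
def basisMul (v : V n) (α : Fin n) : Matrix (Fin n) (Fin n) ℂ :=
  Matrix.of fun γ β => M.c v α β γ

/-- The matrix of the multiplication by `X`. -/
def mulMat (v X : V n) : Matrix (Fin n) (Fin n) ℂ := ∑ α, X α • M.basisMul v α

theorem mulMat_apply (v X : V n) (γ β : Fin n) :
    M.mulMat v X γ β = ∑ α, X α * M.c v α β γ := by
  simp [mulMat, basisMul, Matrix.sum_apply]

theorem mulMat_mulVec (v X Y : V n) : M.mulMat v X *ᵥ Y = M.mul v X Y := by
  ext γ
  simp only [Matrix.mulVec, dotProduct, mulMat_apply, mul, Finset.sum_mul]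
  rw [Finset.sum_comm]
  exact Finset.sum_congr rfl fun α _ => Finset.sum_congr rfl fun β _ => by ring

theorem opU_eq_mulMat (v : V n) : M.opU v = M.mulMat v (M.E v) := by
  ext β γ; simp [opU, mulMat_apply]

variable {M} {v : V n}

/-- By associativity either product is multiplication by ∂_α · ∂_β, which is symmetric in α and β.
-/
theorem basisMul_comm (hv : v ∈ M.domain) (α β : Fin n) :
    M.basisMul v α * M.basisMul v β = M.basisMul v β * M.basisMul v α := by
  ext γ δ
  have h : ∀ a b, (M.basisMul v a * M.basisMul v b) γ δ = ∑ ε, M.c v a b ε * M.c v ε δ γ := by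
    intro a b
    rw [M.c_assoc v hv]
    simp only [Matrix.mul_apply, basisMul, Matrix.of_apply]
    exact Finset.sum_congr rfl fun _ _ => mul_comm _ _
  rw [h, h]
  exact Finset.sum_congr rfl fun ε _ => by rw [M.c_comm v hv α β]

theorem mulMat_comm (hv : v ∈ M.domain) (X Y : V n) :
    M.mulMat v X * M.mulMat v Y = M.mulMat v Y * M.mulMat v X := by
  simp only [mulMat, Finset.sum_mul, Finset.mul_sum, smul_mul_smul_comm]
  rw [Finset.sum_comm]
  exact Finset.sum_congr rfl fun α _ => Finset.sum_congr rfl fun β _ => by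
    rw [basisMul_comm hv, mul_comm]

theorem mul_comm' (hv : v ∈ M.domain) (X Y : V n) : M.mul v X Y = M.mul v Y X := by
  ext γ
  simp only [mul]
  rw [Finset.sum_comm]
  exact Finset.sum_congr rfl fun α _ => Finset.sum_congr rfl fun β _ => by
    rw [M.c_comm v hv α β]; ring

theorem mulMat_unit (hv : v ∈ M.domain) : M.mulMat v (M.e v) = 1 := by
  ext γ β
  rw [mulMat_apply, M.e_unit v hv, Matrix.one_apply]
  simp [eq_comm]

theorem mul_unit (hv : v ∈ M.domain) (X : V n) : M.mul v X (M.e v) = X := by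
  rw [mul_comm' hv, ← mulMat_mulVec, mulMat_unit hv, Matrix.one_mulVec]

theorem basisMul_transpose_mul (hv : v ∈ M.domain) (α : Fin n) :
    (M.basisMul v α)ᵀ * M.η = M.η * M.basisMul v α := by
  ext β γ
  simp only [Matrix.mul_apply, Matrix.transpose_apply, basisMul, Matrix.of_apply]
  rw [M.c_frobenius v hv]
  exact Finset.sum_congr rfl fun _ _ => mul_comm _ _

theorem mulMat_transpose_mul (hv : v ∈ M.domain) (X : V n) :
    (M.mulMat v X)ᵀ * M.η = M.η * M.mulMat v X := by
  simp only [mulMat, Matrix.transpose_sum, Matrix.transpose_smul, Finset.sum_mul, Finset.mul_sum,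
    smul_mul_assoc, mul_smul_comm, basisMul_transpose_mul hv]

/-- The scaling law of η says that the η-symmetric part of ∇E is (2 - d)/2, and μ is built by
removing it. This antisymmetry later produces every constant 1/2. -/
theorem opμ_transpose_mul (hv : v ∈ M.domain) :
    (M.opμ v)ᵀ * M.η = -(M.η * M.opμ v) := by
  rw [← add_eq_zero_iff_eq_neg]
  ext α β
  have h := M.E_metric v hv α β
  rw [Finset.sum_add_distrib] at h
  have h' : (∑ ε, M.η α ε * pd β (fun w => M.E w ε) v) = ∑ ε, pd β (fun w => M.E w ε) v * M.η α ε :=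
    Finset.sum_congr rfl fun _ _ => mul_comm _ _
  simp only [opμ, Matrix.transpose_sub, Matrix.transpose_smul, Matrix.transpose_one, sub_mul,
    mul_sub, Matrix.add_apply, Matrix.sub_apply, smul_mul_assoc, one_mul, mul_smul_comm, mul_one,
    Matrix.smul_apply, smul_eq_mul, Matrix.mul_apply, Matrix.transpose_apply, Matrix.of_apply, h',
    Matrix.zero_apply]
  linear_combination -h

theorem analyticAt_c (hv : v ∈ M.domain) (α β γ : Fin n) : AnalyticAt ℂ (fun w => M.c w α β γ) v :=
  M.c_analytic α β γ v hv

theorem analyticAt_E (hv : v ∈ M.domain) (α : Fin n) : AnalyticAt ℂ (fun w => M.E w α) v :=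
  ((ContinuousLinearMap.proj (R := ℂ) (φ := fun _ : Fin n => ℂ) α).analyticAt _).comp
    (M.E_analytic v hv)

theorem analyticAt_e (hv : v ∈ M.domain) (α : Fin n) : AnalyticAt ℂ (fun w => M.e w α) v :=
  ((ContinuousLinearMap.proj (R := ℂ) (φ := fun _ : Fin n => ℂ) α).analyticAt _).comp
    (M.e_analytic v hv)

theorem analyticAt_opU (hv : v ∈ M.domain) (i j : Fin n) :
    AnalyticAt ℂ (fun w => M.opU w i j) v := by
  simp only [opU, Matrix.of_apply]
  exact Finset.analyticAt_fun_sum _ fun ε _ => (analyticAt_E hv ε).mul (analyticAt_c hv _ _ _)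

theorem analyticAt_opμ (hv : v ∈ M.domain) (i j : Fin n) :
    AnalyticAt ℂ (fun w => M.opμ w i j) v := by
  simp only [opμ, Matrix.of_apply, Matrix.sub_apply]
  exact analyticAt_const.sub (analyticOnNhd_pd (fun w hw => analyticAt_E hw i) j v hv)

/-- Since η is constant and nondegenerate, the lowered index in the potentiality condition can be
raised again. -/
theorem pd_c_symm (hv : v ∈ M.domain) (α β γ δ : Fin n) :
    pd δ (fun w => M.c w α β γ) v = pd α (fun w => M.c w δ β γ) v := by
  have hd : ∀ a b c, DifferentiableAt ℂ (fun w => M.c w a b c) v := fun a b c =>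
    (analyticAt_c hv a b c).differentiableAt
  have h : (fun ε => pd δ (fun w => M.c w α β ε) v - pd α (fun w => M.c w δ β ε) v) ᵥ* M.η = 0 := by
    ext ρ
    have := M.c_potential v hv α β ρ δ
    rw [pd_sum fun ε _ => (hd _ _ _).mul_const _, pd_sum fun ε _ => (hd _ _ _).mul_const _] at this
    simp only [pd_mul_const (hd _ _ _)] at this
    simp [Matrix.vecMul, dotProduct, sub_mul, Finset.sum_sub_distrib, this]
  have h2 := Matrix.eq_zero_of_vecMul_eq_zero M.η_nondeg.ne_zero h
  exact sub_eq_zero.mp (congrFun h2 γ)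

/-- After the product rule, `pd_c_symm` turns the derivative of c contracted with E into the
derivative of c along E, which Lie_E(·) = · evaluates. The scalar part of μ drops out of the
commutator. -/
theorem pdMat_opU (hv : v ∈ M.domain) (α : Fin n) :
    pdMat α M.opU v = M.basisMul v α + M.basisMul v α * M.opμ v - M.opμ v * M.basisMul v α := by
  ext γ β
  have hc : ∀ a b c, DifferentiableAt ℂ (fun w => M.c w a b c) v := fun a b c =>
    (analyticAt_c hv a b c).differentiableAt
  have hE : ∀ a, DifferentiableAt ℂ (fun w => M.E w a) v := fun a =>
    (analyticAt_E hv a).differentiableAt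
  have h1 := M.E_mul v hv α β γ
  have h2 : pdMat α M.opU v γ β = ∑ ε, (pd α (fun w => M.E w ε) v * M.c v ε β γ
      + M.E v ε * pd ε (fun w => M.c w α β γ) v) := by
    simp only [pdMat, opU, Matrix.of_apply]
    rw [pd_sum fun ε _ => (hE ε).fun_mul (hc _ _ _)]
    refine Finset.sum_congr rfl fun ε _ => ?_
    rw [pd_mul (hE ε) (hc _ _ _), pd_c_symm hv]
  rw [h2]
  simp only [opμ, mul_sub, sub_mul, Matrix.add_apply, Matrix.sub_apply, smul_mul_assoc, one_mul,
    mul_smul_comm, mul_one, Matrix.mul_apply, basisMul, Matrix.of_apply]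
  simp only [Finset.sum_add_distrib, Finset.sum_sub_distrib] at h1 ⊢
  have h3 : (∑ ε, pd β (fun w => M.E w ε) v * M.c v α ε γ)
    = ∑ ε, M.c v α ε γ * pd β (fun w => M.E w ε) v :=
    Finset.sum_congr rfl fun _ _ => mul_comm _ _
  have h4 : (∑ ε, M.c v α β ε * pd ε (fun w => M.E w γ) v)
    = ∑ ε, pd ε (fun w => M.E w γ) v * M.c v α β ε :=
    Finset.sum_congr rfl fun _ _ => mul_comm _ _
  rw [h3, h4] at h1
  linear_combination h1

/-- The matrix `U - l` of the multiplication by `E - l e`. -/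
def opUsub (M : GFM n) (l : ℂ) (v : V n) : Matrix (Fin n) (Fin n) ℂ :=
  M.opU v - l • (1 : Matrix (Fin n) (Fin n) ℂ)

theorem opUsub_eq_mulMat (hv : v ∈ M.domain) (l : ℂ) :
    M.opUsub l v = M.mulMat v (M.E v - l • M.e v) := by
  rw [opUsub, ← mulMat_unit hv, opU_eq_mulMat]
  simp [mulMat, sub_smul, Finset.sum_sub_distrib, Finset.smul_sum, smul_smul]

theorem opUsub_transpose_mul (hv : v ∈ M.domain) (l : ℂ) :
    (M.opUsub l v)ᵀ * M.η = M.η * M.opUsub l v := by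
  rw [opUsub_eq_mulMat hv, mulMat_transpose_mul hv]

theorem opUsub_comm (hv : v ∈ M.domain) (l : ℂ) (α : Fin n) :
    M.opUsub l v * M.basisMul v α = M.basisMul v α * M.opUsub l v := by
  have : M.basisMul v α = M.mulMat v (Pi.single α 1) := by
    rw [mulMat, Finset.sum_eq_single α] <;> simp +contextual
  rw [opUsub_eq_mulMat hv, this, mulMat_comm hv]

theorem η_mul_inv : M.η * M.η⁻¹ = 1 := Matrix.mul_nonsing_inv _ M.η_nondeg

theorem η_inv_mul : M.η⁻¹ * M.η = 1 := Matrix.nonsing_inv_mul _ M.η_nondeg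

theorem η_transpose : M.ηᵀ = M.η := M.η_symm

theorem pencil_eq_transpose (l : ℂ) (v : V n) : M.pencil l v = M.η⁻¹ * (M.opUsub l v)ᵀ := by
  simp [pencil, opUsub, mul_sub]

theorem pencil_eq (hv : v ∈ M.domain) (l : ℂ) : M.pencil l v = M.opUsub l v * M.η⁻¹ := by
  have h := congrArg (fun A => M.η⁻¹ * A * M.η⁻¹) (opUsub_transpose_mul hv l)
  simp only [Matrix.mul_assoc, η_mul_inv, mul_one] at h
  rw [pencil_eq_transpose, h, ← Matrix.mul_assoc, η_inv_mul, one_mul]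

theorem det_opUsub_ne_zero {l : ℂ} (h : (M.pencil l v).det ≠ 0) : (M.opUsub l v).det ≠ 0 := by
  rw [pencil_eq_transpose, Matrix.det_mul, Matrix.det_transpose] at h
  exact right_ne_zero_of_mul h

theorem pencil_inv (hv : v ∈ M.domain) (l : ℂ) : (M.pencil l v)⁻¹ = M.η * (M.opUsub l v)⁻¹ := by
  rw [pencil_eq hv, Matrix.mul_inv_rev, Matrix.nonsing_inv_nonsing_inv _ M.η_nondeg]

theorem analyticAt_opUsub (hv : v ∈ M.domain) (l : ℂ) (i j : Fin n) :
    AnalyticAt ℂ (fun w => M.opUsub l w i j) v := by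
  simp only [opUsub, Matrix.sub_apply]
  exact (analyticAt_opU hv i j).sub analyticAt_const

theorem pdMat_opUsub (l : ℂ) (α : Fin n) : pdMat α (M.opUsub l) v = pdMat α M.opU v := by
  ext i j
  simp [pdMat, opUsub, pd_sub_const]

/-- The connection matrices `Γ_α = -(1/2 - μ) ∂_α · (U - l)⁻¹`. -/
def connMat (M : GFM n) (l : ℂ) (v : V n) (α : Fin n) : Matrix (Fin n) (Fin n) ℂ :=
  -(((1 / 2 : ℂ) • 1 - M.opμ v) * M.basisMul v α * (M.opUsub l v)⁻¹)

theorem inv_opUsub_comm (hv : v ∈ M.domain) {l : ℂ} (h : (M.opUsub l v).det ≠ 0) (α : Fin n) :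
    (M.opUsub l v)⁻¹ * M.basisMul v α = M.basisMul v α * (M.opUsub l v)⁻¹ := by
  have h1 := congrArg (fun A => (M.opUsub l v)⁻¹ * A * (M.opUsub l v)⁻¹) (opUsub_comm hv l α)
  simp only [← Matrix.mul_assoc, Matrix.nonsing_inv_mul _ h.isUnit, one_mul] at h1
  simp only [Matrix.mul_assoc, Matrix.mul_nonsing_inv _ h.isUnit, mul_one] at h1
  exact h1.symm

theorem basisMul_mulVec_symm (hv : v ∈ M.domain) (α β : Fin n) (ε : Fin n) :
    M.basisMul v α ε β = M.basisMul v β ε α := by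
  simp [basisMul, M.c_comm v hv α β]

/-- Torsion-freeness: once the resolvent is moved to the left of ∂_α·, the two indices enter only
through ∂_α · ∂_β. -/
theorem connMat_symm (hv : v ∈ M.domain) {l : ℂ} (h : (M.opUsub l v).det ≠ 0) (α β γ : Fin n) :
    M.connMat l v α γ β = M.connMat l v β γ α := by
  simp only [connMat, Matrix.mul_assoc, ← inv_opUsub_comm hv h, Matrix.neg_apply]
  simp only [← Matrix.mul_assoc]
  congr 1
  rw [Matrix.mul_apply, Matrix.mul_apply]
  exact Finset.sum_congr rfl fun ε _ => by rw [basisMul_mulVec_symm hv]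

theorem inv_opUsub_transpose (hv : v ∈ M.domain) {l : ℂ} :
    ((M.opUsub l v)⁻¹)ᵀ * M.η = M.η * (M.opUsub l v)⁻¹ := by
  have h : M.pencil l v = (M.pencil l v)ᵀ := by
    rw [pencil_eq hv, Matrix.transpose_mul, Matrix.transpose_nonsing_inv, η_transpose, ← pencil_eq hv,
      pencil_eq_transpose]
  have h2 := congrArg (·⁻¹) h
  rw [← Matrix.transpose_nonsing_inv, pencil_inv hv, Matrix.transpose_mul, η_transpose] at h2
  exact h2.symm

/-- With R = (U - l)⁻¹ and C = ∂_α·, both sides equal -ηR(C + Cμ - μC)R. The left side uses the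
derivative of U; on the right, C(1/2 + μ) + (1/2 - μ)C arises because transposition through η
reverses the sign of μ. -/
theorem metric_compat (hv : v ∈ M.domain) {l : ℂ} (h : (M.opUsub l v).det ≠ 0) (α : Fin n) :
    pdMat α (fun w => (M.pencil l w)⁻¹) v
      = (M.connMat l v α)ᵀ * (M.pencil l v)⁻¹ + (M.pencil l v)⁻¹ * M.connMat l v α := by
  have hev : ∀ᶠ w in 𝓝 v, w ∈ M.domain := M.isOpen_domain.mem_nhds hv
  have h1 : pdMat α (fun w => (M.pencil l w)⁻¹) v = pdMat α (fun w => M.η * (M.opUsub l w)⁻¹) v := by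
    ext i j
    refine pd_congr ?_ α
    filter_upwards [hev] with w hw
    rw [pencil_inv hw]
  have h0 : pdMat α (fun _ => M.η) v = 0 := by ext i j; simp [pdMat, pd_const]
  rw [h1, pdMat_mul (A := fun _ => M.η) (B := fun w => (M.opUsub l w)⁻¹)
    (fun _ _ => differentiableAt_const _)
    (fun i j => (analyticAt_inv_apply (analyticAt_opUsub hv l) h i j).differentiableAt), h0,
    pdMat_inv (analyticAt_opUsub hv l) h, pdMat_opUsub, pdMat_opU hv, pencil_inv hv]
  have hR := inv_opUsub_transpose hv (l := l)
  have hC := basisMul_transpose_mul hv α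
  have hμ := opμ_transpose_mul hv
  set R := (M.opUsub l v)⁻¹
  set C := M.basisMul v α
  set m := M.opμ v
  have h3 : (M.connMat l v α)ᵀ * (M.η * R) = -(M.η * R * C * ((1 / 2 : ℂ) • 1 + m) * R) := by
    have h4 : ((1 / 2 : ℂ) • (1 : Matrix (Fin n) (Fin n) ℂ) - m)ᵀ * M.η
        = M.η * ((1 / 2 : ℂ) • 1 + m) := by
      simp only [Matrix.transpose_sub, Matrix.transpose_smul, Matrix.transpose_one, sub_mul, hμ,
        mul_add, smul_mul_assoc, one_mul, mul_smul_comm, mul_one, sub_neg_eq_add]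
    simp only [connMat, Matrix.transpose_neg, Matrix.transpose_mul, neg_mul]
    congr 1
    calc _ = Rᵀ * (Cᵀ * (((1 / 2 : ℂ) • (1 : Matrix (Fin n) (Fin n) ℂ) - m)ᵀ * M.η)) * R := by
          simp only [Matrix.mul_assoc]
          rfl
      _ = _ := by
        rw [h4, ← Matrix.mul_assoc Cᵀ, hC, ← Matrix.mul_assoc Rᵀ, ← Matrix.mul_assoc Rᵀ, hR]
  rw [h3, connMat]
  simp only [mul_add, add_mul, mul_sub, sub_mul, mul_neg, smul_mul_assoc, one_mul,
    mul_smul_comm, mul_one, ← Matrix.mul_assoc, zero_mul, zero_add]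
  module

/-- The Levi-Civita connection of the pencil. -/
theorem christoffel_eq (hv : v ∈ M.domain) {l : ℂ} (h : (M.pencil l v).det ≠ 0) (γ α β : Fin n) :
    M.christoffel l v γ α β = M.connMat l v α γ β := by
  have h' := det_opUsub_ne_zero h
  set H := (M.pencil l v)⁻¹ with hH
  have hsym : Hᵀ = H := by
    rw [hH, pencil_inv hv, Matrix.transpose_mul, η_transpose, inv_opUsub_transpose hv]
  have key : ∀ a i j, pd a (fun w => (M.pencil l w)⁻¹ i j) v
      = (H * M.connMat l v a) j i + (H * M.connMat l v a) i j := by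
    intro a i j
    have := congrFun (congrFun (metric_compat hv h' a) i) j
    rw [← hH, Matrix.add_apply] at this
    rw [← Matrix.transpose_apply (H * _), Matrix.transpose_mul, hsym]
    exact this
  have hs : ∀ a b i, (H * M.connMat l v a) i b = (H * M.connMat l v b) i a := by
    intro a b i
    rw [Matrix.mul_apply, Matrix.mul_apply]
    exact Finset.sum_congr rfl fun ε _ => by rw [connMat_symm hv h']
  have hP : M.pencil l v * H = 1 := Matrix.mul_nonsing_inv _ h.isUnit
  calc M.christoffel l v γ α β
      = (1 / 2) * ∑ δ, M.pencil l v γ δ * (2 * (H * M.connMat l v α) δ β) := by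
        unfold christoffel
        congr 1
        refine Finset.sum_congr rfl fun δ _ => ?_
        -- Koszul's argument: of the six terms, symmetry cancels four and identifies the other two.
        rw [key, key, key, hs δ α β, hs δ β α, hs β α δ]
        ring
    _ = (M.pencil l v * (H * M.connMat l v α)) γ β := by
        rw [Matrix.mul_apply, Finset.mul_sum]
        exact Finset.sum_congr rfl fun δ _ => by ring
    _ = M.connMat l v α γ β := by rw [← Matrix.mul_assoc, hP, one_mul]

/-- Differentiation of the gradient of a flat function of the pencil. -/
theorem pd_grad_of_flat (hv : v ∈ M.domain) {l : ℂ} (h : (M.pencil l v).det ≠ 0) {f : V n → ℂ}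
    (hf : AnalyticAt ℂ f v)
    (hflat : ∀ α β, pd α (pd β f) v = ∑ γ, M.christoffel l v γ α β * pd γ f v) (α γ : Fin n) :
    pd α (fun w => M.grad f w γ) v
      = -(((M.opUsub l v)⁻¹ * M.basisMul v α * (M.opμ v + (1 / 2 : ℂ) • 1)) *ᵥ M.grad f v) γ := by
  have h' := det_opUsub_ne_zero h
  obtain ⟨s, hs, hfs⟩ := hf.exists_mem_nhds_analyticOnNhd
  have hd : ∀ δ, DifferentiableAt ℂ (pd δ f) v := fun δ =>
    (analyticOnNhd_pd hfs δ v (mem_of_mem_nhds hs)).differentiableAt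
  have h1 : pd α (fun w => M.grad f w γ) v = ((M.η⁻¹ * (M.connMat l v α)ᵀ) *ᵥ fun δ => pd δ f v) γ := by
    simp only [grad]
    rw [pd_sum fun δ _ => (hd δ).const_mul _]
    simp only [pd_const_mul (hd _), ← Matrix.mulVec_mulVec]
    simp only [Matrix.mulVec, dotProduct, hflat, christoffel_eq hv h, Matrix.transpose_apply]
  have h2 : (fun δ => pd δ f v) = M.η *ᵥ M.grad f v := by
    have : M.grad f v = M.η⁻¹ *ᵥ (fun δ => pd δ f v) := by ext; simp [grad, Matrix.mulVec, dotProduct]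
    rw [this, Matrix.mulVec_mulVec, η_mul_inv, Matrix.one_mulVec]
  have h3 : M.η⁻¹ * (M.connMat l v α)ᵀ * M.η
      = -((M.opUsub l v)⁻¹ * M.basisMul v α * (M.opμ v + (1 / 2 : ℂ) • 1)) := by
    have h4 : (M.connMat l v α)ᵀ * M.η
        = M.η * -((M.opUsub l v)⁻¹ * M.basisMul v α * (M.opμ v + (1 / 2 : ℂ) • 1)) := by
      have hμ := opμ_transpose_mul hv
      have h5 : ((1 / 2 : ℂ) • (1 : Matrix (Fin n) (Fin n) ℂ) - M.opμ v)ᵀ * M.η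
          = M.η * (M.opμ v + (1 / 2 : ℂ) • 1) := by
        simp only [Matrix.transpose_sub, Matrix.transpose_smul, Matrix.transpose_one, sub_mul, hμ,
          mul_add, smul_mul_assoc, one_mul, mul_smul_comm, mul_one, sub_neg_eq_add, add_comm]
      simp only [connMat, Matrix.transpose_neg, Matrix.transpose_mul, neg_mul, mul_neg]
      rw [Matrix.mul_assoc, Matrix.mul_assoc, h5, ← Matrix.mul_assoc (M.basisMul v α)ᵀ,
        basisMul_transpose_mul hv, ← Matrix.mul_assoc, ← Matrix.mul_assoc, inv_opUsub_transpose hv]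
      simp only [Matrix.mul_assoc]
    rw [Matrix.mul_assoc, h4, ← Matrix.mul_assoc, η_inv_mul, one_mul]
  rw [h1, h2, Matrix.mulVec_mulVec, h3, Matrix.neg_mulVec, Pi.neg_apply]

end GFM

/-! ### Interchanging x- and l-derivatives -/

section TwoVariables

/-- The partial derivative with respect to the first variable. -/
def dX (f : ℂ × ℂ → ℂ) (z : ℂ × ℂ) : ℂ := fderiv ℂ f z (1, 0)

/-- The partial derivative with respect to the second variable. -/
def dL (f : ℂ × ℂ → ℂ) (z : ℂ × ℂ) : ℂ := fderiv ℂ f z (0, 1)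

variable {f g : ℂ × ℂ → ℂ} {T : Set (ℂ × ℂ)} {S W : Set ℂ}

theorem analyticAt_dX {z : ℂ × ℂ} (hf : AnalyticAt ℂ f z) : AnalyticAt ℂ (dX f) z :=
  ((ContinuousLinearMap.apply ℂ ℂ ((1, 0) : ℂ × ℂ)).analyticAt _).comp hf.fderiv

theorem analyticAt_dL {z : ℂ × ℂ} (hf : AnalyticAt ℂ f z) : AnalyticAt ℂ (dL f) z :=
  ((ContinuousLinearMap.apply ℂ ℂ ((0, 1) : ℂ × ℂ)).analyticAt _).comp hf.fderiv

theorem hasDerivAt_fst {x l : ℂ} (hf : AnalyticAt ℂ f (x, l)) :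
    HasDerivAt (fun y => f (y, l)) (dX f (x, l)) x :=
  hf.differentiableAt.hasFDerivAt.comp_hasDerivAt x ((hasDerivAt_id x).prodMk (hasDerivAt_const x l))

theorem hasDerivAt_snd {x l : ℂ} (hf : AnalyticAt ℂ f (x, l)) :
    HasDerivAt (fun y => f (x, y)) (dL f (x, l)) l :=
  hf.differentiableAt.hasFDerivAt.comp_hasDerivAt l ((hasDerivAt_const l x).prodMk (hasDerivAt_id l))

theorem dX_dL_comm {z : ℂ × ℂ} (hf : AnalyticAt ℂ f z) : dX (dL f) z = dL (dX f) z := by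
  have hs : IsSymmSndFDerivAt ℂ f z :=
    (hf.contDiffAt (n := 2)).isSymmSndFDerivAt (by simp)
  have hd : DifferentiableAt ℂ (fderiv ℂ f) z := hf.fderiv.differentiableAt
  have h1 : ∀ a b : ℂ × ℂ, fderiv ℂ (fun w => fderiv ℂ f w a) z b = fderiv ℂ (fderiv ℂ f) z b a := by
    intro a b
    rw [fderiv_clm_apply hd (differentiableAt_const a)]
    simp
  simp only [dX, dL]
  change fderiv ℂ (fun w => fderiv ℂ f w (0, 1)) z (1, 0)
    = fderiv ℂ (fun w => fderiv ℂ f w (1, 0)) z (0, 1)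
  rw [h1, h1, hs.eq]

theorem analyticOnNhd_iterate_dX (hf : AnalyticOnNhd ℂ f T) (k : ℕ) :
    AnalyticOnNhd ℂ (dX^[k] f) T := by
  induction k with
  | zero => exact hf
  | succ k ih => rw [Function.iterate_succ_apply']; exact fun z hz => analyticAt_dX (ih z hz)

theorem dX_congr (hT : IsOpen T) (h : Set.EqOn f g T) : Set.EqOn (dX f) (dX g) T := by
  intro z hz
  simp only [dX, (h.eventuallyEq_of_mem (hT.mem_nhds hz)).fderiv_eq]

theorem iterate_dX_dL_comm (hT : IsOpen T) (hf : AnalyticOnNhd ℂ f T) (k : ℕ) :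
    Set.EqOn (dX^[k] (dL f)) (dL (dX^[k] f)) T := by
  induction k with
  | zero => exact fun _ _ => rfl
  | succ k ih =>
    intro z hz
    rw [Function.iterate_succ_apply', Function.iterate_succ_apply', dX_congr hT ih hz,
      dX_dL_comm (analyticOnNhd_iterate_dX hf k z hz)]

theorem iteratedDeriv_fst (hS : IsOpen S) (hf : AnalyticOnNhd ℂ f (S ×ˢ W)) {l : ℂ} (hl : l ∈ W)
    (k : ℕ) {x : ℂ} (hx : x ∈ S) :
    iteratedDeriv k (fun y => f (y, l)) x = (dX^[k] f) (x, l) := by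
  induction k generalizing x with
  | zero => simp
  | succ k ih =>
    rw [iteratedDeriv_succ, Function.iterate_succ_apply']
    have : iteratedDeriv k (fun y => f (y, l)) =ᶠ[𝓝 x] fun y => (dX^[k] f) (y, l) := by
      filter_upwards [hS.mem_nhds hx] with y hy using ih hy
    rw [this.deriv_eq]
    exact (hasDerivAt_fst (analyticOnNhd_iterate_dX hf k _ ⟨hx, hl⟩)).deriv

theorem iteratedDeriv_congr_of_isOpen {f g : ℂ → ℂ} (hS : IsOpen S) (h : Set.EqOn f g S) (k : ℕ)
    {x : ℂ} (hx : x ∈ S) : iteratedDeriv k f x = iteratedDeriv k g x :=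
  (h.eventuallyEq_of_mem (hS.mem_nhds hx)).iteratedDeriv_eq k

/-- This lets ∂_l act on a period first, where the Gauss-Manin equation applies, before the
x-derivatives are taken. -/
theorem deriv_iteratedDeriv_comm (hS : IsOpen S) (hW : IsOpen W) (hf : AnalyticOnNhd ℂ f (S ×ˢ W))
    {l : ℂ} (hl : l ∈ W) (k : ℕ) {x : ℂ} (hx : x ∈ S) :
    deriv (fun l' => iteratedDeriv k (fun y => f (y, l')) x) l
      = iteratedDeriv k (fun y => deriv (fun l' => f (y, l')) l) x := by
  have h1 : (fun l' => iteratedDeriv k (fun y => f (y, l')) x)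
      =ᶠ[𝓝 l] fun l' => (dX^[k] f) (x, l') := by
    filter_upwards [hW.mem_nhds hl] with l' hl' using iteratedDeriv_fst hS hf hl' k hx
  have h2 : Set.EqOn (fun y => deriv (fun l' => f (y, l')) l) (fun y => dL f (y, l)) S :=
    fun y hy => (hasDerivAt_snd (hf _ ⟨hy, hl⟩)).deriv
  rw [h1.deriv_eq, iteratedDeriv_congr_of_isOpen hS h2 k hx,
    iteratedDeriv_fst hS (W := W) (fun z hz => analyticAt_dL (hf z hz)) hl k hx,
    iterate_dX_dL_comm (hS.prod hW) hf k ⟨hx, hl⟩]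
  exact (hasDerivAt_snd (analyticOnNhd_iterate_dX hf k _ ⟨hx, hl⟩)).deriv

end TwoVariables

/-! ### Numerators of iterated derivatives of solutions of linear equations -/

section Numerators

variable {ι κ : Type*} [Fintype κ]

/-- If `Y' = Δ⁻¹ Z Y`, then the derivative of `Δ⁻ᵐ A Y` is `Δ⁻ᵐ⁻¹ B Y`, where `B` is
`numNext Δ Z m A`. -/
def numNext (Δ : ℂ × ℂ → ℂ) (Z : ℂ × ℂ → Matrix κ κ ℂ) (m : ℕ) (A : ℂ × ℂ → Matrix ι κ ℂ) :
    ℂ × ℂ → Matrix ι κ ℂ := fun z =>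
  Matrix.of (fun i j => Δ z * dX (fun w => A w i j) z - m * dX Δ z * A z i j) + A z * Z z

/-- The numerators of the successive derivatives of `Δ⁻ᵐ A Y`, where `Y' = Δ⁻¹ Z Y`. -/
def numSeq (Δ : ℂ × ℂ → ℂ) (Z : ℂ × ℂ → Matrix κ κ ℂ) (A : ℂ × ℂ → Matrix ι κ ℂ) (m : ℕ) :
    ℕ → ℂ × ℂ → Matrix ι κ ℂ
  | 0 => A
  | k + 1 => numNext Δ Z (m + k) (numSeq Δ Z A m k)

variable {Δ : ℂ × ℂ → ℂ} {Z : ℂ × ℂ → Matrix κ κ ℂ} {A : ℂ × ℂ → Matrix ι κ ℂ}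

theorem analyticAt_numNext {z : ℂ × ℂ} (hΔ : AnalyticAt ℂ Δ z)
    (hZ : ∀ i j, AnalyticAt ℂ (fun w => Z w i j) z) (hA : ∀ i j, AnalyticAt ℂ (fun w => A w i j) z)
    (m : ℕ) (i : ι) (j : κ) : AnalyticAt ℂ (fun w => numNext Δ Z m A w i j) z := by
  simp only [numNext, Matrix.add_apply, Matrix.of_apply]
  exact ((hΔ.mul (analyticAt_dX (hA i j))).sub
    ((analyticAt_const.mul (analyticAt_dX hΔ)).mul (hA i j))).add (analyticAt_mul_apply hA hZ i j)

theorem analyticAt_numSeq {z : ℂ × ℂ} (hΔ : AnalyticAt ℂ Δ z)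
    (hZ : ∀ i j, AnalyticAt ℂ (fun w => Z w i j) z) (hA : ∀ i j, AnalyticAt ℂ (fun w => A w i j) z)
    (m k : ℕ) : ∀ (i : ι) (j : κ), AnalyticAt ℂ (fun w => numSeq Δ Z A m k w i j) z := by
  induction k with
  | zero => exact hA
  | succ k ih => exact analyticAt_numNext hΔ hZ ih _

theorem hasDerivAt_inv_pow {u : ℂ → ℂ} {u' x : ℂ} (hu : HasDerivAt u u' x) (h : u x ≠ 0) (m : ℕ) :
    HasDerivAt (fun y => (u y)⁻¹ ^ m) (-(m * u') * (u x)⁻¹ ^ (m + 1)) x := by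
  refine ((hu.inv h).pow m).congr_deriv ?_
  cases m with
  | zero => simp
  | succ m =>
    simp only [Nat.add_sub_cancel, Pi.inv_apply, div_eq_mul_inv, ← inv_pow]
    ring

theorem hasDerivAt_numNext {x l : ℂ} (hΔ : AnalyticAt ℂ Δ (x, l))
    (hA : ∀ i j, AnalyticAt ℂ (fun w => A w i j) (x, l)) (h : Δ (x, l) ≠ 0) {Y : ℂ → κ → ℂ}
    (hY : ∀ j, HasDerivAt (fun y => Y y j) ((Δ (x, l))⁻¹ * (Z (x, l) *ᵥ Y x) j) x) (m : ℕ) (i : ι) :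
    HasDerivAt (fun y => (Δ (y, l))⁻¹ ^ m * (A (y, l) *ᵥ Y y) i)
      ((Δ (x, l))⁻¹ ^ (m + 1) * (numNext Δ Z m A (x, l) *ᵥ Y x) i) x := by
  have h1 := hasDerivAt_inv_pow (hasDerivAt_fst hΔ) h m
  have h2 : HasDerivAt (fun y => (A (y, l) *ᵥ Y y) i)
      (∑ j, (dX (fun w => A w i j) (x, l) * Y x j
        + A (x, l) i j * ((Δ (x, l))⁻¹ * (Z (x, l) *ᵥ Y x) j))) x := by
    simp only [Matrix.mulVec, dotProduct]
    exact HasDerivAt.fun_sum fun j _ => (hasDerivAt_fst (hA i j)).fun_mul (hY j)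
  refine (h1.fun_mul h2).congr_deriv ?_
  have h3 : (numNext Δ Z m A (x, l) *ᵥ Y x) i
      = Δ (x, l) * ∑ j, (dX (fun w => A w i j) (x, l) * Y x j)
        - m * dX Δ (x, l) * (A (x, l) *ᵥ Y x) i
        + ∑ j, A (x, l) i j * (Z (x, l) *ᵥ Y x) j := by
    rw [numNext, Matrix.add_mulVec, Pi.add_apply, ← Matrix.mulVec_mulVec]
    congr 1
    simp only [Matrix.mulVec, dotProduct, Matrix.of_apply, sub_mul, Finset.sum_sub_distrib,
      Finset.mul_sum, mul_assoc]
  rw [h3, Finset.sum_add_distrib]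
  have h4 : ∑ j, A (x, l) i j * ((Δ (x, l))⁻¹ * (Z (x, l) *ᵥ Y x) j)
      = (Δ (x, l))⁻¹ * ∑ j, A (x, l) i j * (Z (x, l) *ᵥ Y x) j := by
    rw [Finset.mul_sum]
    exact Finset.sum_congr rfl fun j _ => by ring
  rw [h4]
  have h5 : Δ (x, l) * (Δ (x, l))⁻¹ = 1 := mul_inv_cancel₀ h
  linear_combination
    (-(Δ (x, l))⁻¹ ^ m * ∑ j, (dX (fun w => A w i j) (x, l) * Y x j)) * h5

/-- Each differentiation costs exactly one factor Δ⁻¹. The numerators use only Δ, Z, A and their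
derivatives, so they remain meaningful where Δ = 0, and there they will be evaluated. -/
theorem iteratedDeriv_numSeq {T : Set ℂ} (hT : IsOpen T) {l : ℂ}
    (hΔ : ∀ x ∈ T, AnalyticAt ℂ Δ (x, l)) (hZ : ∀ x ∈ T, ∀ i j, AnalyticAt ℂ (fun w => Z w i j) (x, l))
    (hA : ∀ x ∈ T, ∀ i j, AnalyticAt ℂ (fun w => A w i j) (x, l)) (h : ∀ x ∈ T, Δ (x, l) ≠ 0)
    {Y : ℂ → κ → ℂ}
    (hY : ∀ x ∈ T, ∀ j, HasDerivAt (fun y => Y y j) ((Δ (x, l))⁻¹ * (Z (x, l) *ᵥ Y x) j) x)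
    (m : ℕ) (i : ι) (k : ℕ) {x : ℂ} (hx : x ∈ T) :
    iteratedDeriv k (fun y => (Δ (y, l))⁻¹ ^ m * (A (y, l) *ᵥ Y y) i) x
      = (Δ (x, l))⁻¹ ^ (m + k) * (numSeq Δ Z A m k (x, l) *ᵥ Y x) i := by
  induction k generalizing x with
  | zero => simp [numSeq]
  | succ k ih =>
    rw [iteratedDeriv_succ]
    have : iteratedDeriv k (fun y => (Δ (y, l))⁻¹ ^ m * (A (y, l) *ᵥ Y y) i)
        =ᶠ[𝓝 x] fun y => (Δ (y, l))⁻¹ ^ (m + k) * (numSeq Δ Z A m k (y, l) *ᵥ Y y) i := by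
      filter_upwards [hT.mem_nhds hx] with y hy using ih hy
    rw [this.deriv_eq]
    exact (hasDerivAt_numNext (hΔ x hx) (analyticAt_numSeq (hΔ x hx) (hZ x hx) (hA x hx) m k)
      (h x hx) (hY x hx) (m + k) i).deriv

end Numerators

/-! ### Total derivatives along polynomial curves -/

section JetCurve

variable {n : ℕ}

theorem jetCurve_zero (q : Jet n) (L : ℕ) : jetCurve q L 0 = q 0 := by
  simp only [jetCurve]
  rw [Finset.sum_eq_single 0] <;> simp +contextual

theorem contDiff_jetCurve (q : Jet n) (L : ℕ) {N : WithTop ℕ∞} : ContDiff ℂ N (jetCurve q L) := by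
  unfold jetCurve
  fun_prop

theorem analyticAt_jetCurve (q : Jet n) (L : ℕ) (x : ℂ) : AnalyticAt ℂ (jetCurve q L) x :=
  (contDiff_jetCurve q L (N := ⊤)).contDiffAt.analyticAt

theorem iteratedDeriv_jetCurve (q : Jet n) (L j : ℕ) :
    iteratedDeriv j (jetCurve q L) 0 = if j ≤ L then q j else 0 := by
  have hterm : ∀ k, iteratedDeriv j (fun x : ℂ => (x ^ k / (k.factorial : ℂ)) • q k) 0
      = if j = k then q k else 0 := by
    intro k
    rw [iteratedDeriv_smul_const (by fun_prop), iteratedDeriv_div_const, iteratedDeriv_fun_pow_zero]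
    split_ifs with h
    · simp [Nat.factorial_ne_zero]
    · simp
  induction L with
  | zero =>
    have : jetCurve q 0 = fun x : ℂ => (x ^ 0 / (Nat.factorial 0 : ℂ)) • q 0 := by
      ext x; simp [jetCurve]
    rw [this, hterm]
    by_cases h : j = 0 <;> simp [h]
  | succ L ih =>
    have : jetCurve q (L + 1)
        = jetCurve q L + fun x : ℂ => (x ^ (L + 1) / ((L + 1).factorial : ℂ)) • q (L + 1) := by
      ext x; simp [jetCurve, Finset.sum_range_succ _ (L + 1)]
    rw [this, iteratedDeriv_add (contDiff_jetCurve q L).contDiffAt (by fun_prop), hterm, ih]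
    by_cases h1 : j = L + 1
    · simp [h1]
    · have : j ≤ L + 1 ↔ j ≤ L := by omega
      simp [h1, this]

theorem deriv_jetCurve (q : Jet n) {L : ℕ} (hL : 1 ≤ L) : deriv (jetCurve q L) 0 = q 1 := by
  have := iteratedDeriv_jetCurve q L 1
  rwa [iteratedDeriv_one, if_pos hL] at this

/-- By Faà di Bruno's formula only the derivatives of the curve up to order s enter, and these do
not depend on where the jet is cut off. -/
theorem iteratedDeriv_comp_jetCurve {f : V n → ℂ} {q : Jet n} (hf : AnalyticAt ℂ f (q 0)) {s L : ℕ}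
    (hL : s ≤ L) :
    iteratedDeriv s (fun x => f (jetCurve q L x)) 0 = iteratedDeriv s (fun x => f (jetCurve q s x)) 0 := by
  have h : ∀ L, s ≤ L → iteratedDeriv s (f ∘ jetCurve q L) 0
      = ∑ c : OrderedFinpartition s, iteratedFDeriv ℂ c.length f (q 0) fun m => q (c.partSize m) := by
    intro L hL
    rw [iteratedDeriv_vcomp_eq_sum_orderedFinpartition (n := s) (i := s)
      (by rw [jetCurve_zero]; exact hf.contDiffAt) (contDiff_jetCurve q L).contDiffAt le_rfl]
    refine Finset.sum_congr rfl fun c _ => ?_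
    rw [jetCurve_zero]
    congr 1
    ext1 m
    rw [iteratedDeriv_jetCurve, if_pos ((c.partSize_le m).trans hL)]
  exact (h L hL).trans (h s le_rfl).symm

/-- The freedom in L allows all the derivatives occurring in the K^{γ,s} with s ≤ L to be computed
on one common curve. -/
theorem dx_eq {f : V n → ℂ} {q : Jet n} (hf : AnalyticAt ℂ f (q 0)) {s L : ℕ} (hL : s ≤ L) :
    dx s (fun v _ => f v) q = iteratedDeriv s (fun x => f (jetCurve q L x)) 0 := by
  rw [iteratedDeriv_comp_jetCurve hf hL]
  exact iteratedDeriv_comp_jetCurve hf (Nat.le_succ s)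

theorem hasDerivAt_comp_curve {f : V n → ℂ} {v : ℂ → V n} {x : ℂ} (hf : AnalyticAt ℂ f (v x))
    (hv : AnalyticAt ℂ v x) :
    HasDerivAt (fun y => f (v y)) (∑ α, deriv v x α * pd α f (v x)) x := by
  rw [← fderiv_apply_eq_sum_pd]
  exact hf.differentiableAt.hasFDerivAt.comp_hasDerivAt x hv.differentiableAt.hasDerivAt

end JetCurve

/-! ### The coefficients K as quotients in l -/

namespace GFM

variable {n : ℕ} (M : GFM n) (v : ℂ → V n)

/-- The determinant of `U - l` along a curve. -/
def curveDet (z : ℂ × ℂ) : ℂ := (M.opUsub z.2 (v z.1)).det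

/-- The adjugate of `U - l` along a curve. -/
def curveAdj (z : ℂ × ℂ) : Matrix (Fin n) (Fin n) ℂ := (M.opUsub z.2 (v z.1)).adjugate

/-- The operator `μ + 1/2` along a curve. -/
def curveMu (z : ℂ × ℂ) : Matrix (Fin n) (Fin n) ℂ := M.opμ (v z.1) + (1 / 2 : ℂ) • 1

/-- The numerator of the matrix of the linear differential equation satisfied along a curve by the
gradients of the periods. -/
def curveConn (z : ℂ × ℂ) : Matrix (Fin n) (Fin n) ℂ :=
  -(M.curveAdj v z * M.mulMat (v z.1) (deriv v z.1) * M.curveMu v z)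

/-- The numerator of the row vector that expresses `∂_x ∂_l p` in terms of `∇p`. -/
def curveRow (z : ℂ × ℂ) : Matrix Unit (Fin n) ℂ :=
  Matrix.replicateRow Unit (deriv v z.1) * M.η * M.curveAdj v z * M.curveMu v z

/-- The numerator of the resolvent `1/(E - l e)`. -/
def curveRes (z : ℂ × ℂ) : Matrix (Fin n) Unit ℂ :=
  M.curveAdj v z * Matrix.replicateCol Unit (M.e (v z.1))

/-- The numerator of `∂_x^k ∇p`. -/
def gradNum (k : ℕ) : ℂ × ℂ → Matrix (Fin n) (Fin n) ℂ :=
  numSeq (M.curveDet v) (M.curveConn v) (fun _ => (1 : Matrix (Fin n) (Fin n) ℂ)) 0 k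

/-- The numerator of `∂_l ∂_x^(k+1) p`. -/
def rowNum (k : ℕ) : ℂ × ℂ → Matrix Unit (Fin n) ℂ :=
  numSeq (M.curveDet v) (M.curveConn v) (M.curveRow v) 1 k

/-- The numerator of `∂_x^k (1/(E - l e))`. -/
def resNum (k : ℕ) : ℂ × ℂ → Matrix (Fin n) Unit ℂ :=
  numSeq (M.curveDet v) (fun _ => (0 : Matrix Unit Unit ℂ)) (M.curveRes v) 1 k

/-- The numerator of `K^{γ,s}`, as a function of `l`. -/
def kNum (s : ℕ) (l : ℂ) : Matrix (Fin n) Unit ℂ :=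
  ((s : ℂ) + 1) • M.resNum v s (0, l)
    + ∑ k ∈ Finset.Icc 1 s, ((k : ℂ) * ((s + 1).choose (k + 1) : ℂ)) •
        (M.gradNum v (s - k) (0, l) * M.curveAdj v (0, l) * M.η⁻¹ * (M.rowNum v (k - 1) (0, l))ᵀ)

variable {M v}

theorem analyticAt_comp_fst {f : V n → ℂ} {z : ℂ × ℂ} (hv : AnalyticAt ℂ v z.1)
    (hf : AnalyticAt ℂ f (v z.1)) : AnalyticAt ℂ (fun w : ℂ × ℂ => f (v w.1)) z :=
  AnalyticAt.fun_comp (f := fun w : ℂ × ℂ => v w.1) hf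
    (AnalyticAt.fun_comp (f := fun w : ℂ × ℂ => w.1) hv analyticAt_fst)

theorem analyticAt_curveUsub {z : ℂ × ℂ} (hv : AnalyticAt ℂ v z.1) (hz : v z.1 ∈ M.domain)
    (i j : Fin n) : AnalyticAt ℂ (fun w : ℂ × ℂ => M.opUsub w.2 (v w.1) i j) z := by
  simp only [opUsub, Matrix.sub_apply, Matrix.smul_apply]
  exact (analyticAt_comp_fst hv (analyticAt_opU hz i j)).sub (analyticAt_snd.mul analyticAt_const)

theorem analyticAt_curveDet {z : ℂ × ℂ} (hv : AnalyticAt ℂ v z.1) (hz : v z.1 ∈ M.domain) :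
    AnalyticAt ℂ (M.curveDet v) z := analyticAt_det (analyticAt_curveUsub hv hz)

theorem analyticAt_curveAdj {z : ℂ × ℂ} (hv : AnalyticAt ℂ v z.1) (hz : v z.1 ∈ M.domain)
    (i j : Fin n) : AnalyticAt ℂ (fun w => M.curveAdj v w i j) z :=
  analyticAt_adjugate (analyticAt_curveUsub hv hz) i j

theorem analyticAt_curveMu {z : ℂ × ℂ} (hv : AnalyticAt ℂ v z.1) (hz : v z.1 ∈ M.domain)
    (i j : Fin n) : AnalyticAt ℂ (fun w => M.curveMu v w i j) z := by
  simp only [curveMu, Matrix.add_apply]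
  exact (analyticAt_comp_fst hv (analyticAt_opμ hz i j)).add analyticAt_const

theorem analyticAt_deriv_curve {z : ℂ × ℂ} (hv : AnalyticAt ℂ v z.1) (α : Fin n) :
    AnalyticAt ℂ (fun w : ℂ × ℂ => deriv v w.1 α) z :=
  ((ContinuousLinearMap.proj (R := ℂ) (φ := fun _ : Fin n => ℂ) α).analyticAt _).fun_comp
    (AnalyticAt.fun_comp (f := fun w : ℂ × ℂ => w.1) hv.deriv analyticAt_fst)

theorem analyticAt_curveConn {z : ℂ × ℂ} (hv : AnalyticAt ℂ v z.1) (hz : v z.1 ∈ M.domain)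
    (i j : Fin n) : AnalyticAt ℂ (fun w => M.curveConn v w i j) z := by
  simp only [curveConn, Matrix.neg_apply]
  refine (analyticAt_mul_apply (analyticAt_mul_apply (analyticAt_curveAdj hv hz) fun a b => ?_)
    (analyticAt_curveMu hv hz) i j).neg
  simp only [mulMat_apply]
  exact Finset.analyticAt_fun_sum _ fun α _ =>
    (analyticAt_deriv_curve hv α).mul (analyticAt_comp_fst hv (analyticAt_c hz _ _ _))

theorem analyticAt_curveRow {z : ℂ × ℂ} (hv : AnalyticAt ℂ v z.1) (hz : v z.1 ∈ M.domain)
    (i : Unit) (j : Fin n) : AnalyticAt ℂ (fun w => M.curveRow v w i j) z := by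
  refine analyticAt_mul_apply (analyticAt_mul_apply (analyticAt_mul_apply
    (A := fun w : ℂ × ℂ => Matrix.replicateRow Unit (deriv v w.1)) (B := fun _ => M.η)
    (fun _ b => ?_) fun _ _ => analyticAt_const) (analyticAt_curveAdj hv hz))
    (analyticAt_curveMu hv hz) i j
  exact analyticAt_deriv_curve hv b

theorem analyticAt_curveRes {z : ℂ × ℂ} (hv : AnalyticAt ℂ v z.1) (hz : v z.1 ∈ M.domain)
    (i : Fin n) (j : Unit) : AnalyticAt ℂ (fun w => M.curveRes v w i j) z := by
  refine analyticAt_mul_apply (B := fun w : ℂ × ℂ => Matrix.replicateCol Unit (M.e (v w.1)))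
    (analyticAt_curveAdj hv hz) (fun a _ => ?_) i j
  exact analyticAt_comp_fst hv (analyticAt_e hz a)

/-- Nothing is asked of l: determinants and adjugates replace inverses of U - l, so the discriminant
is no obstacle to continuation in l. -/
theorem analyticAt_kNum {l : ℂ} (hv : AnalyticAt ℂ v 0) (h0 : v 0 ∈ M.domain) (s : ℕ) (γ : Fin n) :
    AnalyticAt ℂ (fun l => M.kNum v s l γ ()) l := by
  have hp : ∀ {f : ℂ × ℂ → ℂ}, AnalyticAt ℂ f (0, l) → AnalyticAt ℂ (fun l => f (0, l)) l :=
    fun hf => AnalyticAt.fun_comp (f := fun l : ℂ => ((0, l) : ℂ × ℂ)) hf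
      (analyticAt_const.prod analyticAt_id)
  simp only [kNum, Matrix.add_apply, Matrix.sum_apply, Matrix.smul_apply, smul_eq_mul]
  have hΔ : AnalyticAt ℂ (M.curveDet v) (0, l) := analyticAt_curveDet hv h0
  have hZ := analyticAt_curveConn (z := (0, l)) hv h0
  have hN : ∀ k i j, AnalyticAt ℂ (fun l => M.gradNum v k (0, l) i j) l := fun k i j =>
    hp (analyticAt_numSeq (A := fun _ => (1 : Matrix (Fin n) (Fin n) ℂ)) hΔ hZ
      (fun _ _ => analyticAt_const) _ _ _ _)
  have hA : ∀ i j, AnalyticAt ℂ (fun l => M.curveAdj v (0, l) i j) l := fun i j =>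
    hp (analyticAt_curveAdj hv h0 i j)
  have hR : ∀ k i j, AnalyticAt ℂ (fun l => M.rowNum v k (0, l) i j) l := fun k i j =>
    hp (analyticAt_numSeq hΔ hZ (analyticAt_curveRow hv h0) _ _ _ _)
  have hS : AnalyticAt ℂ (fun l => M.resNum v s (0, l) γ ()) l :=
    hp (analyticAt_numSeq (Z := fun _ => (0 : Matrix Unit Unit ℂ)) hΔ
      (fun _ _ => analyticAt_const) (analyticAt_curveRes hv h0) _ _ _ _)
  refine (analyticAt_const.fun_mul hS).fun_add (Finset.analyticAt_fun_sum _ fun k _ =>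
    analyticAt_const.fun_mul ?_)
  exact analyticAt_mul_apply (B := fun l => (M.rowNum v (k - 1) (0, l))ᵀ)
      (analyticAt_mul_apply (B := fun _ => M.η⁻¹) (analyticAt_mul_apply (hN _) hA)
        fun _ _ => analyticAt_const) (fun i j => hR _ j i) γ ()

namespace PeriodBasis

variable (P : M.PeriodBasis)

theorem analyticAt_p {w : V n} (hw : w ∈ P.D) {l : ℂ} (hl : l ∈ P.W) (σ : Fin n) :
    AnalyticAt ℂ (fun w => P.p σ w l) w :=
  AnalyticAt.fun_comp (f := fun w : V n => (w, l)) (P.analytic σ (w, l) ⟨hw, hl⟩)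
    (analyticAt_id.prod analyticAt_const)

theorem analyticAt_deriv_p {w : V n} (hw : w ∈ P.D) {l : ℂ} (hl : l ∈ P.W) (σ : Fin n) :
    AnalyticAt ℂ (fun w => deriv (P.p σ w) l) w := by
  have h := (P.analytic σ).fderiv
  have h1 : AnalyticAt ℂ (fun w => fderiv ℂ (fun x : V n × ℂ => P.p σ x.1 x.2) (w, l) (0, 1)) w :=
    ((ContinuousLinearMap.apply ℂ ℂ ((0, 1) : V n × ℂ)).analyticAt _).fun_comp
      (AnalyticAt.fun_comp (f := fun w : V n => (w, l)) (h (w, l) ⟨hw, hl⟩)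
        (analyticAt_id.prod analyticAt_const))
  refine h1.congr ?_
  filter_upwards [P.isOpen_D.mem_nhds hw] with u hu
  have h2 := (P.analytic σ (u, l) ⟨hu, hl⟩).differentiableAt.hasFDerivAt.comp_hasDerivAt l
    ((hasDerivAt_const l u).prodMk (hasDerivAt_id l))
  exact h2.deriv.symm

theorem det_ne_zero {w : V n} (hw : w ∈ P.D) {l : ℂ} (hl : l ∈ P.W) : (M.opUsub l w).det ≠ 0 :=
  det_opUsub_ne_zero (P.regular w hw l hl)

theorem analyticAt_grad {w : V n} (hw : w ∈ P.D) {l : ℂ} (hl : l ∈ P.W) (σ γ : Fin n) :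
    AnalyticAt ℂ (fun w => M.grad (fun w => P.p σ w l) w γ) w := by
  simp only [grad]
  exact Finset.analyticAt_fun_sum _ fun δ _ => analyticAt_const.mul
    (analyticOnNhd_pd (fun u hu => P.analyticAt_p hu hl σ) δ w hw)

theorem opUsub_inv (l : ℂ) (w : V n) :
    (M.opUsub l w)⁻¹ = (M.opUsub l w).det⁻¹ • (M.opUsub l w).adjugate := by
  rw [Matrix.inv_def, Ring.inverse_eq_inv']

variable {P}

/-- The linear differential equation satisfied by the gradients of the periods along a curve. -/
theorem hasDerivAt_grad {x l : ℂ} (hv : AnalyticAt ℂ v x) (hx : v x ∈ P.D) (hl : l ∈ P.W)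
    (σ γ : Fin n) :
    HasDerivAt (fun y => M.grad (fun w => P.p σ w l) (v y) γ)
      ((M.curveDet v (x, l))⁻¹ * (M.curveConn v (x, l) *ᵥ M.grad (fun w => P.p σ w l) (v x)) γ) x := by
  refine (hasDerivAt_comp_curve (P.analyticAt_grad hx hl σ γ) hv).congr_deriv ?_
  have h1 : ∀ α, deriv v x α * pd α (fun w => M.grad (fun w => P.p σ w l) w γ) (v x)
      = -(((M.opUsub l (v x))⁻¹ * (deriv v x α • M.basisMul (v x) α)
        * (M.opμ (v x) + (1 / 2 : ℂ) • 1)) *ᵥ M.grad (fun w => P.p σ w l) (v x)) γ := by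
    intro α
    rw [pd_grad_of_flat (P.D_subset hx) (P.regular _ hx l hl) (P.analyticAt_p hx hl σ)
      (P.flat σ _ hx l hl)]
    simp [Matrix.smul_mulVec]
  simp only [h1, Finset.sum_neg_distrib]
  rw [← Finset.sum_apply, ← Matrix.sum_mulVec, ← Finset.sum_mul, ← Finset.mul_sum, ← mulMat, opUsub_inv]
  simp [curveDet, curveConn, curveAdj, curveMu, Matrix.neg_mulVec, Matrix.smul_mulVec]

/-- Solve the Gauss-Manin equation for ∇∂_l p and pair the result with v_x through η. -/
theorem deriv_deriv_p {x l : ℂ} (hv : AnalyticAt ℂ v x) (hx : v x ∈ P.D) (hl : l ∈ P.W)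
    (σ : Fin n) :
    deriv (fun y => deriv (P.p σ (v y)) l) x
      = (M.curveDet v (x, l))⁻¹ ^ 1
        * (M.curveRow v (x, l) *ᵥ M.grad (fun w => P.p σ w l) (v x)) () := by
  rw [(hasDerivAt_comp_curve (P.analyticAt_deriv_p hx hl σ) hv).deriv]
  have h1 := congrArg (fun X => (M.opUsub l (v x))⁻¹ *ᵥ X) (P.gaussManin σ _ hx l hl)
  change (M.opUsub l (v x))⁻¹ *ᵥ (M.opUsub l (v x) *ᵥ _) = _ at h1
  rw [Matrix.mulVec_mulVec, Matrix.nonsing_inv_mul _ (P.det_ne_zero hx hl).isUnit,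
    Matrix.one_mulVec] at h1
  have h2 : (fun α => pd α (fun w => deriv (P.p σ w) l) (v x)) = M.η *ᵥ M.gradDl (P.p σ) (v x) l := by
    have : M.gradDl (P.p σ) (v x) l = M.η⁻¹ *ᵥ (fun α => pd α (fun w => deriv (P.p σ w) l) (v x)) := by
      ext; simp [gradDl, grad, Matrix.mulVec, dotProduct]
    rw [this, Matrix.mulVec_mulVec, η_mul_inv, Matrix.one_mulVec]
  change deriv v x ⬝ᵥ (fun α => pd α (fun w => deriv (P.p σ w) l) (v x)) = _
  rw [h2, h1, opUsub_inv, pow_one]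
  simp only [curveRow, Matrix.mul_assoc, ← Matrix.mulVec_mulVec, 
    curveAdj, curveMu, curveDet, Matrix.smul_mulVec, Matrix.mulVec_smul, dotProduct_smul, smul_eq_mul]
  rfl

/-- The matrix of differentials occurs in the Gram matrix and in the gradients, and cancels. The
contraction therefore does not depend on the basis of periods. -/
theorem gram_contraction {w : V n} (hw : w ∈ P.D) {l : ℂ} (hl : l ∈ P.W) :
    (Matrix.of fun γ σ => M.grad (fun w => P.p σ w l) w γ) * P.gram w l
      * (Matrix.of fun γ σ => M.grad (fun w => P.p σ w l) w γ)ᵀ = (M.opUsub l w)⁻¹ * M.η⁻¹ := by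
  set A : Matrix (Fin n) (Fin n) ℂ := Matrix.of fun σ α => pd α (fun w => P.p σ w l) w with hA
  have hdet : IsUnit A.det := (P.independent w hw l hl).isUnit
  have hdet' : IsUnit Aᵀ.det := by rwa [Matrix.det_transpose]
  have h1 : (Matrix.of fun γ σ => M.grad (fun w => P.p σ w l) w γ : Matrix (Fin n) (Fin n) ℂ)
      = M.η⁻¹ * Aᵀ := by
    ext γ σ; simp [grad, Matrix.mul_apply, hA]
  have h2 : P.gram w l = (A * M.pencil l w * Aᵀ)⁻¹ := by
    rw [gram]
    congr 1
    ext σ ρ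
    simp only [Matrix.mul_apply, Matrix.of_apply, Matrix.transpose_apply, hA, Finset.sum_mul]
    rw [Finset.sum_comm]
  rw [h1, h2, Matrix.mul_inv_rev, Matrix.mul_inv_rev, pencil_inv (P.D_subset hw),
    Matrix.transpose_mul, Matrix.transpose_transpose, Matrix.transpose_nonsing_inv, η_transpose]
  calc _ = M.η⁻¹ * (Aᵀ * Aᵀ⁻¹) * M.η * (M.opUsub l w)⁻¹ * (A⁻¹ * A) * M.η⁻¹ := by
        simp only [Matrix.mul_assoc]
    _ = _ := by
        rw [Matrix.mul_nonsing_inv _ hdet', Matrix.nonsing_inv_mul _ hdet, mul_one, mul_one,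
          η_inv_mul, one_mul]

section Numerators

variable {q : Jet n} {l : ℂ} {L : ℕ}

theorem isOpen_curve_preimage (P : M.PeriodBasis) (q : Jet n) (L : ℕ) :
    IsOpen (jetCurve q L ⁻¹' P.D) :=
  P.isOpen_D.preimage (contDiff_jetCurve q L (N := 0)).continuous

theorem zero_mem_curve_preimage (hq : q 0 ∈ P.D) (L : ℕ) : (0 : ℂ) ∈ jetCurve q L ⁻¹' P.D := by
  simpa [jetCurve_zero] using hq

theorem dxGrad_eq (hq : q 0 ∈ P.D) (hl : l ∈ P.W) {s : ℕ} (hL : s ≤ L) (γ σ : Fin n) :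
    P.dxGrad s γ σ l q = (M.curveDet (jetCurve q L) (0, l))⁻¹ ^ s
      * (M.gradNum (jetCurve q L) s (0, l) *ᵥ M.grad (fun w => P.p σ w l) (q 0)) γ := by
  have hv := analyticAt_jetCurve q L
  rw [dxGrad, dx_eq (P.analyticAt_grad hq hl σ γ) hL]
  have := iteratedDeriv_numSeq (P.isOpen_curve_preimage q L) (l := l)
    (Δ := M.curveDet (jetCurve q L)) (Z := M.curveConn (jetCurve q L))
    (A := fun _ => (1 : Matrix (Fin n) (Fin n) ℂ))
    (Y := fun y => M.grad (fun w => P.p σ w l) (jetCurve q L y))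
    (fun x hx => analyticAt_curveDet (hv x) (P.D_subset hx))
    (fun x hx => analyticAt_curveConn (hv x) (P.D_subset hx)) (fun _ _ _ _ => analyticAt_const)
    (fun x hx => P.det_ne_zero hx hl) (fun x hx j => hasDerivAt_grad (hv x) hx hl σ j) 0 γ s
    (zero_mem_curve_preimage hq L)
  simp only [pow_zero, one_mul, Matrix.one_mulVec, zero_add, jetCurve_zero] at this
  exact this

theorem dxResolvent_eq (hq : q 0 ∈ P.D) (hl : l ∈ P.W) {s : ℕ} (hL : s ≤ L) (γ : Fin n) :
    P.dxResolvent s γ l q = (M.curveDet (jetCurve q L) (0, l))⁻¹ ^ (s + 1)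
      * M.resNum (jetCurve q L) s (0, l) γ () := by
  have hv := analyticAt_jetCurve q L
  have hf : AnalyticAt ℂ (fun v => ((M.opU v - l • (1 : Matrix (Fin n) (Fin n) ℂ))⁻¹.mulVec (M.e v)) γ)
      (q 0) := by
    simp only [Matrix.mulVec, dotProduct]
    exact Finset.analyticAt_fun_sum _ fun j _ =>
      (analyticAt_inv_apply (analyticAt_opUsub (P.D_subset hq) l) (P.det_ne_zero hq hl) γ j).mul
        (analyticAt_e (P.D_subset hq) j)
  rw [dxResolvent, dx_eq hf hL]
  -- The resolvent involves no period, so the linear equation is the trivial one: Z = 0 with the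
  -- scalar solution Y = 1.
  have := iteratedDeriv_numSeq (P.isOpen_curve_preimage q L) (l := l)
    (Δ := M.curveDet (jetCurve q L)) (Z := fun _ => (0 : Matrix Unit Unit ℂ))
    (A := M.curveRes (jetCurve q L)) (Y := fun _ _ => 1)
    (fun x hx => analyticAt_curveDet (hv x) (P.D_subset hx))
    (fun _ _ _ _ => analyticAt_const)
    (fun x hx => analyticAt_curveRes (hv x) (P.D_subset hx))
    (fun x hx => P.det_ne_zero hx hl)
    (fun x hx j => (hasDerivAt_const x (1 : ℂ)).congr_deriv (by simp)) 1 γ s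
    (zero_mem_curve_preimage hq L)
  rw [add_comm 1 s] at this
  refine Eq.trans ?_ (this.trans ?_)
  · congr 1
    ext x
    change ((M.opUsub l _)⁻¹ *ᵥ _) γ = _
    rw [opUsub_inv, pow_one, Matrix.smul_mulVec]
    simp [curveDet, curveRes, curveAdj, Matrix.mulVec, dotProduct, Matrix.mul_apply]
  · simp [resNum, Matrix.mulVec, dotProduct]

theorem deriv_dx_p_eq (hq : q 0 ∈ P.D) (hl : l ∈ P.W) {k : ℕ} (hL : k + 1 ≤ L) (σ : Fin n) :
    deriv (fun l' => dx (k + 1) (fun v _ => P.p σ v l') q) l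
      = (M.curveDet (jetCurve q L) (0, l))⁻¹ ^ (k + 1)
        * (M.rowNum (jetCurve q L) k (0, l) *ᵥ M.grad (fun w => P.p σ w l) (q 0)) () := by
  have hv := analyticAt_jetCurve q L
  have h0 := zero_mem_curve_preimage hq L
  have hS := P.isOpen_curve_preimage q L
  have h1 : (fun l' => dx (k + 1) (fun v _ => P.p σ v l') q)
      =ᶠ[𝓝 l] fun l' => iteratedDeriv (k + 1) (fun x => P.p σ (jetCurve q L x) l') 0 := by
    filter_upwards [P.isOpen_W.mem_nhds hl] with l' hl'
    exact dx_eq (P.analyticAt_p hq hl' σ) hL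
  have h2 : AnalyticOnNhd ℂ (fun z : ℂ × ℂ => P.p σ (jetCurve q L z.1) z.2)
      ((jetCurve q L ⁻¹' P.D) ×ˢ P.W) := fun z hz =>
    AnalyticAt.fun_comp (f := fun z : ℂ × ℂ => (jetCurve q L z.1, z.2))
      (P.analytic σ (jetCurve q L z.1, z.2) hz)
      ((AnalyticAt.fun_comp (f := fun z : ℂ × ℂ => z.1) (hv z.1) analyticAt_fst).prod analyticAt_snd)
  rw [h1.deriv_eq]
  refine (deriv_iteratedDeriv_comm hS P.isOpen_W h2 hl (k + 1) h0).trans ?_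
  -- The innermost x-derivative is split off, because ∂_x ∂_l p, unlike ∂_l p, is linear in ∇p. This
  -- accounts for the index shift in `rowNum`.
  rw [iteratedDeriv_succ']
  rw [iteratedDeriv_congr_of_isOpen hS (fun x hx => deriv_deriv_p (hv x) hx hl σ) k h0]
  have := iteratedDeriv_numSeq hS (l := l)
    (Δ := M.curveDet (jetCurve q L)) (Z := M.curveConn (jetCurve q L))
    (A := M.curveRow (jetCurve q L))
    (Y := fun y => M.grad (fun w => P.p σ w l) (jetCurve q L y))
    (fun x hx => analyticAt_curveDet (hv x) (P.D_subset hx))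
    (fun x hx => analyticAt_curveConn (hv x) (P.D_subset hx))
    (fun x hx => analyticAt_curveRow (hv x) (P.D_subset hx))
    (fun x hx => P.det_ne_zero hx hl) (fun x hx j => hasDerivAt_grad (hv x) hx hl σ j) 1 () k h0
  rw [this, jetCurve_zero, add_comm 1 k]
  rfl

theorem sum_gram (hq : q 0 ∈ P.D) (hl : l ∈ P.W) (A : Matrix (Fin n) (Fin n) ℂ)
    (B : Matrix Unit (Fin n) ℂ) (γ : Fin n) :
    ∑ α, ∑ β, (A *ᵥ M.grad (fun w => P.p α w l) (q 0)) γ * P.gram (q 0) l α β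
        * (B *ᵥ M.grad (fun w => P.p β w l) (q 0)) ()
      = (M.curveDet (jetCurve q L) (0, l))⁻¹
        * (A * M.curveAdj (jetCurve q L) (0, l) * M.η⁻¹ * Bᵀ) γ () := by
  set Ψ : Matrix (Fin n) (Fin n) ℂ := Matrix.of fun γ σ => M.grad (fun w => P.p σ w l) (q 0) γ with hΨ
  have h1 : ∀ (κ : Type) (C : Matrix κ (Fin n) ℂ) (i : κ) σ,
      (C *ᵥ M.grad (fun w => P.p σ w l) (q 0)) i = (C * Ψ) i σ := by
    intro κ C i σ; simp [Matrix.mulVec, dotProduct, Matrix.mul_apply, hΨ]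
  have h2 : ∑ α, ∑ β, (A * Ψ) γ α * P.gram (q 0) l α β * (B * Ψ) () β
      = (A * (Ψ * P.gram (q 0) l * Ψᵀ) * Bᵀ) γ () := by
    have : A * (Ψ * P.gram (q 0) l * Ψᵀ) * Bᵀ = A * Ψ * P.gram (q 0) l * (B * Ψ)ᵀ := by
      simp only [Matrix.transpose_mul, Matrix.mul_assoc]
    rw [this, Finset.sum_comm, Matrix.mul_apply]
    refine Finset.sum_congr rfl fun β _ => ?_
    rw [Matrix.mul_apply (N := P.gram (q 0) l), Matrix.transpose_apply]
    exact (Finset.sum_mul _ _ _).symm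
  simp only [h1]
  rw [h2, gram_contraction hq hl, opUsub_inv]
  simp [curveDet, curveAdj, jetCurve_zero, Matrix.mul_assoc]

/-- The powers of Δ⁻¹ add up uniformly: s - k from the gradient, k from the l-derivative and 1 from
the Gram contraction make s + 1, the same as for the resolvent. The periods disappear from the
numerator. -/
theorem K_eq (hq : q 0 ∈ P.D) (hl : l ∈ P.W) {s : ℕ} (hL : s ≤ L) (γ : Fin n) :
    P.K γ s l q = (M.curveDet (jetCurve q L) (0, l))⁻¹ ^ (s + 1)
      * M.kNum (jetCurve q L) s l γ () := by
  rw [K, dxResolvent_eq hq hl hL, kNum, Matrix.add_apply, mul_add, Matrix.sum_apply, Finset.mul_sum]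
  congr 1
  · simp only [Matrix.smul_apply, smul_eq_mul]; ring
  refine Finset.sum_congr rfl fun k hk => ?_
  obtain ⟨hk1, hks⟩ := Finset.mem_Icc.mp hk
  obtain ⟨k, rfl⟩ := Nat.exists_eq_add_of_le' hk1
  simp only [deriv_dx_p_eq hq hl (hks.trans hL),
    dxGrad_eq hq hl ((Nat.sub_le s (k + 1)).trans hL), Nat.add_sub_cancel, Matrix.smul_apply, smul_eq_mul]
  set t := (M.curveDet (jetCurve q L) (0, l))⁻¹ with ht
  have h1 := sum_gram (L := L) hq hl (M.gradNum (jetCurve q L) (s - (k + 1)) (0, l))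
    (M.rowNum (jetCurve q L) k (0, l)) γ
  rw [← ht] at h1
  have h2 : t ^ (s + 1) = t ^ (s - (k + 1)) * t ^ (k + 1) * t := by
    rw [← pow_add, ← pow_succ]; congr 1; omega
  rw [h2]
  have h3 : ∀ (X : Fin n → ℂ) (Y : Matrix (Fin n) (Fin n) ℂ) (Z : Fin n → ℂ),
      (∑ α, ∑ β, t ^ (s - (k + 1)) * X α * Y α β * (t ^ (k + 1) * Z β))
        = t ^ (s - (k + 1)) * t ^ (k + 1) * ∑ α, ∑ β, X α * Y α β * Z β := by
    intro X Y Z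
    simp only [Finset.mul_sum]
    exact Finset.sum_congr rfl fun α _ => Finset.sum_congr rfl fun β _ => by ring
  refine (congrArg _ (h3 (fun α => _) (P.gram (q 0) l) (fun β => _))).trans ?_
  rw [h1]
  ring

end Numerators

end PeriodBasis

end GFM

/-! ### A binomial identity for rising factorials -/

section RisingFactorial

/-- The rising factorial `a (a + 1) ⋯ (a + k - 1)`. -/
def rising (a : ℂ) (k : ℕ) : ℂ := (ascPochhammer ℂ k).eval a

theorem rising_zero (a : ℂ) : rising a 0 = 1 := by simp [rising]

theorem rising_succ (a : ℂ) (k : ℕ) : rising a (k + 1) = rising a k * (a + k) :=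
  ascPochhammer_succ_eval k a

theorem rising_succ_left (a : ℂ) (k : ℕ) : rising a (k + 1) = a * rising (a + 1) k := by
  simp [rising, ascPochhammer_succ_left, Polynomial.eval_comp]

theorem rising_one (k : ℕ) : rising 1 k = k.factorial := by
  simp [rising, ascPochhammer_eval_one]

theorem rising_half_ne_zero (k : ℕ) : rising (1 / 2) k ≠ 0 := by
  induction k with
  | zero => simp [rising_zero]
  | succ k ih =>
    rw [rising_succ]
    refine mul_ne_zero ih fun h => ?_
    have := congrArg Complex.re h
    simp at this
    have h2 : (0 : ℝ) ≤ k := Nat.cast_nonneg k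
    linarith

/-- The Chu-Vandermonde identity. -/
theorem rising_add (a b : ℂ) (N : ℕ) :
    ∑ k ∈ Finset.range (N + 1), (N.choose k : ℂ) * (rising a k * rising b (N - k))
      = rising (a + b) N := by
  rw [← Finset.Nat.sum_antidiagonal_eq_sum_range_succ
    (fun i j => (N.choose i : ℂ) * (rising a i * rising b j))]
  induction N with
  | zero => simp [rising_zero]
  | succ N ih =>
    rw [Finset.sum_antidiagonal_choose_succ_mul (fun i j => rising a i * rising b j),
      rising_succ (a + b), ← ih, Finset.sum_mul, ← Finset.sum_add_distrib]
    refine Finset.sum_congr rfl fun ij hij => ?_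
    have h1 := Finset.HasAntidiagonal.mem_antidiagonal.mp hij
    have h2 : N.choose ij.2 = N.choose ij.1 := Nat.choose_symm_of_eq_add (by omega)
    rw [h2, rising_succ, rising_succ]
    have h3 : (N : ℂ) = ij.1 + ij.2 := by rw [← h1]; push_cast; rfl
    rw [h3]
    ring

/-- The factor k C(s+1,k+1) equals (s+1) C(s,k) - C(s+1,k+1), and each piece is a Chu-Vandermonde
sum, with parameters (1/2, 1/2) and (-1/2, 1/2). The term (s+1) s! will cancel the resolvent's
contribution to K. -/
theorem sum_choose_rising (s : ℕ) :
    ∑ k ∈ Finset.Icc 1 s, ((k : ℂ) * ((s + 1).choose (k + 1) : ℂ))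
        * (rising (1 / 2) k * rising (1 / 2) (s - k))
      = ((s : ℂ) + 1) * s.factorial - 2 * rising (1 / 2) (s + 1) := by
  have h1 : ∑ k ∈ Finset.Icc 1 s, ((k : ℂ) * ((s + 1).choose (k + 1) : ℂ))
        * (rising (1 / 2) k * rising (1 / 2) (s - k))
      = ∑ k ∈ Finset.range (s + 1), ((k : ℂ) * ((s + 1).choose (k + 1) : ℂ))
        * (rising (1 / 2) k * rising (1 / 2) (s - k)) := by
    refine Finset.sum_subset (fun k hk => ?_) fun k hk hk' => ?_
    · have := Finset.mem_Icc.mp hk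
      exact Finset.mem_range.mpr (by omega)
    · have : k = 0 := by
        by_contra h0
        exact hk' (Finset.mem_Icc.mpr ⟨by omega, by have := Finset.mem_range.mp hk; omega⟩)
      simp [this]
  have h2 : ∀ k : ℕ, (k : ℂ) * ((s + 1).choose (k + 1) : ℂ)
      = (s + 1) * (s.choose k : ℂ) - ((s + 1).choose (k + 1) : ℂ) := by
    intro k
    have := Nat.add_one_mul_choose_eq s k
    have h := congrArg (Nat.cast (R := ℂ)) this
    push_cast at h
    linear_combination -h
  have h3 : ∑ k ∈ Finset.range (s + 1), ((s + 1).choose (k + 1) : ℂ)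
      * (rising (1 / 2) k * rising (1 / 2) (s - k)) = 2 * rising (1 / 2) (s + 1) := by
    -- The full sum is (0)_{s+1} = 0, so the k = 0 term determines the rest; (-1/2)_{k+1} =
    -- -(1/2)(1/2)_k supplies the factor 2.
    have h4 := rising_add (-1 / 2) (1 / 2) (s + 1)
    rw [Finset.sum_range_succ'] at h4
    have h5 : rising (-1 / 2 + 1 / 2) (s + 1) = 0 := by
      rw [rising_succ_left]; norm_num
    have h6 : ∀ k, rising (-1 / 2) (k + 1) = -1 / 2 * rising (1 / 2) k := by
      intro k
      rw [rising_succ_left]; norm_num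
    rw [h5] at h4
    simp only [h6, Nat.succ_sub_succ_eq_sub, rising_zero, Nat.choose_zero_right, Nat.cast_one,
      Nat.sub_zero, one_mul] at h4
    have h7 : ∑ k ∈ Finset.range (s + 1), ((s + 1).choose (k + 1) : ℂ)
        * (-1 / 2 * rising (1 / 2) k * rising (1 / 2) (s - k))
        = -1 / 2 * ∑ k ∈ Finset.range (s + 1), ((s + 1).choose (k + 1) : ℂ)
        * (rising (1 / 2) k * rising (1 / 2) (s - k)) := by
      rw [Finset.mul_sum]
      exact Finset.sum_congr rfl fun k _ => by ring
    rw [h7] at h4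
    linear_combination (-2) * h4
  have h8 := rising_add (1 / 2) (1 / 2) s
  rw [add_halves, rising_one] at h8
  rw [h1]
  simp only [h2, sub_mul, Finset.sum_sub_distrib, h3, mul_assoc ((s : ℂ) + 1), ← Finset.mul_sum, h8]

end RisingFactorial

/-! ### Numerators at a simple eigenvalue of U -/

namespace GFM

variable {n : ℕ} {M : GFM n}

/-- A multiplicative character `ℓ` of the algebra at the point `w` with a dual vector `π` on which
the algebra acts through this character. -/
structure IsEigen (M : GFM n) (w π ℓ : V n) : Prop where
  mulVec : ∀ h, M.mulMat w h *ᵥ π = (ℓ ⬝ᵥ h) • π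
  vecMul : ∀ h, ℓ ᵥ* M.mulMat w h = (ℓ ⬝ᵥ h) • ℓ
  dual : ℓ ⬝ᵥ π = 1

/-- The eigenvalue `u = ℓ(E)` of `U` that belongs to the character `ℓ` is simple, and the adjugate
of `U - u` is `τ π ⊗ ℓ`. -/
structure IsSimpleEigen (M : GFM n) (w π ℓ : V n) (τ : ℂ) : Prop extends IsEigen M w π ℓ where
  ne_zero : τ ≠ 0
  adjugate : (M.opUsub (ℓ ⬝ᵥ M.E w) w).adjugate = τ • Matrix.vecMulVec π ℓ

namespace IsEigen

variable {w π ℓ : V n}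

theorem dotProduct_unit (h : IsEigen M w π ℓ) (hw : w ∈ M.domain) : ℓ ⬝ᵥ M.e w = 1 := by
  have h1 := congrArg (· ⬝ᵥ π) (h.vecMul (M.e w))
  simpa [mulMat_unit hw, h.dual] using h1.symm

/-- Invariance of η makes the algebra act on the covector ηπ through ℓ, and such a covector is
determined by its value on e. That value is κ. -/
theorem exists_metric (h : IsEigen M w π ℓ) (hw : w ∈ M.domain) :
    ∃ κ : ℂ, κ ≠ 0 ∧ M.η *ᵥ π = κ • ℓ := by
  have h1 : ∀ X, (M.η *ᵥ π) ᵥ* M.mulMat w X = (ℓ ⬝ᵥ X) • (M.η *ᵥ π) := by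
    intro X
    rw [← Matrix.mulVec_transpose, Matrix.mulVec_mulVec, mulMat_transpose_mul hw,
      ← Matrix.mulVec_mulVec, h.mulVec, Matrix.mulVec_smul]
  have h3 : M.η *ᵥ π = ((M.η *ᵥ π) ⬝ᵥ M.e w) • ℓ := by
    refine dotProduct_eq _ _ fun X => ?_
    have h2 : (M.η *ᵥ π) ⬝ᵥ X = ((M.η *ᵥ π) ᵥ* M.mulMat w X) ⬝ᵥ M.e w := by
      rw [← Matrix.dotProduct_mulVec, mulMat_mulVec, mul_unit hw]
    rw [h2, h1, smul_dotProduct, smul_dotProduct, smul_eq_mul, smul_eq_mul, mul_comm]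
  refine ⟨(M.η *ᵥ π) ⬝ᵥ M.e w, fun h0 => ?_, h3⟩
  rw [h0, zero_smul] at h3
  have h4 : π = 0 := by
    rw [← Matrix.one_mulVec π, ← η_inv_mul (M := M), ← Matrix.mulVec_mulVec, h3, Matrix.mulVec_zero]
  simpa [h4] using h.dual

/-- Up to the factor κ this is ⟨π, μπ⟩, which equals its own negative by antisymmetry of μ. -/
theorem dotProduct_opμ (h : IsEigen M w π ℓ) (hw : w ∈ M.domain) :
    ℓ ⬝ᵥ (M.opμ w *ᵥ π) = 0 := by
  obtain ⟨κ, hκ, hη⟩ := h.exists_metric hw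
  have h1 : κ * (ℓ ⬝ᵥ (M.opμ w *ᵥ π)) = π ⬝ᵥ ((M.η * M.opμ w) *ᵥ π) := by
    rw [← smul_eq_mul, ← smul_dotProduct, ← hη, ← Matrix.mulVec_mulVec, Matrix.dotProduct_mulVec π,
      ← Matrix.mulVec_transpose, η_transpose]
  have h2 : π ⬝ᵥ ((M.η * M.opμ w) *ᵥ π) = -(π ⬝ᵥ ((M.η * M.opμ w) *ᵥ π)) := by
    conv_lhs => rw [Matrix.dotProduct_mulVec, ← Matrix.mulVec_transpose, Matrix.transpose_mul,
      η_transpose, opμ_transpose_mul hw, dotProduct_comm, Matrix.neg_mulVec, dotProduct_neg]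
  have h3 := self_eq_neg.mp h2
  rw [h3] at h1
  exact (mul_eq_zero.mp h1).resolve_left hκ

theorem opUsub_mulVec (h : IsEigen M w π ℓ) (hw : w ∈ M.domain) :
    M.opUsub (ℓ ⬝ᵥ M.E w) w *ᵥ π = 0 := by
  rw [opUsub_eq_mulMat hw, h.mulVec, dotProduct_sub, dotProduct_smul, h.dotProduct_unit hw]
  simp

theorem det_eq_zero (h : IsEigen M w π ℓ) (hw : w ∈ M.domain) :
    (M.opUsub (ℓ ⬝ᵥ M.E w) w).det = 0 := by
  by_contra h0
  have h1 := Matrix.eq_zero_of_mulVec_eq_zero h0 (h.opUsub_mulVec hw)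
  simpa [h1] using h.dual

/-- The commutator with μ has no diagonal entry, so only multiplication by X contributes. This is
the relation du = ℓ without any differentiation of eigenvalues. -/
theorem dotProduct_pd_opU (h : IsEigen M w π ℓ) (hw : w ∈ M.domain) (X : V n) :
    ℓ ⬝ᵥ ((∑ α, X α • pdMat α M.opU w) *ᵥ π) = ℓ ⬝ᵥ X := by
  have h1 : ∑ α, X α • pdMat α M.opU w
      = M.mulMat w X + M.mulMat w X * M.opμ w - M.opμ w * M.mulMat w X := by
    simp only [pdMat_opU hw, smul_sub, smul_add, Finset.sum_sub_distrib, Finset.sum_add_distrib,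
      mulMat, Finset.sum_mul, Finset.mul_sum, smul_mul_assoc, mul_smul_comm]
  rw [h1, Matrix.sub_mulVec, Matrix.add_mulVec, dotProduct_sub, dotProduct_add,
    ← Matrix.mulVec_mulVec, ← Matrix.mulVec_mulVec, Matrix.dotProduct_mulVec ℓ (M.mulMat w X),
    Matrix.dotProduct_mulVec ℓ (M.mulMat w X), h.vecMul, h.mulVec, Matrix.mulVec_smul]
  simp [h.dual, h.dotProduct_opμ hw]

end IsEigen

namespace IsSimpleEigen

variable {w π ℓ : V n} {τ : ℂ} {v : ℂ → V n}

theorem curveAdj_eq (h : IsSimpleEigen M (v 0) π ℓ τ) :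
    M.curveAdj v (0, ℓ ⬝ᵥ M.E (v 0)) = τ • Matrix.vecMulVec π ℓ := h.adjugate

/-- Differentiate adj(U - u)(U - u) = det(U - u) with u held fixed and sandwich it between ℓ and π.
The derivative of the adjugate drops out because (U - u)π = 0. -/
theorem dX_curveDet (h : IsSimpleEigen M (v 0) π ℓ τ) (hv : AnalyticAt ℂ v 0)
    (hw : v 0 ∈ M.domain) :
    dX (M.curveDet v) (0, ℓ ⬝ᵥ M.E (v 0)) = τ * (ℓ ⬝ᵥ deriv v 0) := by
  set u := ℓ ⬝ᵥ M.E (v 0) with hu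
  have hU : ∀ i j, HasDerivAt (fun x => M.opUsub u (v x) i j)
      ((∑ α, deriv v 0 α • pdMat α M.opU (v 0)) i j) 0 := by
    intro i j
    refine (hasDerivAt_comp_curve (analyticAt_opUsub hw u i j) hv).congr_deriv ?_
    simp only [Matrix.sum_apply, Matrix.smul_apply, smul_eq_mul, ← pdMat_opUsub u]
    rfl
  have hA : ∀ i j, HasDerivAt (fun x => M.curveAdj v (x, u) i j)
      (dX (fun z => M.curveAdj v z i j) (0, u)) 0 := fun i j =>
    hasDerivAt_fst (analyticAt_curveAdj hv hw i j)
  have hΔ := hasDerivAt_fst (analyticAt_curveDet (z := (0, u)) hv hw)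
  set A' : Matrix (Fin n) (Fin n) ℂ := Matrix.of fun i j => dX (fun z => M.curveAdj v z i j) (0, u)
  set U' := ∑ α, deriv v 0 α • pdMat α M.opU (v 0) with hU'
  have h1 : A' * M.opUsub u (v 0) + M.curveAdj v (0, u) * U'
      = dX (M.curveDet v) (0, u) • (1 : Matrix (Fin n) (Fin n) ℂ) := by
    ext i j
    have h2 : HasDerivAt (fun x => (M.curveAdj v (x, u) * M.opUsub u (v x)) i j)
        ((A' * M.opUsub u (v 0) + M.curveAdj v (0, u) * U') i j) 0 := by
      simp only [Matrix.mul_apply, Matrix.add_apply]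
      rw [← Finset.sum_add_distrib]
      exact HasDerivAt.fun_sum fun k _ => (hA i k).fun_mul (hU k j)
    have h3 : (fun x => (M.curveAdj v (x, u) * M.opUsub u (v x)) i j)
        = fun x => M.curveDet v (x, u) * (1 : Matrix (Fin n) (Fin n) ℂ) i j := by
      ext x
      simp only [curveAdj, curveDet, Matrix.adjugate_mul, Matrix.smul_apply, smul_eq_mul]
    rw [h3] at h2
    exact h2.unique (hΔ.mul_const _)
  have h4 := congrArg (fun B : Matrix (Fin n) (Fin n) ℂ => ℓ ⬝ᵥ (B *ᵥ π)) h1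
  simp only [Matrix.add_mulVec, ← Matrix.mulVec_mulVec, h.opUsub_mulVec hw, hu, h.curveAdj_eq,
    Matrix.mulVec_zero, zero_add, Matrix.smul_mulVec, Matrix.one_mulVec, dotProduct_smul, h.dual,
    smul_eq_mul, mul_one, Matrix.vecMulVec_mulVec] at h4
  rw [hU', h.dotProduct_pd_opU hw] at h4
  simp only [op_smul_eq_smul, smul_eq_mul, mul_one] at h4
  exact h4.symm

theorem curveMu_mulVec (h : IsSimpleEigen M (v 0) π ℓ τ) (hw : v 0 ∈ M.domain) (u : ℂ) :
    ℓ ⬝ᵥ (M.curveMu v (0, u) *ᵥ π) = 1 / 2 := by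
  rw [curveMu, Matrix.add_mulVec, dotProduct_add, h.dotProduct_opμ hw, Matrix.smul_mulVec,
    Matrix.one_mulVec, dotProduct_smul, h.dual]
  simp

/-- The rank-one adjugate makes the connection numerator rank one; since ℓ is a character,
multiplication by v_x contributes only the scalar ℓ(v_x). -/
theorem vecMul_curveConn (h : IsSimpleEigen M (v 0) π ℓ τ) (y : V n) :
    y ᵥ* M.curveConn v (0, ℓ ⬝ᵥ M.E (v 0))
      = -((τ * (ℓ ⬝ᵥ deriv v 0) * (y ⬝ᵥ π)) • (ℓ ᵥ* M.curveMu v (0, ℓ ⬝ᵥ M.E (v 0)))) := by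
  rw [curveConn, Matrix.vecMul_neg, ← Matrix.vecMul_vecMul, ← Matrix.vecMul_vecMul, h.curveAdj_eq,
    Matrix.vecMul_smul, Matrix.vecMul_vecMulVec]
  simp only [Matrix.smul_vecMul, h.vecMul, smul_smul]
  congr 2
  ring

theorem curveConn_mulVec (h : IsSimpleEigen M (v 0) π ℓ τ) (hw : v 0 ∈ M.domain) :
    M.curveConn v (0, ℓ ⬝ᵥ M.E (v 0)) *ᵥ π = -((τ * (ℓ ⬝ᵥ deriv v 0) / 2) • π) := by
  refine dotProduct_eq _ _ fun y => ?_
  rw [dotProduct_comm, Matrix.dotProduct_mulVec, h.vecMul_curveConn, neg_dotProduct, smul_dotProduct,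
    ← Matrix.dotProduct_mulVec, h.curveMu_mulVec hw, neg_dotProduct, smul_dotProduct,
    dotProduct_comm π y]
  simp only [smul_eq_mul]
  ring

/-- Since Δ vanishes here, the derivative of A drops out and the recursion closes up at a single
point. With b = τ ℓ(v_x), the operator Z contributes -b/2 on π, so the steps multiply by -b(k +
1/2), -b(k + 3/2) and -b(k + 1) in the three sequences below. -/
theorem numNext_eq {ι κ : Type*} [Fintype κ] (h : IsSimpleEigen M (v 0) π ℓ τ)
    (hv : AnalyticAt ℂ v 0) (hw : v 0 ∈ M.domain) (Z : ℂ × ℂ → Matrix κ κ ℂ) (m : ℕ)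
    (A : ℂ × ℂ → Matrix ι κ ℂ) :
    numNext (M.curveDet v) Z m A (0, ℓ ⬝ᵥ M.E (v 0))
      = -(m * (τ * (ℓ ⬝ᵥ deriv v 0))) • A (0, ℓ ⬝ᵥ M.E (v 0))
        + A (0, ℓ ⬝ᵥ M.E (v 0)) * Z (0, ℓ ⬝ᵥ M.E (v 0)) := by
  have h0 : M.curveDet v (0, ℓ ⬝ᵥ M.E (v 0)) = 0 := h.det_eq_zero hw
  ext i j
  simp [numNext, h0, h.dX_curveDet hv hw]

theorem resNum_succ (M : GFM n) (v : ℂ → V n) (k : ℕ) :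
    M.resNum v (k + 1)
      = numNext (M.curveDet v) (fun _ => (0 : Matrix Unit Unit ℂ)) (1 + k) (M.resNum v k) := rfl

theorem gradNum_mulVec (h : IsSimpleEigen M (v 0) π ℓ τ) (hv : AnalyticAt ℂ v 0)
    (hw : v 0 ∈ M.domain) (k : ℕ) :
    M.gradNum v k (0, ℓ ⬝ᵥ M.E (v 0)) *ᵥ π
      = ((-(τ * (ℓ ⬝ᵥ deriv v 0))) ^ k * rising (1 / 2) k) • π := by
  induction k with
  | zero => simp [gradNum, numSeq, rising_zero]
  | succ k ih =>
    change numNext _ _ _ (M.gradNum v k) _ *ᵥ π = _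
    rw [h.numNext_eq hv hw, Matrix.add_mulVec, Matrix.smul_mulVec, ← Matrix.mulVec_mulVec,
      h.curveConn_mulVec hw, Matrix.mulVec_neg, Matrix.mulVec_smul, ih, rising_succ]
    push_cast
    module

theorem rowNum_eq (h : IsSimpleEigen M (v 0) π ℓ τ) (hv : AnalyticAt ℂ v 0)
    (hw : v 0 ∈ M.domain) {κ : ℂ} (hκ : M.η *ᵥ π = κ • ℓ) (k : ℕ) :
    M.rowNum v k (0, ℓ ⬝ᵥ M.E (v 0))
      = ((-(τ * (ℓ ⬝ᵥ deriv v 0))) ^ k * rising (3 / 2) k * (τ * (ℓ ⬝ᵥ deriv v 0) * κ))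
        • Matrix.replicateRow Unit (ℓ ᵥ* M.curveMu v (0, ℓ ⬝ᵥ M.E (v 0))) := by
  induction k with
  | zero =>
    simp only [rowNum, numSeq, curveRow, h.curveAdj_eq, Matrix.mul_assoc, Matrix.smul_mul,
      Matrix.mul_smul]
    rw [← Matrix.mul_assoc M.η, Matrix.mul_vecMulVec, hκ]
    ext i j
    simp [Matrix.mul_apply, Matrix.vecMulVec_apply, rising_zero, Matrix.vecMul, dotProduct,
      Finset.mul_sum, Finset.sum_mul]
    rw [Finset.sum_comm]
    refine Finset.sum_congr rfl fun a _ => Finset.sum_congr rfl fun b _ => by ring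
  | succ k ih =>
    change numNext _ _ _ (M.rowNum v k) _ = _
    rw [h.numNext_eq hv hw, ih, Matrix.smul_mul, ← Matrix.replicateRow_vecMul, h.vecMul_curveConn,
      ← Matrix.dotProduct_mulVec, h.curveMu_mulVec hw, rising_succ]
    ext i j
    simp only [Matrix.add_apply, Matrix.smul_apply, Matrix.replicateRow_apply, smul_eq_mul,
      Pi.neg_apply, Pi.smul_apply]
    push_cast
    ring

theorem resNum_eq (h : IsSimpleEigen M (v 0) π ℓ τ) (hv : AnalyticAt ℂ v 0)
    (hw : v 0 ∈ M.domain) (k : ℕ) :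
    M.resNum v k (0, ℓ ⬝ᵥ M.E (v 0))
      = ((-(τ * (ℓ ⬝ᵥ deriv v 0))) ^ k * k.factorial * τ) • Matrix.replicateCol Unit π := by
  induction k with
  | zero =>
    simp only [resNum, numSeq, curveRes, h.curveAdj_eq, Matrix.smul_mul]
    rw [← Matrix.replicateCol_mulVec, Matrix.vecMulVec_mulVec, h.dotProduct_unit hw]
    simp
  | succ k ih =>
    rw [resNum_succ, h.numNext_eq hv hw, ih, Matrix.mul_zero, add_zero, smul_smul, Nat.factorial_succ]
    congr 1
    push_cast
    ring

/-- All terms are multiples of π. The resolvent gives (s+1) s! and the k-th product -(1/2)_k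
(1/2)_{s-k}, up to the common factor (-b)^s τ; `sum_choose_rising` leaves a coefficient that never
vanishes for b ≠ 0. -/
theorem kNum_eq (h : IsSimpleEigen M (v 0) π ℓ τ) (hv : AnalyticAt ℂ v 0)
    (hw : v 0 ∈ M.domain) (s : ℕ) :
    M.kNum v s (ℓ ⬝ᵥ M.E (v 0))
      = ((-(τ * (ℓ ⬝ᵥ deriv v 0))) ^ s * (2 * rising (1 / 2) (s + 1)) * τ)
        • Matrix.replicateCol Unit π := by
  obtain ⟨κ, -, hη⟩ := h.exists_metric hw
  set u := ℓ ⬝ᵥ M.E (v 0) with hu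
  set b := τ * (ℓ ⬝ᵥ deriv v 0) with hb
  have h1 : κ • (M.η⁻¹ *ᵥ (ℓ ᵥ* M.curveMu v (0, u))) = ((1 / 2 : ℂ) • 1 - M.opμ (v 0)) *ᵥ π := by
    have h2 : (M.curveMu v (0, u))ᵀ * M.η = M.η * ((1 / 2 : ℂ) • 1 - M.opμ (v 0)) := by
      simp only [curveMu, Matrix.transpose_add, Matrix.transpose_smul, Matrix.transpose_one, add_mul,
        opμ_transpose_mul hw, mul_sub, smul_mul_assoc, one_mul, mul_smul_comm, mul_one]
      abel
    rw [← Matrix.mulVec_smul, ← Matrix.smul_vecMul, ← hη, ← Matrix.mulVec_transpose,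
      Matrix.mulVec_mulVec π, h2, Matrix.mulVec_mulVec, ← Matrix.mul_assoc, η_inv_mul, one_mul]
  have h3 : ℓ ⬝ᵥ (((1 / 2 : ℂ) • 1 - M.opμ (v 0)) *ᵥ π) = 1 / 2 := by
    rw [Matrix.sub_mulVec, dotProduct_sub, h.dotProduct_opμ hw, Matrix.smul_mulVec,
      Matrix.one_mulVec, dotProduct_smul, h.dual]
    simp
  have hterm : ∀ k ∈ Finset.Icc 1 s,
      M.gradNum v (s - k) (0, u) * M.curveAdj v (0, u) * M.η⁻¹ * (M.rowNum v (k - 1) (0, u))ᵀ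
        = (-((-b) ^ s * (rising (1 / 2) k * rising (1 / 2) (s - k)) * τ))
          • Matrix.replicateCol Unit π := by
    intro k hk
    obtain ⟨hk1, hks⟩ := Finset.mem_Icc.mp hk
    obtain ⟨k, rfl⟩ := Nat.exists_eq_add_of_le' hk1
    rw [Nat.add_sub_cancel, h.rowNum_eq hv hw hη, h.curveAdj_eq, Matrix.transpose_smul,
      Matrix.transpose_replicateRow, Matrix.mul_smul, Matrix.mul_assoc, ← Matrix.replicateCol_mulVec,
      ← Matrix.replicateCol_mulVec, ← Matrix.mulVec_mulVec, Matrix.smul_mulVec,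
      Matrix.vecMulVec_mulVec, op_smul_eq_smul, Matrix.mulVec_smul, Matrix.mulVec_smul,
      h.gradNum_mulVec hv hw, ← hu, ← hb]
    -- The factor κ from `rowNum` turns ℓ back into ηπ; passing η across μ + 1/2 gives ℓ((1/2 - μ)π)
    -- = 1/2.
    have h4 : ℓ ⬝ᵥ (M.η⁻¹ *ᵥ (ℓ ᵥ* M.curveMu v (0, u))) * κ = 1 / 2 := by
      rw [mul_comm, ← smul_eq_mul, ← dotProduct_smul, h1, h3]
    have h5 : rising (1 / 2) (k + 1) = 1 / 2 * rising (3 / 2) k := by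
      rw [rising_succ_left]; norm_num
    have h6 : (-b) ^ s = (-b) ^ (s - (k + 1)) * (-b) ^ k * (-b) := by
      rw [mul_assoc, ← pow_succ, ← pow_add]; congr 1; omega
    rw [h5, h6]
    ext i j
    simp only [Matrix.smul_apply, Matrix.replicateCol_apply, Pi.smul_apply, smul_eq_mul]
    linear_combination ((-b) ^ (s - (k + 1)) * (-b) ^ k * b * rising (3 / 2) k
      * rising (1 / 2) (s - (k + 1)) * τ * π i) * h4
  rw [kNum, Finset.sum_congr rfl fun k hk => by rw [hterm k hk], h.resNum_eq hv hw, ← hb]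
  simp only [smul_smul, ← Finset.sum_smul, ← add_smul]
  congr 1
  have h7 := sum_choose_rising s
  have h8 : ∑ k ∈ Finset.Icc 1 s, (k : ℂ) * ((s + 1).choose (k + 1) : ℂ)
      * (-((-b) ^ s * (rising (1 / 2) k * rising (1 / 2) (s - k)) * τ))
      = -((-b) ^ s * τ) * (((s : ℂ) + 1) * s.factorial - 2 * rising (1 / 2) (s + 1)) := by
    rw [← h7, Finset.mul_sum]
    exact Finset.sum_congr rfl fun k _ => by ring
  rw [h8]
  ring

end IsSimpleEigen

end GFM

open Polynomial

/-! ### Linear relations between powers of a matrix -/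

section MatrixPolynomials

variable {m : Type*} [Fintype m] [DecidableEq m]

theorem analyticAt_pow_apply {E : Type*} [NormedAddCommGroup E] [NormedSpace ℂ E]
    {A : E → Matrix m m ℂ} {z : E} (hA : ∀ i j, AnalyticAt ℂ (fun w => A w i j) z) (k : ℕ) :
    ∀ i j, AnalyticAt ℂ (fun w => (A w ^ k) i j) z := by
  induction k with
  | zero => intro i j; simpa using analyticAt_const
  | succ k ih => intro i j; simpa only [pow_succ] using analyticAt_mul_apply ih hA i j

theorem analyticAt_aeval_apply {E : Type*} [NormedAddCommGroup E] [NormedSpace ℂ E]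
    {A : E → Matrix m m ℂ} {z : E} (hA : ∀ i j, AnalyticAt ℂ (fun w => A w i j) z) (p : ℂ[X])
    (i j : m) : AnalyticAt ℂ (fun w => (aeval (A w) p) i j) z := by
  simp only [aeval_eq_sum_range, Matrix.sum_apply, Matrix.smul_apply]
  exact Finset.analyticAt_fun_sum _ fun k _ => analyticAt_const.mul (analyticAt_pow_apply hA k i j)

theorem aeval_mulVec_eigen {A : Matrix m m ℂ} {x : m → ℂ} {u : ℂ} (h : A *ᵥ x = u • x) (p : ℂ[X]) :
    aeval A p *ᵥ x = p.eval u • x := by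
  induction p using Polynomial.induction_on' with
  | add p q hp hq => rw [map_add, Matrix.add_mulVec, hp, hq, eval_add, add_smul]
  | monomial k a =>
    have hk : (A ^ k) *ᵥ x = u ^ k • x := by
      induction k with
      | zero => simp
      | succ k ih => rw [pow_succ, ← Matrix.mulVec_mulVec, h, Matrix.mulVec_smul, ih, smul_smul, pow_succ,
          mul_comm]
    rw [aeval_monomial, eval_monomial, ← Algebra.smul_def,
      Matrix.smul_mulVec, hk, smul_smul]

/-- The entries of the powers of a matrix. -/
def powEntries (A : Matrix m m ℂ) (k : ℕ) : m → m → ℂ := fun i j => (A ^ k) i j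

theorem aeval_mem_span_powEntries (A : Matrix m m ℂ) {p : ℂ[X]} {r : ℕ} (hp : p.natDegree < r) :
    (fun i j => (aeval A p) i j : m → m → ℂ)
      ∈ Submodule.span ℂ (Set.range fun k : Fin r => powEntries A k) := by
  have h : (fun i j => (aeval A p) i j : m → m → ℂ) = ∑ k : Fin r, p.coeff k • powEntries A k := by
    ext i j
    rw [aeval_eq_sum_range' hp, Finset.sum_range]
    simp [Matrix.sum_apply, powEntries]
  rw [h]
  exact Submodule.sum_mem _ fun k _ => Submodule.smul_mem _ _ (Submodule.subset_span ⟨k, rfl⟩)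

theorem not_linearIndependent_powEntries {A : Matrix m m ℂ} {p : ℂ[X]} {r : ℕ} (hp : p.natDegree < r)
    (hp0 : p ≠ 0) (h : aeval A p = 0) : ¬ LinearIndependent ℂ fun k : Fin r => powEntries A k := by
  intro hli
  have h1 : ∑ k : Fin r, p.coeff k • powEntries A k = 0 := by
    ext i j
    have := congrFun (congrFun h i) j
    rw [aeval_eq_sum_range' hp, Finset.sum_range] at this
    simpa [Matrix.sum_apply, powEntries] using this
  have h2 := Fintype.linearIndependent_iff.mp hli _ h1
  refine hp0 (Polynomial.ext fun k => ?_)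
  rcases lt_or_ge k r with hk | hk
  · simpa using h2 ⟨k, hk⟩
  · simpa using coeff_eq_zero_of_natDegree_lt (hp.trans_le hk)

/-- A relation would be a polynomial of degree below |S| that annihilates A and hence vanishes at
every eigenvalue in S. -/
theorem linearIndependent_powEntries {A : Matrix m m ℂ} (S : Finset ℂ)
    (hS : ∀ u ∈ S, ∃ x : m → ℂ, x ≠ 0 ∧ A *ᵥ x = u • x) :
    LinearIndependent ℂ fun k : Fin S.card => powEntries A k := by
  rw [Fintype.linearIndependent_iff]
  intro c hc k
  have hdeg : (∑ k : Fin S.card, C (c k) * X ^ (k : ℕ) : ℂ[X]).degree < S.card := by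
    refine (degree_sum_le _ _).trans_lt ?_
    rw [Finset.sup_lt_iff (WithBot.bot_lt_coe _)]
    exact fun k _ => (degree_C_mul_X_pow_le _ _).trans_lt (by exact_mod_cast k.2)
  have h1 : aeval A (∑ k : Fin S.card, C (c k) * X ^ (k : ℕ) : ℂ[X]) = 0 := by
    ext i j
    have := congrFun (congrFun hc i) j
    simpa [Matrix.sum_apply, powEntries, ← Algebra.smul_def] using this
  have h2 := eq_zero_of_degree_lt_of_eval_finset_eq_zero S hdeg fun a ha => by
    obtain ⟨x, hx, hxa⟩ := hS a ha
    have h3 := aeval_mulVec_eigen hxa (∑ k : Fin S.card, C (c k) * X ^ (k : ℕ) : ℂ[X])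
    rw [h1, Matrix.zero_mulVec] at h3
    exact (smul_eq_zero.mp h3.symm).resolve_right hx
  have h4 := congrArg (fun p => p.coeff (k : ℕ)) h2
  simpa [finsetSum_coeff, coeff_C_mul, coeff_X_pow, Fin.val_inj, Finset.sum_ite_eq] using h4

end MatrixPolynomials

/-! ### Frames of idempotents and generic simplicity of the spectrum -/

namespace GFM

variable {n : ℕ} {M : GFM n}

/-- The idempotents `π i` of a semisimple tangent algebra with the dual covectors `ℓ i`. -/
structure IsFrame (M : GFM n) (w : V n) (π ℓ : Fin n → V n) : Prop where
  eigen : ∀ i, IsEigen M w (π i) (ℓ i)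
  off : ∀ i j, i ≠ j → ℓ i ⬝ᵥ π j = 0
  span : ∀ h, ∑ i, (ℓ i ⬝ᵥ h) • π i = h

theorem mulMat_sum_smul (w : V n) {κ : Type*} (s : Finset κ) (a : κ → ℂ) (x : κ → V n) :
    M.mulMat w (∑ i ∈ s, a i • x i) = ∑ i ∈ s, a i • M.mulMat w (x i) := by
  ext γ β
  simp only [mulMat_apply, Matrix.sum_apply, Matrix.smul_apply, Finset.sum_apply, Pi.smul_apply,
    smul_eq_mul, Finset.sum_mul, Finset.mul_sum]
  rw [Finset.sum_comm]
  exact Finset.sum_congr rfl fun _ _ => Finset.sum_congr rfl fun _ _ => by ring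

/-- The dual covectors are the rows of the inverse of the matrix with columns π i. They are
characters because the π i are orthogonal idempotents. -/
theorem SemisimpleAt.exists_isFrame {w : V n} (h : M.SemisimpleAt w) : ∃ π ℓ, IsFrame M w π ℓ := by
  obtain ⟨π, hli, hmul⟩ := h
  set Q : Matrix (Fin n) (Fin n) ℂ := Matrix.of fun a i => π i a with hQ
  have hQu : IsUnit Q := by
    rw [← Matrix.linearIndependent_cols_iff_isUnit]
    exact hli
  have hdet : IsUnit Q.det := (Matrix.isUnit_iff_isUnit_det _).mp hQu
  have hLQ : Q⁻¹ * Q = 1 := Matrix.nonsing_inv_mul _ hdet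
  have hQL : Q * Q⁻¹ = 1 := Matrix.mul_nonsing_inv _ hdet
  have hdual : ∀ i j, Q⁻¹ i ⬝ᵥ π j = if i = j then 1 else 0 := fun i j =>
    congrFun (congrFun hLQ i) j
  have hspan : ∀ h, ∑ i, (Q⁻¹ i ⬝ᵥ h) • π i = h := by
    intro h
    have h1 : Q *ᵥ (Q⁻¹ *ᵥ h) = h := by rw [Matrix.mulVec_mulVec, hQL, Matrix.one_mulVec]
    conv_rhs => rw [← h1]
    ext a
    simp [Matrix.mulVec, dotProduct, hQ, mul_comm]
  have hπ : ∀ h j, M.mulMat w h *ᵥ π j = (Q⁻¹ j ⬝ᵥ h) • π j := by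
    intro h j
    conv_lhs => rw [← hspan h]
    rw [mulMat_sum_smul, Matrix.sum_mulVec]
    simp only [Matrix.smul_mulVec, mulMat_mulVec, hmul]
    simp
  refine ⟨π, fun i => Q⁻¹ i, fun i => ⟨fun h => hπ h i, fun h => ?_, by simp [hdual]⟩,
    fun i j hij => by simp [hdual, hij], hspan⟩
  refine dotProduct_eq _ _ fun X => ?_
  conv_lhs => rw [← hspan X]
  rw [← Matrix.dotProduct_mulVec, Matrix.mulVec_sum, dotProduct_sum]
  simp only [Matrix.mulVec_smul, hπ, dotProduct_smul, hdual]
  simp [mul_comm]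

namespace IsFrame

variable {w : V n} {π ℓ : Fin n → V n}

theorem dual (h : IsFrame M w π ℓ) (i j : Fin n) : ℓ i ⬝ᵥ π j = if i = j then 1 else 0 := by
  by_cases hij : i = j
  · subst hij; simp [(h.eigen i).dual]
  · simp [hij, h.off i j hij]

theorem matrix_ext (h : IsFrame M w π ℓ) {A B : Matrix (Fin n) (Fin n) ℂ}
    (hAB : ∀ i, A *ᵥ π i = B *ᵥ π i) : A = B := by
  refine Matrix.ext_of_mulVec_single fun j => ?_
  rw [← h.span (Pi.single j 1), Matrix.mulVec_sum, Matrix.mulVec_sum]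
  exact Finset.sum_congr rfl fun i _ => by rw [Matrix.mulVec_smul, Matrix.mulVec_smul, hAB]

theorem opU_mulVec (h : IsFrame M w π ℓ) (i : Fin n) :
    M.opU w *ᵥ π i = (ℓ i ⬝ᵥ M.E w) • π i := by
  rw [opU_eq_mulMat, (h.eigen i).mulVec]

theorem ne_zero (h : IsFrame M w π ℓ) (i : Fin n) : π i ≠ 0 := by
  intro h0
  have := (h.eigen i).dual
  simp [h0] at this

/-- In the frame U - u_i is diagonal with exactly one zero entry, so its adjugate retains only the
product τ of the other entries, in position i. The determinants from the change of basis cancel. -/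
theorem isSimpleEigen (h : IsFrame M w π ℓ)
    (hinj : Function.Injective fun i => ℓ i ⬝ᵥ M.E w) (i : Fin n) :
    ∃ τ, IsSimpleEigen M w (π i) (ℓ i) τ := by
  set u : Fin n → ℂ := fun i => ℓ i ⬝ᵥ M.E w with hu
  set Q : Matrix (Fin n) (Fin n) ℂ := Matrix.of fun a i => π i a with hQ
  set L : Matrix (Fin n) (Fin n) ℂ := Matrix.of fun i a => ℓ i a with hL
  have hLQ : L * Q = 1 := by
    ext i j
    rw [Matrix.one_apply, ← h.dual i j]
    rfl
  have hQL : Q * L = 1 := mul_eq_one_comm.mp hLQ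
  have hQa : Q.adjugate = Q.det • L := by
    rw [← Matrix.one_mul Q.adjugate, ← hLQ, Matrix.mul_assoc, Matrix.mul_adjugate, Matrix.mul_smul,
      Matrix.mul_one]
  have hLa : L.adjugate = L.det • Q := by
    rw [← Matrix.one_mul L.adjugate, ← hQL, Matrix.mul_assoc, Matrix.mul_adjugate, Matrix.mul_smul,
      Matrix.mul_one]
  have hdet : L.det * Q.det = 1 := by rw [← Matrix.det_mul, hLQ, Matrix.det_one]
  have hU : M.opUsub (u i) w = Q * Matrix.diagonal (fun j => u j - u i) * L := by
    have h1 : M.opUsub (u i) w * Q = Q * Matrix.diagonal (fun j => u j - u i) := by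
      ext a j
      have h2 : M.opUsub (u i) w *ᵥ π j = (u j - u i) • π j := by
        rw [opUsub, Matrix.sub_mulVec, h.opU_mulVec, Matrix.smul_mulVec, Matrix.one_mulVec, sub_smul]
      rw [Matrix.mul_diagonal]
      have := congrFun h2 a
      rw [Pi.smul_apply, smul_eq_mul, mul_comm] at this
      exact this
    rw [← h1, Matrix.mul_assoc, hQL, Matrix.mul_one]
  set τ : ℂ := ∏ k ∈ Finset.univ.erase i, (u k - u i)
  have hτ : τ ≠ 0 := Finset.prod_ne_zero_iff.mpr fun k hk =>
    sub_ne_zero.mpr fun hki => (Finset.mem_erase.mp hk).1 (hinj hki)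
  refine ⟨τ, ⟨h.eigen i, hτ, ?_⟩⟩
  change (M.opUsub (u i) w).adjugate = _
  have hd : (fun j => ∏ k ∈ Finset.univ.erase j, (u k - u i)) = Pi.single i τ := by
    ext j
    by_cases hj : j = i
    · subst hj; simp [τ]
    · rw [Pi.single_eq_of_ne hj]
      exact Finset.prod_eq_zero (Finset.mem_erase.mpr ⟨Ne.symm hj, Finset.mem_univ i⟩) (sub_self _)
  rw [hU, Matrix.adjugate_mul_distrib, Matrix.adjugate_mul_distrib, Matrix.adjugate_diagonal, hd,
    hQa, hLa, Matrix.mul_smul, Matrix.mul_smul, Matrix.smul_mul, smul_smul, mul_comm Q.det, hdet,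
    one_smul]
  ext a b
  simp only [Matrix.mul_apply (M := Q), Matrix.diagonal_mul]
  rw [Finset.sum_eq_single i]
  · simp only [hQ, hL, Matrix.of_apply, Pi.single_eq_same, Matrix.smul_apply,
      Matrix.vecMulVec_apply, smul_eq_mul]
    ring
  · intro j _ hj
    simp [Pi.single_eq_of_ne hj]
  · simp

end IsFrame

end GFM

/-- If the first `r + 1` powers of the matrices `A t` are linearly dependent for small `t ≠ 0`, while
the first `r` powers of `A 0` are linearly independent, and if `m` has degree at most `r` and
`m(A 0) = 0`, then the derivative of `m(A t)` at `t = 0` is a polynomial in `A 0`. -/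
theorem deriv_aeval_mem_span {n : ℕ} {A : ℂ → Matrix (Fin n) (Fin n) ℂ}
    (hA : ∀ i j, AnalyticAt ℂ (fun t => A t i j) 0) {r : ℕ}
    (hli : LinearIndependent ℂ fun k : Fin r => powEntries (A 0) k)
    (hdep : ∀ᶠ t in 𝓝[≠] (0 : ℂ), ¬ LinearIndependent ℂ fun k : Fin (r + 1) => powEntries (A t) k)
    {p : ℂ[X]} (hp : p.natDegree ≤ r) (hp0 : aeval (A 0) p = 0) :
    (fun i j => deriv (fun t => (aeval (A t) p) i j) 0 : Fin n → Fin n → ℂ)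
      ∈ Submodule.span ℂ (Set.range fun k : Fin r => powEntries (A 0) k) := by
  by_contra hnot
  set W' : Fin n → Fin n → ℂ := fun i j => deriv (fun t => (aeval (A t) p) i j) 0 with hW'
  -- The last vector is the difference quotient of p(A t), since p(A 0) = 0. If the limit lay
  -- outside the span, the limiting family, hence the nearby ones, would be independent.
  set g : ℂ → Fin (r + 1) → Fin n → Fin n → ℂ := fun t =>
    Fin.snoc (α := fun _ => Fin n → Fin n → ℂ) (fun k : Fin r => powEntries (A t) k)
      (fun i j => t⁻¹ * (aeval (A t) p) i j) with hg
  set g0 : Fin (r + 1) → Fin n → Fin n → ℂ :=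
    Fin.snoc (α := fun _ => Fin n → Fin n → ℂ) (fun k : Fin r => powEntries (A 0) k) W' with hg0
  have hg0i : LinearIndependent ℂ g0 := linearIndependent_finSnoc.mpr ⟨hli, hnot⟩
  have hlim : Filter.Tendsto g (𝓝[≠] 0) (𝓝 g0) := by
    rw [tendsto_pi_nhds]
    intro k
    refine Fin.lastCases ?_ (fun k => ?_) k
    · simp only [hg, hg0, Fin.snoc_last]
      rw [tendsto_pi_nhds]; intro i
      rw [tendsto_pi_nhds]; intro j
      have h1 := (analyticAt_aeval_apply hA p i j).differentiableAt.hasDerivAt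
      rw [hasDerivAt_iff_tendsto_slope] at h1
      refine h1.congr fun t => ?_
      simp [slope, hp0]
    · simp only [hg, hg0, Fin.snoc_castSucc]
      rw [tendsto_pi_nhds]; intro i
      rw [tendsto_pi_nhds]; intro j
      exact (analyticAt_pow_apply hA k i j).continuousAt.tendsto.mono_left nhdsWithin_le_nhds
  have hev : ∀ᶠ t in 𝓝[≠] (0 : ℂ), LinearIndependent ℂ (g t) :=
    hlim.eventually (isOpen_setOfPred_linearIndependent.mem_nhds hg0i)
  obtain ⟨t, ht1, ht2⟩ := (hdep.and hev).exists
  refine ht1 ?_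
  -- The family lies in the span of the first r + 1 powers, so its independence would force
  -- independence of those powers.
  rw [linearIndependent_iff_card_le_finrank_span]
  rw [linearIndependent_iff_card_le_finrank_span] at ht2
  refine ht2.trans (Submodule.finrank_mono (Submodule.span_le.mpr ?_))
  rintro _ ⟨k, rfl⟩
  refine Fin.lastCases ?_ (fun k => ?_) k
  · simp only [hg, Fin.snoc_last]
    exact Submodule.smul_mem _ t⁻¹ (aeval_mem_span_powEntries (A t) (Nat.lt_succ_of_le hp))
  · simp only [hg, Fin.snoc_castSucc]
    exact Submodule.subset_span ⟨k.castSucc, rfl⟩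

namespace GFM

variable {n : ℕ} {M : GFM n}

theorem IsSemisimple.exists_isFrame (hM : M.IsSemisimple) {O : Set (V n)} (hO : IsOpen O)
    (hOM : O ⊆ M.domain) (hne : O.Nonempty) : ∃ w ∈ O, ∃ π ℓ, IsFrame M w π ℓ := by
  obtain ⟨w, hw⟩ := hne
  obtain ⟨w', hw', h⟩ := mem_closure_iff.mp (hM (hOM hw)) O hO hw
  exact ⟨w', hw', h.2.exists_isFrame⟩

theorem IsFrame.exists_annihilating {w : V n} {π ℓ : Fin n → V n} (h : IsFrame M w π ℓ) :
    aeval (M.opU w) (∏ a ∈ Finset.univ.image fun i => ℓ i ⬝ᵥ M.E w, (X - C a)) = 0 := by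
  refine h.matrix_ext fun i => ?_
  rw [aeval_mulVec_eigen (h.opU_mulVec i), eval_prod, Finset.prod_eq_zero
    (Finset.mem_image_of_mem _ (Finset.mem_univ i)) (by simp)]
  simp

/-- At generic points the tangent algebra is semisimple and `U` has distinct eigenvalues. -/
theorem IsSemisimple.exists_isFrame_injective (hM : M.IsSemisimple) {O : Set (V n)} (hO : IsOpen O)
    (hOM : O ⊆ M.domain) (hne : O.Nonempty) :
    ∃ w ∈ O, ∃ π ℓ, IsFrame M w π ℓ ∧ Function.Injective fun i => ℓ i ⬝ᵥ M.E w := by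
  -- Choose a semisimple point of O where the number of distinct eigenvalues is maximal; a
  -- coincidence u_i = u_j there will be contradicted.
  set R : Set ℕ := {r | ∃ w ∈ O, ∃ π ℓ, IsFrame M w π ℓ ∧
    (Finset.univ.image fun i => ℓ i ⬝ᵥ M.E w).card = r} with hR
  have hRne : R.Nonempty := by
    obtain ⟨w, hw, π, ℓ, h⟩ := hM.exists_isFrame hO hOM hne
    exact ⟨_, w, hw, π, ℓ, h, rfl⟩
  have hRb : BddAbove R := by
    refine ⟨n, ?_⟩
    rintro _ ⟨w, hw, π, ℓ, h, rfl⟩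
    exact Finset.card_image_le.trans (by simp)
  obtain ⟨w, hw, π, ℓ, h, hr⟩ := Nat.sSup_mem hRne hRb
  refine ⟨w, hw, π, ℓ, h, ?_⟩
  intro i j hij
  by_contra hne'
  dsimp only at hij
  set u : Fin n → ℂ := fun i => ℓ i ⬝ᵥ M.E w with hu
  set S := Finset.univ.image u with hS
  have hwM := hOM hw
  -- near `w` the number of distinct eigenvalues does not increase
  have hdep : ∀ v ∈ O, ¬ LinearIndependent ℂ fun k : Fin (S.card + 1) => powEntries (M.opU v) k := by
    intro v hv hli
    have hcont : ContinuousAt (fun v => fun k : Fin (S.card + 1) => powEntries (M.opU v) k) v := by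
      refine continuousAt_pi.mpr fun k => continuousAt_pi.mpr fun a => continuousAt_pi.mpr fun b => ?_
      exact (analyticAt_pow_apply (analyticAt_opU (hOM hv)) k a b).continuousAt
    -- Independence is an open condition, so it would persist at a nearby semisimple point, where
    -- maximality gives an annihilating polynomial of degree at most |S|.
    have hev : ∀ᶠ v' in 𝓝 v, LinearIndependent ℂ fun k : Fin (S.card + 1) => powEntries (M.opU v') k :=
      hcont.eventually (isOpen_setOfPred_linearIndependent.mem_nhds hli)
    obtain ⟨O', hO'sub, hO', hvO'⟩ := mem_nhds_iff.mp (hev.and (hO.mem_nhds hv))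
    obtain ⟨v', hv', π', ℓ', h'⟩ := hM.exists_isFrame hO' (fun x hx => hOM (hO'sub hx).2) ⟨v, hvO'⟩
    refine not_linearIndependent_powEntries ?_ ?_ h'.exists_annihilating (hO'sub hv').1
    · rw [natDegree_prod_of_monic _ _ fun a _ => monic_X_sub_C a]
      simp only [natDegree_X_sub_C, Finset.sum_const, smul_eq_mul, mul_one]
      refine Nat.lt_succ_of_le ?_
      rw [hr]
      exact le_csSup hRb ⟨v', (hO'sub hv').2, π', ℓ', h', rfl⟩
    · exact (monic_prod_of_monic _ _ fun a _ => monic_X_sub_C a).ne_zero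
  set m₁ : ℂ[X] := ∏ a ∈ S.erase (u i), (X - C a) with hm₁
  have hm₁i : m₁.eval (u i) ≠ 0 := by
    rw [hm₁, eval_prod]
    refine Finset.prod_ne_zero_iff.mpr fun a ha => ?_
    simpa using sub_ne_zero.mpr (Finset.ne_of_mem_erase ha).symm
  have hm : ∏ a ∈ S, (X - C a) = (X - C (u i)) * m₁ :=
    (Finset.mul_prod_erase S (fun a => X - C a)
      (Finset.mem_image_of_mem u (Finset.mem_univ i))).symm
  -- The direction π_i separates the two eigenvalues to first order, since ℓ_i(π_i) = 1 and ℓ_j(π_i)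
  -- = 0.
  set A : ℂ → Matrix (Fin n) (Fin n) ℂ := fun t => M.opU (w + t • π i) with hA
  have hline : AnalyticAt ℂ (fun t : ℂ => w + t • π i) 0 :=
    analyticAt_const.add (analyticAt_id.smul analyticAt_const)
  have hline0 : w + (0 : ℂ) • π i = w := by simp
  have hA0 : A 0 = M.opU w := by simp [hA]
  have hAan : ∀ a b, AnalyticAt ℂ (fun t => A t a b) 0 := fun a b =>
    AnalyticAt.fun_comp (f := fun t : ℂ => w + t • π i)
      (by rw [hline0]; exact analyticAt_opU hwM a b) hline
  have hspan := deriv_aeval_mem_span hAan (r := S.card)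
    (p := ∏ a ∈ S, (X - C a))
    (by
      rw [hA0]
      refine linearIndependent_powEntries S fun a ha => ?_
      obtain ⟨k, -, rfl⟩ := Finset.mem_image.mp ha
      exact ⟨π k, h.ne_zero k, h.opU_mulVec k⟩)
    (by
      have : ∀ᶠ t in 𝓝 (0 : ℂ), w + t • π i ∈ O :=
        hline.continuousAt.eventually (hO.mem_nhds (by simpa using hw))
      filter_upwards [this.filter_mono nhdsWithin_le_nhds] with t ht using hdep _ ht)
    (by
      rw [natDegree_prod_of_monic _ _ fun a _ => monic_X_sub_C a]
      simp)
    (by rw [hA0]; exact h.exists_annihilating)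
  -- the diagonal entries of a polynomial in `U`
  set W' : Matrix (Fin n) (Fin n) ℂ :=
    Matrix.of fun a b => deriv (fun t => (aeval (A t) (∏ a ∈ S, (X - C a))) a b) 0 with hW'
  have hdiag1 : ℓ i ⬝ᵥ (W' *ᵥ π i) = ℓ j ⬝ᵥ (W' *ᵥ π j) := by
    have key : ∀ B : Fin n → Fin n → ℂ,
        B ∈ Submodule.span ℂ (Set.range fun k : Fin S.card => powEntries (A 0) k) →
        ℓ i ⬝ᵥ (Matrix.of B *ᵥ π i) = ℓ j ⬝ᵥ (Matrix.of B *ᵥ π j) := by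
      intro B hB
      induction hB using Submodule.span_induction with
      | mem x hx =>
        obtain ⟨k, rfl⟩ := hx
        have hk : ∀ a, (Matrix.of (powEntries (A 0) k)) *ᵥ π a = u a ^ (k : ℕ) • π a := by
          intro a
          have := aeval_mulVec_eigen (h.opU_mulVec a) (X ^ (k : ℕ))
          simp only [map_pow, aeval_X, eval_pow, eval_X] at this
          rw [← hA0] at this
          exact this
        rw [hk, hk, dotProduct_smul, dotProduct_smul, (h.eigen i).dual, (h.eigen j).dual]
        change u i ^ _ • _ = _
        rw [show u i = u j from hij]
      | zero => simp
      | add x y _ _ hx hy =>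
        rw [← Matrix.of_add_of, Matrix.add_mulVec, Matrix.add_mulVec, dotProduct_add,
          dotProduct_add, hx, hy]
      | smul a x _ hx =>
        rw [← Matrix.smul_of, Matrix.smul_mulVec, Matrix.smul_mulVec, dotProduct_smul,
          dotProduct_smul, hx]
    exact key _ hspan
  -- the diagonal entries of the derivative of `m(U)` in the direction `π i`
  have hdiag2 : ∀ k, u k = u i → ℓ k ⬝ᵥ (W' *ᵥ π k) = m₁.eval (u i) * (ℓ k ⬝ᵥ π i) := by
    intro k hk
    set U' := ∑ α, π i α • pdMat α M.opU w with hU'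
    have hdA : ∀ a b, HasDerivAt (fun t => (A t - u i • (1 : Matrix (Fin n) (Fin n) ℂ)) a b) (U' a b) 0 := by
      intro a b
      have h1 : AnalyticAt ℂ (fun v => M.opU v a b) (w + (0 : ℂ) • π i) := by
        rw [hline0]; exact analyticAt_opU hwM a b
      have h2 := hasDerivAt_comp_curve (f := fun v => M.opU v a b)
        (v := fun t : ℂ => w + t • π i) h1 hline
      have h3 : deriv (fun t : ℂ => w + t • π i) 0 = π i := by
        have : HasDerivAt (fun t : ℂ => w + t • π i) ((1 : ℂ) • π i) 0 :=
          ((hasDerivAt_id (0 : ℂ)).smul_const (π i)).const_add w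
        rw [this.deriv, one_smul]
      rw [h3, hline0] at h2
      simp only [Matrix.sub_apply]
      refine (h2.sub_const _).congr_deriv ?_
      simp [hU', pdMat, Matrix.sum_apply]
    set N' : Matrix (Fin n) (Fin n) ℂ := Matrix.of fun a b => deriv (fun t => (aeval (A t) m₁) a b) 0
    have hdN : ∀ a b, HasDerivAt (fun t => (aeval (A t) m₁) a b) (N' a b) 0 := fun a b =>
      (analyticAt_aeval_apply hAan m₁ a b).differentiableAt.hasDerivAt
    have h1 : W' = U' * aeval (M.opU w) m₁ + M.opUsub (u i) w * N' := by
      ext a b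
      rw [hW', Matrix.of_apply, hm]
      have h2 : HasDerivAt (fun t => (aeval (A t) ((X - C (u i)) * m₁)) a b)
          ((U' * aeval (A 0) m₁ + (A 0 - u i • (1 : Matrix (Fin n) (Fin n) ℂ)) * N') a b) 0 := by
        simp only [map_mul, map_sub, aeval_X, aeval_C, Algebra.algebraMap_eq_smul_one,
          Matrix.mul_apply, Matrix.add_apply]
        rw [← Finset.sum_add_distrib]
        exact HasDerivAt.fun_sum fun k _ => (hdA a k).fun_mul (hdN k b)
      rw [h2.deriv, hA0]
      rfl
    have h3 : ℓ k ᵥ* M.opUsub (u i) w = 0 := by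
      rw [opUsub, Matrix.vecMul_sub, opU_eq_mulMat, (h.eigen k).vecMul, Matrix.vecMul_smul,
        Matrix.vecMul_one]
      change u k • _ - _ = _
      rw [hk, sub_self]
    rw [h1, Matrix.add_mulVec, dotProduct_add, ← Matrix.mulVec_mulVec, ← Matrix.mulVec_mulVec,
      aeval_mulVec_eigen (h.opU_mulVec k), Matrix.dotProduct_mulVec _ (M.opUsub _ _), h3,
      Matrix.mulVec_smul, dotProduct_smul, hU', (h.eigen k).dotProduct_pd_opU hwM]
    simp only [zero_dotProduct, add_zero, smul_eq_mul]
    change m₁.eval (u k) * _ = _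
    rw [hk]
  -- A polynomial in U has equal diagonal entries at i and j, yet the derivative has m₁(u_i) ≠ 0 at
  -- i and 0 at j.
  have h5 := hdiag2 i rfl
  have h6 := hdiag2 j hij.symm
  rw [hdiag1, h6, (h.eigen i).dual, h.off j i (Ne.symm hne'), mul_zero, mul_one] at h5
  exact hm₁i h5.symm

/-- Along y + t ∑ π_j every ℓ_i grows by exactly t, so each vanishes for only one t. -/
theorem exists_dotProduct_ne_zero {O : Set (V n)} (hO : IsOpen O) {y : V n} (hy : y ∈ O)
    {w : V n} {π ℓ : Fin n → V n} (h : IsFrame M w π ℓ) : ∃ y' ∈ O, ∀ i, ℓ i ⬝ᵥ y' ≠ 0 := by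
  have hdot : ∀ i, ∀ t : ℂ, ℓ i ⬝ᵥ (y + t • ∑ j, π j) = ℓ i ⬝ᵥ y + t := by
    intro i t
    rw [dotProduct_add, dotProduct_smul, dotProduct_sum]
    simp [h.dual]
  have h1 : ∀ i, ∀ᶠ t in 𝓝[≠] (0 : ℂ), ℓ i ⬝ᵥ (y + t • ∑ j, π j) ≠ 0 := by
    intro i
    simp only [hdot]
    by_cases h0 : ℓ i ⬝ᵥ y = 0
    · filter_upwards [self_mem_nhdsWithin] with t ht
      simpa [h0] using ht
    · have : ContinuousAt (fun t : ℂ => ℓ i ⬝ᵥ y + t) 0 := by fun_prop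
      exact (this.eventually_ne (by simpa using h0)).filter_mono nhdsWithin_le_nhds
  have h2 : ∀ᶠ t in 𝓝[≠] (0 : ℂ), y + t • ∑ j, π j ∈ O := by
    have : ContinuousAt (fun t : ℂ => y + t • ∑ j, π j) 0 := by fun_prop
    exact (this.eventually (hO.mem_nhds (by simpa using hy))).filter_mono nhdsWithin_le_nhds
  obtain ⟨t, ht, ht'⟩ := (h2.and (Filter.eventually_all.mpr h1)).exists
  exact ⟨_, ht, ht'⟩

end GFM

/-! ### Functions of finitely many jet variables -/

section JetFunctions

variable {n : ℕ} {Ω : Set (Jet n)}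

/-- The truncation of a jet to the orders `0, …, N`. -/
def truncate (N : ℕ) (q : Jet n) : Fin (N + 1) → V n := fun k => q k

theorem continuous_truncate (N : ℕ) : Continuous (truncate (n := n) N) :=
  continuous_pi fun k => continuous_apply (k : ℕ)

/-- Completing a truncated jet by the higher coordinates of q is a continuous section of the
truncation through q. -/
theorem isOpen_truncate_image (hΩ : IsOpen Ω) (N : ℕ) : IsOpen (truncate N '' Ω) := by
  rw [isOpen_iff_mem_nhds]
  rintro _ ⟨q, hq, rfl⟩
  set σ : (Fin (N + 1) → V n) → Jet n := fun p k => if h : k < N + 1 then p ⟨k, h⟩ else q k with hσ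
  have hcont : Continuous σ := by
    refine continuous_pi fun k => ?_
    by_cases h : k < N + 1
    · simp only [hσ, dif_pos h]
      exact continuous_apply (A := fun _ : Fin (N + 1) => V n) ⟨k, h⟩
    · simp only [hσ, dif_neg h]
      exact continuous_const
  have hσq : σ (truncate N q) = q := by
    ext k; simp [hσ, truncate]
  have h1 : σ ⁻¹' Ω ∈ 𝓝 (truncate N q) := (hΩ.preimage hcont).mem_nhds (by
    rw [Set.mem_preimage, hσq]; exact hq)
  refine Filter.mem_of_superset h1 fun p hp => ⟨σ p, hp, ?_⟩
  funext k
  simp only [hσ, truncate, dif_pos k.2]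

/-- The jet `q` with the coordinate `v^{γ,s}` replaced by `t`. -/
def replaceCoord (q : Jet n) (γ : Fin n) (s : ℕ) (t : ℂ) : Jet n :=
  Function.update q s (Function.update (q s) γ t)

theorem replaceCoord_self (q : Jet n) (γ : Fin n) (s : ℕ) : replaceCoord q γ s (q s γ) = q := by
  simp [replaceCoord]

theorem continuous_replaceCoord (q : Jet n) (γ : Fin n) (s : ℕ) :
    Continuous (replaceCoord q γ s) :=
  continuous_const.update s (continuous_const.update γ continuous_id)

theorem eventually_replaceCoord_mem (hΩ : IsOpen Ω) {q : Jet n} (hq : q ∈ Ω) (γ : Fin n) (s : ℕ) :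
    ∀ᶠ t in 𝓝 (q s γ), replaceCoord q γ s t ∈ Ω :=
  (continuous_replaceCoord q γ s).continuousAt.eventually
    (hΩ.mem_nhds (by rwa [replaceCoord_self]))

theorem jpd_congr (hΩ : IsOpen Ω) {F G : Jet n → ℂ} {a : ℂ} (h : ∀ q ∈ Ω, G q = F q + a)
    {q : Jet n} (hq : q ∈ Ω) (γ : Fin n) (s : ℕ) : jpd γ s G q = jpd γ s F q := by
  have h1 : (fun t => G (replaceCoord q γ s t))
      =ᶠ[𝓝 (q s γ)] fun t => F (replaceCoord q γ s t) + a := by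
    filter_upwards [eventually_replaceCoord_mem hΩ hq γ s] with t ht using h _ ht
  exact h1.deriv_eq.trans (deriv_add_const a)

theorem jpd_zero (γ : Fin n) (s : ℕ) (q : Jet n) : jpd γ s (0 : Jet n → ℂ) q = 0 := by
  simp [jpd]

theorem truncate_replaceCoord_of_lt (q : Jet n) (γ : Fin n) {s N : ℕ} (hs : s < N + 1) (t : ℂ) :
    truncate N (replaceCoord q γ s t)
      = truncate N q + (t - q s γ) • (Pi.single ⟨s, hs⟩ (Pi.single γ 1) : Fin (N + 1) → V n) := by
  ext k δ
  simp only [truncate, replaceCoord, Pi.add_apply, Pi.smul_apply, smul_eq_mul]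
  by_cases hk : k = ⟨s, hs⟩
  · subst hk
    by_cases hδ : δ = γ
    · subst hδ; simp
    · simp [hδ]
  · have : (k : ℕ) ≠ s := fun h => hk (Fin.ext h)
    simp [hk, this]

theorem truncate_replaceCoord_of_le (q : Jet n) (γ : Fin n) {s N : ℕ} (hs : N + 1 ≤ s) (t : ℂ) :
    truncate N (replaceCoord q γ s t) = truncate N q := by
  ext k δ
  have : (k : ℕ) ≠ s := by have := k.2; omega
  simp [truncate, replaceCoord, this]

variable {N : ℕ} {f : (Fin (N + 1) → V n) → ℂ} {F : Jet n → ℂ}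

theorem hasDerivAt_replaceCoord_of_lt (hΩ : IsOpen Ω) (hf : AnalyticOnNhd ℂ f (truncate N '' Ω))
    (hF : ∀ q ∈ Ω, F q = f (truncate N q)) {q : Jet n} (hq : q ∈ Ω) (γ : Fin n) {s : ℕ}
    (hs : s < N + 1) :
    HasDerivAt (fun t => F (replaceCoord q γ s t))
      (fderiv ℂ f (truncate N q) (Pi.single ⟨s, hs⟩ (Pi.single γ 1))) (q s γ) := by
  have h1 : HasDerivAt (fun t : ℂ => truncate N (replaceCoord q γ s t))
      (Pi.single ⟨s, hs⟩ (Pi.single γ 1)) (q s γ) := by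
    simp only [truncate_replaceCoord_of_lt q γ hs]
    have := (((hasDerivAt_id (q s γ)).sub_const (q s γ)).smul_const
      (Pi.single ⟨s, hs⟩ (Pi.single γ 1) : Fin (N + 1) → V n)).const_add (truncate N q)
    simpa using this
  have h2 : HasFDerivAt f (fderiv ℂ f (truncate N q)) (truncate N (replaceCoord q γ s (q s γ))) := by
    rw [replaceCoord_self]
    exact (hf _ ⟨q, hq, rfl⟩).differentiableAt.hasFDerivAt
  refine (h2.comp_hasDerivAt (q s γ) h1).congr_of_eventuallyEq ?_
  filter_upwards [eventually_replaceCoord_mem hΩ hq γ s] with t ht using hF _ ht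

theorem hasDerivAt_replaceCoord_of_le (hΩ : IsOpen Ω) (hF : ∀ q ∈ Ω, F q = f (truncate N q))
    {q : Jet n} (hq : q ∈ Ω) (γ : Fin n) {s : ℕ} (hs : N + 1 ≤ s) :
    HasDerivAt (fun t => F (replaceCoord q γ s t)) 0 (q s γ) := by
  refine (hasDerivAt_const (q s γ) (f (truncate N q))).congr_of_eventuallyEq ?_
  filter_upwards [eventually_replaceCoord_mem hΩ hq γ s] with t ht
  rw [hF _ ht, truncate_replaceCoord_of_le q γ hs]

theorem IsJetFunction.hasDerivAt (hΩ : IsOpen Ω) (h : IsJetFunction Ω F) {q : Jet n} (hq : q ∈ Ω)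
    (γ : Fin n) (s : ℕ) :
    HasDerivAt (fun t => F (replaceCoord q γ s t)) (jpd γ s F q) (q s γ) := by
  obtain ⟨N, f, hf, hF⟩ := h
  refine DifferentiableAt.hasDerivAt ?_
  rcases lt_or_ge s (N + 1) with hs | hs
  · exact (hasDerivAt_replaceCoord_of_lt hΩ hf hF hq γ hs).differentiableAt
  · exact (hasDerivAt_replaceCoord_of_le hΩ hF hq γ hs).differentiableAt

theorem IsJetFunction.exists_forall_jpd_eq_zero (hΩ : IsOpen Ω) (h : IsJetFunction Ω F) :
    ∃ N, ∀ s, N ≤ s → ∀ q ∈ Ω, ∀ γ, jpd γ s F q = 0 := by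
  obtain ⟨N, f, hf, hF⟩ := h
  exact ⟨N + 1, fun s hs q hq γ => (hasDerivAt_replaceCoord_of_le hΩ hF hq γ hs).deriv⟩

theorem IsJetFunction.continuousOn_jpd (hΩ : IsOpen Ω) (h : IsJetFunction Ω F) (γ : Fin n) (s : ℕ) :
    ContinuousOn (jpd γ s F) Ω := by
  obtain ⟨N, f, hf, hF⟩ := h
  rcases lt_or_ge s (N + 1) with hs | hs
  · have h1 : ContinuousOn (fun q => fderiv ℂ f (truncate N q) (Pi.single ⟨s, hs⟩ (Pi.single γ 1))) Ω :=
      (hf.fderiv.continuousOn.comp (continuous_truncate N).continuousOn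
        (Set.mapsTo_image _ _)).clm_apply continuousOn_const
    exact h1.congr fun q hq => (hasDerivAt_replaceCoord_of_lt hΩ hf hF hq γ hs).deriv
  · exact continuousOn_const.congr fun q hq =>
      (hasDerivAt_replaceCoord_of_le hΩ hF hq γ hs).deriv

theorem IsJetFunction.exists_of_le (hF : ∀ q ∈ Ω, F q = f (truncate N q))
    (hf : AnalyticOnNhd ℂ f (truncate N '' Ω)) {N' : ℕ} (hN : N ≤ N') :
    ∃ f' : (Fin (N' + 1) → V n) → ℂ, AnalyticOnNhd ℂ f' (truncate N' '' Ω) ∧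
      ∀ q ∈ Ω, F q = f' (truncate N' q) := by
  set ρ : (Fin (N' + 1) → V n) →L[ℂ] (Fin (N + 1) → V n) :=
    ContinuousLinearMap.pi fun k => ContinuousLinearMap.proj (Fin.castLE (Nat.succ_le_succ hN) k)
  have hρ : ∀ q, ρ (truncate N' q) = truncate N q := fun q => rfl
  refine ⟨f ∘ ρ, ?_, fun q hq => hF q hq⟩
  rintro _ ⟨q, hq, rfl⟩
  exact (hf _ ⟨q, hq, (hρ q).symm⟩).comp (ρ.analyticAt _)

theorem IsJetFunction.sub {G : Jet n → ℂ} (hF : IsJetFunction Ω F) (hG : IsJetFunction Ω G) :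
    IsJetFunction Ω (fun q => F q - G q) := by
  obtain ⟨N, f, hf, hFf⟩ := hF
  obtain ⟨N', g, hg, hGg⟩ := hG
  obtain ⟨f', hf', hFf'⟩ := IsJetFunction.exists_of_le hFf hf (le_max_left N N')
  obtain ⟨g', hg', hGg'⟩ := IsJetFunction.exists_of_le hGg hg (le_max_right N N')
  refine ⟨max N N', fun p => f' p - g' p, hf'.sub hg', fun q hq => ?_⟩
  change F q - G q = _
  rw [hFf' q hq, hGg' q hq]
  rfl

theorem isJetFunction_zero : IsJetFunction Ω (0 : Jet n → ℂ) :=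
  ⟨0, fun _ => 0, analyticOnNhd_const, fun _ _ => rfl⟩

theorem jpd_sub (hΩ : IsOpen Ω) {G : Jet n → ℂ} (hF : IsJetFunction Ω F) (hG : IsJetFunction Ω G)
    {q : Jet n} (hq : q ∈ Ω) (γ : Fin n) (s : ℕ) :
    jpd γ s (fun q => F q - G q) q = jpd γ s F q - jpd γ s G q :=
  ((hF.hasDerivAt hΩ hq γ s).sub (hG.hasDerivAt hΩ hq γ s)).deriv

/-- A function on a connected open subset of the jet space is constant if its partial derivatives
vanish. -/
theorem IsJetFunction.exists_eq_const (hΩ : IsOpen Ω) (hΩc : IsPreconnected Ω)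
    (h : IsJetFunction Ω F) (h0 : ∀ q ∈ Ω, ∀ γ s, jpd γ s F q = 0) : ∃ a, ∀ q ∈ Ω, F q = a := by
  obtain ⟨N, f, hf, hF⟩ := h
  obtain ⟨a, ha⟩ := (isOpen_truncate_image hΩ N).exists_is_const_of_fderiv_eq_zero (𝕜 := ℂ)
    (hΩc.image _ (continuous_truncate N).continuousOn) hf.differentiableOn (by
      rintro _ ⟨q, hq, rfl⟩
      refine ContinuousLinearMap.coe_injective (LinearMap.pi_ext fun k y => ?_)
      change fderiv ℂ f (truncate N q) (Pi.single k y) = 0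
      have h1 : (Pi.single k y : Fin (N + 1) → V n)
          = ∑ γ, y γ • Pi.single k (Pi.single γ (1 : ℂ)) := by
        ext k' δ
        by_cases hk : k' = k
        · subst hk; simp [Finset.sum_apply, Pi.single_apply]
        · simp [Finset.sum_apply, hk]
      rw [h1, map_sum]
      refine (Finset.sum_eq_zero fun γ _ => ?_)
      rw [map_smul]
      have h2 := (hasDerivAt_replaceCoord_of_lt hΩ hf hF hq γ k.2).deriv
      change jpd γ k F q = _ at h2
      rw [h0 q hq] at h2
      rw [← h2, smul_zero])
  exact ⟨a, fun q hq => (hF q hq).trans (ha _ ⟨q, hq, rfl⟩)⟩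

end JetFunctions

/-! ### The kernel of the linear part, parity and uniqueness -/

namespace GFM

variable {n : ℕ} {M : GFM n}

/-- At a generic jet the vectors `K^{·,m}` cannot be annihilated modulo those of lower order. -/
theorem PeriodBasis.coeff_eq_zero (P : M.PeriodBasis) {q : Jet n} (hq : q 0 ∈ P.D)
    {π ℓ : Fin n → V n} (h : IsFrame M (q 0) π ℓ)
    (hinj : Function.Injective fun i => ℓ i ⬝ᵥ M.E (q 0)) (hne : ∀ i, ℓ i ⬝ᵥ q 1 ≠ 0)
    (a : ℕ → V n) (m : ℕ)
    (ha : ∀ l ∈ P.W, ∑ s ∈ Finset.range (m + 1), ∑ γ, a s γ * P.K γ s l q = 0) : a m = 0 := by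
  -- Order m + 1 rather than m ensures that the curve has velocity q 1 even when m = 0.
  set v := jetCurve q (m + 1) with hv
  have hq' : v 0 = q 0 := jetCurve_zero q _
  have hva : AnalyticAt ℂ v 0 := analyticAt_jetCurve q _ 0
  have hvM : v 0 ∈ M.domain := by rw [hq']; exact P.D_subset hq
  -- This is the relation multiplied by det(U - l)^{m+1}: entire in l, hence zero everywhere because
  -- it vanishes on the open set W.
  set Φ : ℂ → ℂ := fun l => ∑ s ∈ Finset.range (m + 1), ∑ γ,
    a s γ * (M.curveDet v (0, l) ^ (m - s) * M.kNum v s l γ ()) with hΦ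
  have hΔan : ∀ l, AnalyticAt ℂ (fun l => M.curveDet v (0, l)) l := fun l =>
    AnalyticAt.fun_comp (f := fun l : ℂ => ((0, l) : ℂ × ℂ)) (analyticAt_curveDet hva hvM)
      (analyticAt_const.prod analyticAt_id)
  have hΦan : AnalyticOnNhd ℂ Φ Set.univ := fun l _ =>
    Finset.analyticAt_fun_sum _ fun s _ => Finset.analyticAt_fun_sum _ fun γ _ =>
      analyticAt_const.mul (((hΔan l).pow _).mul (analyticAt_kNum hva hvM s γ))
  have hΦW : ∀ l ∈ P.W, Φ l = 0 := by
    intro l hl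
    have hΔ : M.curveDet v (0, l) ≠ 0 := by
      have := P.det_ne_zero hq hl
      rwa [← hq'] at this
    have h1 : Φ l = M.curveDet v (0, l) ^ (m + 1)
        * ∑ s ∈ Finset.range (m + 1), ∑ γ, a s γ * P.K γ s l q := by
      simp only [hΦ, Finset.mul_sum]
      refine Finset.sum_congr rfl fun s hs => Finset.sum_congr rfl fun γ _ => ?_
      have hs' : s ≤ m := Nat.lt_succ_iff.mp (Finset.mem_range.mp hs)
      rw [PeriodBasis.K_eq hq hl (hs'.trans (Nat.le_succ m)) γ, ← hv]
      have h2 : M.curveDet v (0, l) ^ (m + 1)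
          = M.curveDet v (0, l) ^ (m - s) * M.curveDet v (0, l) ^ (s + 1) := by
        rw [← pow_add]; congr 1; omega
      have h3 : M.curveDet v (0, l) ^ (s + 1) * (M.curveDet v (0, l))⁻¹ ^ (s + 1) = 1 := by
        rw [← mul_pow, mul_inv_cancel₀ hΔ, one_pow]
      rw [h2]
      linear_combination (-(a s γ * M.curveDet v (0, l) ^ (m - s) * M.kNum v s l γ ())) * h3
    rw [h1, ha l hl, mul_zero]
  obtain ⟨l₀, hl₀⟩ := P.nonempty_W
  have hΦ0 : ∀ l, Φ l = 0 := fun l =>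
    hΦan.eqOn_zero_of_preconnected_of_eventuallyEq_zero isPreconnected_univ (Set.mem_univ l₀)
      (by filter_upwards [P.isOpen_W.mem_nhds hl₀] with l hl using hΦW l hl) (Set.mem_univ l)
  have hπ : ∀ i, a m ⬝ᵥ π i = 0 := by
    intro i
    obtain ⟨τ, hτ⟩ := h.isSimpleEigen hinj i
    rw [← hq'] at hτ
    have h1 := hΦ0 (ℓ i ⬝ᵥ M.E (v 0))
    -- At an eigenvalue every term with s < m keeps a positive power of the determinant and
    -- disappears.
    have h2 : M.curveDet v (0, ℓ i ⬝ᵥ M.E (v 0)) = 0 := hτ.det_eq_zero hvM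
    simp only [hΦ, h2] at h1
    rw [Finset.sum_range_succ, Finset.sum_eq_zero, zero_add] at h1
    · simp only [Nat.sub_self, pow_zero, one_mul, hτ.kNum_eq hva hvM, Matrix.smul_apply,
        Matrix.replicateCol_apply, smul_eq_mul] at h1
      have h3 : ∀ b : ℂ, ∑ γ, a m γ * (b * π i γ) = b * (a m ⬝ᵥ π i) := by
        intro b
        rw [dotProduct, Finset.mul_sum]
        exact Finset.sum_congr rfl fun γ _ => by ring
      rw [h3] at h1
      refine (mul_eq_zero.mp h1).resolve_left (mul_ne_zero (mul_ne_zero (pow_ne_zero _ ?_)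
        (mul_ne_zero two_ne_zero (rising_half_ne_zero _))) hτ.ne_zero)
      rw [hv, deriv_jetCurve q (Nat.le_add_left 1 m)]
      exact neg_ne_zero.mpr (mul_ne_zero hτ.ne_zero (hne i))
    · intro s hs
      have : m - s ≠ 0 := by have := Finset.mem_range.mp hs; omega
      simp [zero_pow this]
  refine dotProduct_eq _ _ fun X => ?_
  rw [← h.span X, dotProduct_sum, dotProduct_sum]
  exact Finset.sum_congr rfl fun i _ => by rw [dotProduct_smul, hπ, zero_dotProduct, smul_zero]

variable {ι : Type*} {P : ι → M.PeriodBasis} {Ω : Set (Jet n)}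

/-- The linear part of the loop equation has only the constants as solutions. -/
theorem exists_eq_const_of_loop_linear (hM : M.IsSemisimple) (hP : ∀ v ∈ M.domain, ∃ i, v ∈ (P i).D)
    (hΩ : IsOpen Ω) (hΩc : IsPreconnected Ω) (hΩM : ∀ q ∈ Ω, q 0 ∈ M.domain) {H : Jet n → ℂ}
    (hH : IsJetFunction Ω H)
    (h0 : ∀ i, ∀ q ∈ Ω, q 0 ∈ (P i).D → ∀ l ∈ (P i).W,
      ∑ᶠ s : ℕ, ∑ γ, jpd γ s H q * (P i).K γ s l q = 0) : ∃ a, ∀ q ∈ Ω, H q = a := by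
  obtain ⟨N, hN⟩ := hH.exists_forall_jpd_eq_zero hΩ
  -- Descending induction on the jet order s, written as induction on j.
  have key : ∀ j s, N ≤ s + j → ∀ q ∈ Ω, ∀ γ, jpd γ s H q = 0 := by
    intro j
    induction j with
    | zero => exact hN
    | succ j ih =>
      intro m hm q hq γ
      by_contra hne
      -- A nonzero value would persist on an open set of jets. Inside it, first v is moved to a
      -- point with simple spectrum, then v_x, with v fixed, off the hyperplanes ℓ_i = 0.
      have hO : IsOpen (Ω ∩ jpd γ m H ⁻¹' {0}ᶜ) :=
        (hH.continuousOn_jpd hΩ γ m).isOpen_inter_preimage hΩ isOpen_compl_singleton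
      have hO0 : IsOpen {w | Function.update q 0 w ∈ Ω ∩ jpd γ m H ⁻¹' {0}ᶜ} :=
        hO.preimage (continuous_const.update 0 continuous_id)
      obtain ⟨w, hw, π, ℓ, hfr, hinj⟩ := hM.exists_isFrame_injective hO0
        (fun w hw => by simpa using hΩM _ hw.1) ⟨q 0, by simpa using ⟨hq, hne⟩⟩
      have hO1 : IsOpen {y | Function.update (Function.update q 0 w) 1 y
          ∈ Ω ∩ jpd γ m H ⁻¹' {0}ᶜ} :=
        hO.preimage (continuous_const.update 1 continuous_id)
      obtain ⟨y, hy, hyne⟩ := exists_dotProduct_ne_zero hO1 (y := Function.update q 0 w 1)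
        (by simpa only [Set.mem_ofPred_eq, Function.update_eq_self] using hw) hfr
      set q' : Jet n := Function.update (Function.update q 0 w) 1 y with hq'
      have hq0 : q' 0 = w := by simp [hq']
      have hq1 : q' 1 = y := by simp [hq']
      obtain ⟨i, hi⟩ := hP (q' 0) (hΩM q' hy.1)
      refine hy.2 (congrFun (PeriodBasis.coeff_eq_zero (P i) hi (π := π) (ℓ := ℓ) (by rwa [hq0])
        (by rwa [hq0]) (by rwa [hq1]) (fun s γ => jpd γ s H q') m fun l hl => ?_) γ)
      rw [← h0 i q' hy.1 hi l hl]
      refine (finsum_eq_sum_of_support_subset _ fun s hs => ?_).symm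
      rw [Finset.coe_range, Set.mem_Iio]
      by_contra hs'
      refine hs (Finset.sum_eq_zero fun δ _ => ?_)
      rw [ih s (by omega) q' hy.1, zero_mul]
  exact hH.exists_eq_const hΩ hΩc fun q hq γ s => key N s (Nat.le_add_left N s) q hq γ

/-- The right-hand side of the loop equation. -/
def PeriodBasis.loopRHS (P : M.PeriodBasis) (F : ℕ → Jet n → ℂ) (k : ℕ) (l : ℂ) (q : Jet n) : ℂ :=
  (1 / 2) * (∑ a ∈ Finset.Ico 1 k, ∑ᶠ ij : ℕ × ℕ, ∑ α, ∑ β,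
      jpd α ij.1 (F a) q * jpd β ij.2 (F (k - a)) q * P.quadCoeff α ij.1 β ij.2 l q)
    + (if 3 ≤ k then
        (1 / 2) * (∑ᶠ ij : ℕ × ℕ, ∑ α, ∑ β,
          jpd α ij.1 (jpd β ij.2 (F (k - 2))) q * P.quadCoeff α ij.1 β ij.2 l q)
        + (1 / 2) * (∑ᶠ i : ℕ, ∑ α, jpd α i (F (k - 2)) q * P.linCoeff α i l q)
      else 0)
    + (if k = 2 then
        (1 / 2) * P.starContraction (q 0) l - M.trConst (q 0) / (4 * l ^ 2)
      else 0)

theorem PeriodBasis.loopEquation_iff (P : M.PeriodBasis) (F : ℕ → Jet n → ℂ) (k : ℕ) (l : ℂ)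
    (q : Jet n) : P.LoopEquation F k l q
      ↔ ∑ᶠ s : ℕ, ∑ γ, jpd γ s (F k) q * P.K γ s l q = P.loopRHS F k l q := Iff.rfl

/-- Only the coefficients with 1 ≤ a < k enter, and only through derivatives, so additive constants
are invisible. -/
theorem PeriodBasis.loopRHS_congr (P : M.PeriodBasis) (hΩ : IsOpen Ω) {F G : ℕ → Jet n → ℂ} {k : ℕ}
    (h : ∀ a, 1 ≤ a → a < k → ∃ c : ℂ, ∀ q ∈ Ω, G a q = F a q + c) (l : ℂ) {q : Jet n}
    (hq : q ∈ Ω) : P.loopRHS G k l q = P.loopRHS F k l q := by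
  have h1 : ∀ a, 1 ≤ a → a < k → ∀ q ∈ Ω, ∀ α s, jpd α s (G a) q = jpd α s (F a) q := by
    intro a ha hak q hq α s
    obtain ⟨c, hc⟩ := h a ha hak
    exact jpd_congr hΩ hc hq α s
  unfold PeriodBasis.loopRHS
  congr 2
  · congr 1
    refine Finset.sum_congr rfl fun a ha => ?_
    obtain ⟨ha1, hak⟩ := Finset.mem_Ico.mp ha
    simp only [h1 a ha1 hak q hq, h1 (k - a) (by omega) (by omega) q hq]
  · split_ifs with hk
    · have h2 : ∀ α s β t, jpd α s (jpd β t (G (k - 2))) q = jpd α s (jpd β t (F (k - 2))) q :=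
        fun α s β t => jpd_congr (a := 0) hΩ
          (fun q hq => by rw [h1 (k - 2) (by omega) (by omega) q hq, add_zero]) hq α s
      simp only [h1 (k - 2) (by omega) (by omega) q hq, h2]
    · rfl

/-- If k is odd, one of a and k - a is odd, k - 2 is odd, and the inhomogeneous term, present only
for k = 2, is absent. -/
theorem PeriodBasis.loopRHS_eq_zero_of_odd (P : M.PeriodBasis) {G : ℕ → Jet n → ℂ}
    (hG : ∀ k, ¬ Even k → G k = 0) {k : ℕ} (hk : ¬ Even k) (l : ℂ) (q : Jet n) :
    P.loopRHS G k l q = 0 := by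
  have h0 : ∀ β t, jpd β t (0 : Jet n → ℂ) = 0 := fun β t => funext fun q => jpd_zero β t q
  have h1 : ∀ a ∈ Finset.Ico 1 k, (∑ᶠ ij : ℕ × ℕ, ∑ α, ∑ β,
      jpd α ij.1 (G a) q * jpd β ij.2 (G (k - a)) q * P.quadCoeff α ij.1 β ij.2 l q) = 0 := by
    intro a ha
    obtain ⟨ha1, hak⟩ := Finset.mem_Ico.mp ha
    by_cases hae : Even a
    · have : ¬ Even (k - a) := fun h => hk (by
        have := h.add hae
        rwa [Nat.sub_add_cancel hak.le] at this)
      simp [hG _ this, h0]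
    · simp [hG _ hae, h0]
  have h2 : k ≠ 2 := fun h => hk (h ▸ even_two)
  unfold PeriodBasis.loopRHS
  rw [Finset.sum_eq_zero h1, if_neg h2]
  split_ifs with h3
  · have : ¬ Even (k - 2) := fun h => hk (by
      have := h.add even_two
      rwa [Nat.sub_add_cancel (by omega)] at this)
    simp [hG _ this, h0]
  · simp

theorem genusSeries_of_even (F : ℕ → Jet n → ℂ) {k : ℕ} (hk : Even k) :
    genusSeries (fun g => F (2 * g)) k = F k := by
  rw [genusSeries, if_pos hk, Nat.two_mul_div_two_of_even hk]

theorem genusSeries_of_not_even (F : ℕ → Jet n → ℂ) {k : ℕ} (hk : ¬ Even k) :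
    genusSeries F k = 0 := by
  rw [genusSeries, if_neg hk]

/-- Treating all k together lets the induction hypothesis replace every lower coefficient at once by
its counterpart in the even series, after which the right-hand side at odd k is zero. -/
theorem IsLoopSolution.odd_eq_const (hM : M.IsSemisimple) (hP : ∀ v ∈ M.domain, ∃ i, v ∈ (P i).D)
    (hΩ : IsOpen Ω) (hΩc : IsPreconnected Ω) (hΩM : ∀ q ∈ Ω, q 0 ∈ M.domain) {F : ℕ → Jet n → ℂ}
    (hF : IsLoopSolution P Ω F) (k : ℕ) : 1 ≤ k →
      ∃ c : ℂ, ∀ q ∈ Ω, genusSeries (fun g => F (2 * g)) k q = F k q + c := by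
  induction k using Nat.strong_induction_on with
  | _ k ih =>
    intro hk1
    by_cases hk : Even k
    · exact ⟨0, fun q _ => by rw [genusSeries_of_even F hk, add_zero]⟩
    · obtain ⟨a, ha⟩ := exists_eq_const_of_loop_linear hM hP hΩ hΩc hΩM (hF k hk1).1
        fun i q hq hqi l hl => by
          rw [((P i).loopEquation_iff F k l q).mp ((hF k hk1).2 i q hq hqi l hl),
            ← (P i).loopRHS_congr hΩ (fun a ha hak => ih a hak ha) l hq,
            (P i).loopRHS_eq_zero_of_odd (fun _ => genusSeries_of_not_even _) hk]
      exact ⟨-a, fun q hq => by rw [genusSeries_of_not_even _ hk, ha q hq]; simp⟩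

theorem IsLoopSolution.genusSeries (hM : M.IsSemisimple) (hP : ∀ v ∈ M.domain, ∃ i, v ∈ (P i).D)
    (hΩ : IsOpen Ω) (hΩc : IsPreconnected Ω) (hΩM : ∀ q ∈ Ω, q 0 ∈ M.domain) {F : ℕ → Jet n → ℂ}
    (hF : IsLoopSolution P Ω F) : IsLoopSolution P Ω (genusSeries fun g => F (2 * g)) := by
  intro k hk1
  by_cases hk : Even k
  · rw [genusSeries_of_even F hk]
    refine ⟨(hF k hk1).1, fun i q hq hqi l hl => ?_⟩
    rw [PeriodBasis.loopEquation_iff, genusSeries_of_even F hk, (P i).loopRHS_congr hΩ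
      (fun a ha _ => hF.odd_eq_const hM hP hΩ hΩc hΩM a ha) l hq]
    exact (hF k hk1).2 i q hq hqi l hl
  · rw [genusSeries_of_not_even _ hk]
    refine ⟨isJetFunction_zero, fun i q hq hqi l hl => ?_⟩
    rw [PeriodBasis.loopEquation_iff, genusSeries_of_not_even _ hk,
      (P i).loopRHS_eq_zero_of_odd (fun _ => genusSeries_of_not_even _) hk]
    simp [jpd_zero]

/-- By induction both solutions have the same right-hand side at order k, so the difference of the
k-th coefficients satisfies the homogeneous linear equation. -/
theorem IsLoopSolution.sub_eq_const (hM : M.IsSemisimple) (hP : ∀ v ∈ M.domain, ∃ i, v ∈ (P i).D)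
    (hΩ : IsOpen Ω) (hΩc : IsPreconnected Ω) (hΩM : ∀ q ∈ Ω, q 0 ∈ M.domain) {F F' : ℕ → Jet n → ℂ}
    (hF : IsLoopSolution P Ω F) (hF' : IsLoopSolution P Ω F') (k : ℕ) : 1 ≤ k →
      ∃ c : ℂ, ∀ q ∈ Ω, F' k q = F k q + c := by
  induction k using Nat.strong_induction_on with
  | _ k ih =>
    intro hk1
    obtain ⟨a, ha⟩ := exists_eq_const_of_loop_linear hM hP hΩ hΩc hΩM
      ((hF' k hk1).1.sub (hF k hk1).1) fun i q hq hqi l hl => by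
        obtain ⟨N, hN⟩ := (hF k hk1).1.exists_forall_jpd_eq_zero hΩ
        obtain ⟨N', hN'⟩ := (hF' k hk1).1.exists_forall_jpd_eq_zero hΩ
        -- `finsum` is additive only on finite supports; they are finite because jet functions
        -- involve finitely many variables.
        have hfin : ∀ {G : Jet n → ℂ} {N : ℕ}, (∀ s, N ≤ s → ∀ q ∈ Ω, ∀ γ, jpd γ s G q = 0) →
            (Function.support fun s => ∑ γ, jpd γ s G q * (P i).K γ s l q).Finite := by
          intro G N hG
          refine (Set.finite_Iio N).subset fun s hs => ?_
          by_contra hs'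
          exact hs (Finset.sum_eq_zero fun γ _ => by
            rw [hG s (not_lt.mp hs') q hq, zero_mul])
        simp only [jpd_sub hΩ (hF' k hk1).1 (hF k hk1).1 hq, sub_mul, Finset.sum_sub_distrib]
        rw [finsum_sub_distrib (hfin hN') (hfin hN),
          ((P i).loopEquation_iff F k l q).mp ((hF k hk1).2 i q hq hqi l hl),
          ((P i).loopEquation_iff F' k l q).mp ((hF' k hk1).2 i q hq hqi l hl),
          (P i).loopRHS_congr hΩ (fun a ha hak => ih a hak ha) l hq, sub_self]
    exact ⟨a, fun q hq => by rw [← ha q hq]; ring⟩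

end GFM

end GenFrob

end

theorem mainTheorem2 {n : ℕ} (M : GenFrob.GFM n) (hM : M.IsSemisimple)
    {ι : Type*} (P : ι → M.PeriodBasis) (hP : ∀ v ∈ M.domain, ∃ i, v ∈ (P i).D)
    (Ω : Set (GenFrob.Jet n)) (hΩ : IsOpen Ω) (hΩc : IsPreconnected Ω)
    (hΩM : ∀ q ∈ Ω, q 0 ∈ M.domain) :
    (∀ F : ℕ → GenFrob.Jet n → ℂ, GenFrob.GFM.IsLoopSolution P Ω F →
      (∀ k, 1 ≤ k → ∃ a : ℂ, ∀ q ∈ Ω, F (2 * k - 1) q = a) ∧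
      GenFrob.GFM.IsLoopSolution P Ω (GenFrob.genusSeries fun g => F (2 * g))) ∧
    (∀ F F' : ℕ → GenFrob.Jet n → ℂ,
      GenFrob.GFM.IsLoopSolution P Ω F → GenFrob.GFM.IsLoopSolution P Ω F' →
      ∀ k, 1 ≤ k → ∃ a : ℂ, ∀ q ∈ Ω, F' k q = F k q + a) := by
  refine ⟨fun F hF => ⟨fun k hk => ?_, hF.genusSeries hM hP hΩ hΩc hΩM⟩,
    fun F F' hF hF' k => hF.sub_eq_const hM hP hΩ hΩc hΩM hF' k⟩
  obtain ⟨c, hc⟩ := hF.odd_eq_const hM hP hΩ hΩc hΩM (2 * k - 1) (by omega)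
  refine ⟨-c, fun q hq => ?_⟩
  have h1 := hc q hq
  rw [GenFrob.GFM.genusSeries_of_not_even _ (by rw [Nat.not_even_iff_odd]; exact ⟨k - 1, by omega⟩)]
    at h1
  exact eq_neg_of_add_eq_zero_left h1.symm
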